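/- Let $X$ be a finite $T_0$ topological space (equivalently, a finite poset), ordered by $p\le q$ iff $p\in\overline{\{q\}}$; put $C_x=\overline{\{x\}}=\{p\in X: p\le x\}$ and let $n=\dim X$ be the maximal length of a chain $x_0<\cdots<x_n$ in $X$ (with $\dim\emptyset=0$). An abelian data on $X$ is a functor $F$ from $X$ (viewed as a category through its order) to abelian groups; let $D(X)$ be the unbounded derived category of abelian data on $X$, let $D(\mathbb Z)$ be the derived category of abelian groups, and let $R\Gamma(X,-)\colon D(X)\to D(\mathbb Z)$ be the right derived functor of $\Gamma(X,F)=\varprojlim_{p\in X}F_p$. For $x\in X$ let $\mathbb Z_{C_x}$ be the abelian data equal to $\mathbb Z$ at the points of $C_x$ and to $0$ elsewhere, whose restriction maps are the identity between points of $C_x$ and zero otherwise. The dualizing complex $D_X\in D(X)$ is the object representing $R\Gamma(X,-)^\vee$, that is, $\operatorname{Hom}_{D(\mathbb Z)}(R\Gamma(X,F),\mathbb Z)\cong\operatorname{Hom}_{D(X)}(F,D_X)$ naturally in $F\in D(X)$. Then $D_X$ exists and is isomorphic in $D(X)$ to a complex of abelian data $$0\to D_X^{-n}\to\cdots\to D_X^{0}\to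 0,\qquad D_X^{-p}\cong\bigoplus_{x_0<\cdots<x_p}\mathbb Z_{C_{x_p}},$$ where the sum runs over the chains $x_0<\cdots<x_p$ of points of $X$. In particular, $D_X$ is of finite type (the groups $H^i((D_X)_x)$ are finitely generated for all $i\in\mathbb Z$, $x\in X$) and has amplitude $[-n,0]$ ($H^i(D_X)=0$ for $i\notin[-n,0]$). -/

import Mathlib

open CategoryTheory CategoryTheory.Limits

universe w₁ w₂ u

namespace FiniteSpace

/-- Abelian data on a space `X`: functors from `X`, viewed as a category through the
specialization preorder (`p ≤ q` iff the closure of `p` is contained in the closure of `q`),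
to abelian groups. -/
abbrev AbData (X : Type u) [TopologicalSpace X] : Type (u + 1) :=
  Specialization X ⥤ AddCommGrpCat.{u}

section Basic

variable (X : Type u) [TopologicalSpace X]

/-- The chains `x₀ < ⋯ < x_p` of points of `X` for the specialization order. -/
abbrev Chain (p : ℕ) : Type u :=
  {c : Fin (p + 1) → Specialization X // StrictMono c}

instance [Finite X] : Finite (Specialization X) := inferInstanceAs (Finite X)

instance : HasFiniteBiproducts (AbData X) := Abelian.hasFiniteBiproducts

/-- The last point `x_p` of a chain. -/
def Chain.last {X : Type u} [TopologicalSpace X] {p : ℕ} (c : Chain X p) : X :=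
  Specialization.ofEquiv (c.1 (Fin.last p))

/-- The dimension of a finite space: the maximum of the lengths `p` of the chains
`x₀ < ⋯ < x_p`. (It is `0` for the empty space.) -/
noncomputable def dim : ℕ := sSup {p : ℕ | Nonempty (Chain X p)}

/-- The group `ℤ`, in the universe of `X`. -/
abbrev zGroup : AddCommGrpCat.{u} := AddCommGrpCat.of (ULift.{u} ℤ)

/-- The constant abelian data `G`. -/
abbrev constData (G : AddCommGrpCat.{u}) : AbData X :=
  (Functor.const (Specialization X)).obj G

variable {X}

/-- A locally closed subset is convex for the specialization preorder. -/
lemma mem_of_isLocallyClosed {S : Set X} (hS : IsLocallyClosed S) {p q l : Specialization X}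
    (hpq : p ≤ q) (hql : q ≤ l) (hp : Specialization.ofEquiv p ∈ S)
    (hl : Specialization.ofEquiv l ∈ S) : Specialization.ofEquiv q ∈ S := by
  obtain ⟨U, Z, hU, hZ, rfl⟩ := hS
  have h₁ : Specialization.ofEquiv q ⤳ Specialization.ofEquiv p := hpq
  have h₂ : Specialization.ofEquiv l ⤳ Specialization.ofEquiv q := hql
  exact ⟨h₁.mem_open hU hp.1, h₂.mem_closed hZ hl.2⟩

/-- The group `(F_S)_p`, as a subgroup of `F_p`: it is `F_p` if `p ∈ S`, and zero otherwise. -/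
def supportSubgroup (F : AbData X) (S : Set X) (p : Specialization X) :
    AddSubgroup (F.obj p) where
  carrier := {g | Specialization.ofEquiv p ∉ S → g = 0}
  zero_mem' := fun _ => rfl
  add_mem' := fun ha hb h => by rw [ha h, hb h, add_zero]
  neg_mem' := fun ha h => by rw [ha h, neg_zero]

open Classical in
/-- The restriction `(F_S)_p ⟶ (F_S)_q`: the one of `F` if `p, q ∈ S`, and zero otherwise. -/
noncomputable def supportMap (F : AbData X) (S : Set X) {p q : Specialization X} (f : p ⟶ q) :
    supportSubgroup F S p →+ supportSubgroup F S q where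
  toFun g := ⟨if Specialization.ofEquiv q ∈ S then F.map f g.1 else 0, fun h => if_neg h⟩
  map_zero' := by ext; simp
  map_add' a b := by
    ext
    by_cases h : Specialization.ofEquiv q ∈ S <;> simp [h]

/-- The abelian data `F_S` obtained by supporting `F` on a locally closed subset `S`. -/
noncomputable def supportOn (F : AbData X) (S : Set X) (hS : IsLocallyClosed S) : AbData X where
  obj p := AddCommGrpCat.of (supportSubgroup F S p)
  map f := AddCommGrpCat.ofHom (supportMap F S f)
  map_id p := by
    ext g
    by_cases h : Specialization.ofEquiv p ∈ S
    · simp [supportMap, h]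
    · simp [supportMap, h, g.2 h]
  map_comp {p q l} f g := by
    ext a
    by_cases hl : Specialization.ofEquiv l ∈ S
    · by_cases hp : Specialization.ofEquiv p ∈ S
      · have hq := mem_of_isLocallyClosed hS (leOfHom f) (leOfHom g) hp hl
        simp [supportMap, hl, hq]
      · simp [supportMap, a.2 hp]
    · simp [supportMap, hl]

/-- The abelian data `ℤ_{C_x}`: the constant abelian data `ℤ` supported on the closure `C_x`
of the point `x`. -/
noncomputable def zClosure (x : X) : AbData X :=
  supportOn (constData X zGroup.{u}) (closure {x}) isClosed_closure.isLocallyClosed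

end Basic

section Derived

variable (X : Type u) [TopologicalSpace X]

/-- The functor of global sections `Γ(X, F) = lim_{p ∈ X} F_p`. -/
noncomputable abbrev sections : AbData X ⥤ AddCommGrpCat.{u} := lim

instance : (sections X).Additive :=
  Functor.additive_of_preserves_binary_products _

variable [HasDerivedCategory.{w₁} (AbData X)] [HasDerivedCategory.{w₂} AddCommGrpCat.{u}]

/-- The functor `C(X) ⥤ D(ℤ)` sending a complex `F` to the class of the complex `Γ(X, F)`. -/
noncomputable abbrev sectionsQ :
    CochainComplex (AbData X) ℤ ⥤ DerivedCategory AddCommGrpCat.{u} :=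
  (sections X).mapHomologicalComplex (ComplexShape.up ℤ) ⋙ DerivedCategory.Q

variable {X}

/-- `D` is a dualizing complex of `X`: it represents the functor
`F ↦ Hom(RΓ(X, F), ℤ)` on `D(X)`, where `RΓ(X, -) : D(X) ⥤ D(ℤ)` is the (total, unbounded)
right derived functor of `Γ(X, -)`. In other words, `D` is the value at `ℤ` of the right adjoint
of `RΓ(X, -)`. (By the universal properties, `RΓ(X, -)` is unique up to unique isomorphism,
and so is `D`.) -/
def IsDualizingComplex (D : DerivedCategory (AbData X)) : Prop :=
  ∃ (RΓ : DerivedCategory (AbData X) ⥤ DerivedCategory AddCommGrpCat.{u})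
    (α : sectionsQ X ⟶ DerivedCategory.Q ⋙ RΓ),
    RΓ.IsRightDerivedFunctor α
        (HomologicalComplex.quasiIso (AbData X) (ComplexShape.up ℤ)) ∧
      Nonempty ((RΓ.op ⋙ yoneda.obj
        ((DerivedCategory.singleFunctor AddCommGrpCat.{u} 0).obj zGroup.{u})).RepresentableBy D)

/-- The stalk `F_x` in `D(ℤ)` of `F` in `D(X)`. -/
noncomputable def stalk (x : X) (F : DerivedCategory (AbData X)) :
    DerivedCategory AddCommGrpCat.{u} :=
  (((evaluation (Specialization X) AddCommGrpCat.{u}).obj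
    (Specialization.toEquiv x)).mapDerivedCategory).obj F

/-- `F` is of finite type: all the groups `Hⁱ(F_x)` are finitely generated. -/
def IsOfFiniteType (F : DerivedCategory (AbData X)) : Prop :=
  ∀ (i : ℤ) (x : X),
    AddGroup.FG ((DerivedCategory.homologyFunctor AddCommGrpCat.{u} i).obj (stalk x F))

/-- `F` has amplitude `[a, b]`: `Hⁱ(F) = 0` for `i` outside of `[a, b]`. -/
def HasAmplitude (F : DerivedCategory (AbData X)) (a b : ℤ) : Prop :=
  ∀ i : ℤ, i ∉ Set.Icc a b →
    IsZero ((DerivedCategory.homologyFunctor (AbData X) i).obj F)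

end Derived

end FiniteSpace

/-! Derived global sections of a finite poset can be computed by cochains on chains of points. For a
complex of abelian data `F` and a point `p`, or `p = ⊥` for the whole space, let `C(p, F)` be the
total complex (`cochainComplex`) with one column, the value of `F` at the last point, for every
chain of points above `p`. There are finitely many columns, so `C(p, -)` preserves
quasi-isomorphisms between unbounded complexes (`quasiIso_totalMap`) and `C(⊥, -)` descends to
derived categories without any injective resolution.

The descended functor is the right derived functor of global sections for the following reason. Let
`R F` be the diagram sending `p` to `C(p, F)`. Since `p` is the least of the points above it,
inserting `p` into chains is a contraction, so `j : F ⟶ R F` is a quasi-isomorphism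
(`quasiIso_aug_pointCone`). There are natural maps `a : Γ(F) ⟶ C(⊥, F)` and `r : C(⊥, F) ⟶ Γ(R F)`.
The composite `a ≫ r` equals `Γ(j)`, and `r` followed by `a` for `R F` is homotopic to `C(⊥, j)`.
The homotopy sends `v` to `±v(c ∪ d)`, where `c` lies strictly below `d` (`Cochain.D_join`,
`joinHomotopy`). These two identities formally give the universal property
(`isRightDerivedFunctor_of_resolution`).

The functor `F ↦ F_x` has a right adjoint, which places a group on the points `p ≤ x`. Hence `C(⊥,
-)` has, already on complexes, an explicit right adjoint `dualFunctor`: the column of a chain of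
dimension `k` sits in degree `-k` and is supported on the closure of its last point. It too has
finitely many columns and preserves quasi-isomorphisms, so the adjunction passes to derived
categories (`derivedDualAdjunction`). Its value at `ℤ` is the dualizing complex; terms, finiteness
and amplitude are read off from the formula. Uniqueness of derived functors and of representing
objects transfers them to every dualizing complex. -/

namespace FiniteSpace

/-! ### Quasi-isomorphisms of complexes of abelian groups in terms of elements. -/

section QuasiIso

variable {K L : CochainComplex AddCommGrpCat.{u} ℤ} (φ : K ⟶ L)

/-- The mapping cone of `φ` is acyclic, expressed with elements. -/
def ConeAcyclic : Prop :=
  ∀ (a b c d : ℤ), a + 1 = b → b + 1 = c → c + 1 = d → ∀ (x : K.X c) (y : L.X b),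
    K.d c d x = 0 → φ.f c x = L.d b c y →
      ∃ (x' : K.X b) (y' : L.X a), K.d b c x' = x ∧ y = φ.f b x' + L.d a b y'

/-- Exactness up to refinements asks for a solution after pulling back along an epimorphism. The
fibre product of `f` and `g` is such a refinement: its projection is onto because the equation is
solvable element by element. -/
lemma exists_pullback_epi {A B C : AddCommGrpCat.{u}} (f : A ⟶ C) (g : B ⟶ C)
    (h : ∀ a : A, ∃ b : B, f a = g b) :
    ∃ (A' : AddCommGrpCat.{u}) (π : A' ⟶ A) (_ : Epi π) (q : A' ⟶ B), π ≫ f = q ≫ g := by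
  let S : AddSubgroup (A × B) :=
    AddMonoidHom.ker (f.hom.comp (AddMonoidHom.fst A B) - g.hom.comp (AddMonoidHom.snd A B))
  refine ⟨AddCommGrpCat.of S, AddCommGrpCat.ofHom ((AddMonoidHom.fst A B).comp S.subtype), ?_,
    AddCommGrpCat.ofHom ((AddMonoidHom.snd A B).comp S.subtype), ?_⟩
  · rw [AddCommGrpCat.epi_iff_surjective]
    intro a
    obtain ⟨b, hb⟩ := h a
    exact ⟨⟨(a, b), sub_eq_zero.2 hb⟩, rfl⟩
  · ext ⟨⟨a, b⟩, h⟩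
    exact sub_eq_zero.1 h

/-- The morphism `ℤ ⟶ A` corresponding to an element. -/
def elementHom {A : AddCommGrpCat.{u}} (a : A) : AddCommGrpCat.of (ULift.{u} ℤ) ⟶ A :=
  AddCommGrpCat.ofHom ((zmultiplesHom A a).comp AddEquiv.ulift.toAddMonoidHom)

lemma elementHom_one {A : AddCommGrpCat.{u}} (a : A) : elementHom a ⟨1⟩ = a :=
  one_zsmul a

lemma elementHom_comp {A B : AddCommGrpCat.{u}} (a : A) (f : A ⟶ B) :
    elementHom a ≫ f = elementHom (f a) := by
  ext ⟨n⟩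
  exact map_zsmul f.hom n a

lemma elementHom_zero {A : AddCommGrpCat.{u}} : elementHom (0 : A) = 0 := by
  ext ⟨n⟩
  exact zsmul_zero n

/-- Injectivity on cohomology in degree `c` makes `x` a boundary `d x₁`; then `y - φ x₁` is a
cocycle, and surjectivity in degree `b` makes it cohomologous to an image. Elements enter the
categorical criteria as morphisms from `ℤ`. -/
lemma coneAcyclic_of_quasiIso [QuasiIso φ] : ConeAcyclic φ := by
  intro a b c d hab hbc hcd x y hx hy
  have h₁ : Mono (HomologicalComplex.homologyMap φ c) := inferInstance
  have h₂ : Epi (HomologicalComplex.homologyMap φ b) := inferInstance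
  rw [HomologicalComplex.mono_homologyMap_iff_up_to_refinements φ b c d (by simp; omega)
    (by simp; omega)] at h₁
  rw [HomologicalComplex.epi_homologyMap_iff_up_to_refinements φ a b c (by simp; omega)
    (by simp; omega)] at h₂
  obtain ⟨A', π, hπ, x₁, h⟩ := h₁ (elementHom x) (by rw [elementHom_comp, hx, elementHom_zero])
    (elementHom y) (by rw [elementHom_comp, elementHom_comp, hy])
  -- Evaluating the refined equation at a preimage of the generator gives an equation about `x`
  -- itself.
  obtain ⟨t, ht⟩ := (AddCommGrpCat.epi_iff_surjective π).1 hπ ⟨1⟩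
  have e : x = K.d b c (x₁ t) := by
    have := ConcreteCategory.congr_hom h t
    simp only [ConcreteCategory.comp_apply] at this
    rw [ht, elementHom_one] at this
    exact this
  have hz : L.d b c (y - φ.f b (x₁ t)) = 0 := by
    rw [map_sub, ← hy, e]
    exact sub_eq_zero.2 (ConcreteCategory.congr_hom (φ.comm b c) (x₁ t)).symm
  obtain ⟨A'', ρ, hρ, x₂, hx₂, y₁, h'⟩ := h₂ (elementHom (y - φ.f b (x₁ t)))
    (by rw [elementHom_comp, hz, elementHom_zero])
  obtain ⟨s, hs⟩ := (AddCommGrpCat.epi_iff_surjective ρ).1 hρ ⟨1⟩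
  have e' : y - φ.f b (x₁ t) = φ.f b (x₂ s) + L.d a b (y₁ s) := by
    have := ConcreteCategory.congr_hom h' s
    simp only [ConcreteCategory.comp_apply] at this
    rw [hs, elementHom_one] at this
    exact this
  refine ⟨x₁ t + x₂ s, y₁ s, ?_, ?_⟩
  · rw [map_add, ← e]
    have := ConcreteCategory.congr_hom hx₂ s
    simp only [ConcreteCategory.comp_apply] at this
    rw [this]
    exact add_zero x
  · rw [map_add, add_assoc, ← e', add_sub_cancel]

/-- A cocycle `x` whose image is the boundary of `y` yields injectivity on cohomology; the case `x =
0`, with `y` a cocycle, yields surjectivity. -/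
lemma quasiIso_of_coneAcyclic (h : ConeAcyclic φ) : QuasiIso φ := by
  refine ⟨fun n => ?_⟩
  rw [quasiIsoAt_iff_isIso_homologyMap]
  have h₁ : Mono (HomologicalComplex.homologyMap φ n) := by
    rw [HomologicalComplex.mono_homologyMap_iff_up_to_refinements φ (n - 1) n (n + 1) (by simp)
      (by simp)]
    intro A x₂ hx₂ y₁ hy₁
    refine exists_pullback_epi _ _ fun t => ?_
    obtain ⟨x', y', e, -⟩ := h (n - 1 - 1) (n - 1) n (n + 1) (by omega) (by omega) rfl (x₂ t) (y₁ t)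
      (ConcreteCategory.congr_hom hx₂ t) (ConcreteCategory.congr_hom hy₁ t)
    exact ⟨x', e.symm⟩
  have h₂ : Epi (HomologicalComplex.homologyMap φ n) := by
    rw [HomologicalComplex.epi_homologyMap_iff_up_to_refinements φ (n - 1) n (n + 1) (by simp)
      (by simp)]
    intro A y₂ hy₂
    obtain ⟨A', π, hπ, q, hq⟩ := exists_pullback_epi y₂
      (AddCommGrpCat.ofHom (AddMonoidHom.coprod ((φ.f n).hom.comp
        (AddMonoidHom.ker (K.d n (n + 1)).hom).subtype) (L.d (n - 1) n).hom) :
        AddCommGrpCat.of (AddMonoidHom.ker (K.d n (n + 1)).hom × L.X (n - 1)) ⟶ L.X n)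
      (fun t => by
        obtain ⟨x', y', e, e'⟩ := h (n - 1) n (n + 1) (n + 2) (by omega) rfl (by omega) 0 (y₂ t)
          (map_zero _) (by
            rw [map_zero]
            exact (ConcreteCategory.congr_hom hy₂ t).symm)
        exact ⟨(⟨x', e⟩, y'), e'⟩)
    refine ⟨A', π, hπ, q ≫ AddCommGrpCat.ofHom ((AddMonoidHom.ker (K.d n (n + 1)).hom).subtype.comp
      (AddMonoidHom.fst _ _)), ?_, q ≫ AddCommGrpCat.ofHom (AddMonoidHom.snd _ _), ?_⟩
    · ext t
      exact (q t).1.2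
    · rw [hq]
      ext t
      rfl
  exact isIso_of_mono_of_epi _

end QuasiIso

end FiniteSpace

/-! ### Twisted complexes and their total complexes. -/

namespace FiniteSpace

/-- A finite family of complexes of abelian groups, indexed by a graded set, with morphisms
`δ i j` of degree one such that `δ² = 0`. -/
structure TwistedComplex {J : Type u} [Fintype J] (deg : J → ℤ) where
  /-- the complexes -/
  obj : J → CochainComplex AddCommGrpCat.{u} ℤ
  /-- the twisting morphisms -/
  δ : ∀ i j, obj i ⟶ obj j
  δ_eq_zero : ∀ i j, deg j ≠ deg i + 1 → δ i j = 0
  δ_comp_δ : ∀ i k, ∑ j, δ i j ≫ δ j k = 0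

namespace TwistedComplex

variable {J : Type u} [Fintype J] {deg : J → ℤ}

/-- Morphisms of twisted complexes. -/
@[ext]
structure Hom (M N : TwistedComplex deg) where
  /-- the components -/
  app : ∀ i, M.obj i ⟶ N.obj i
  comm : ∀ i j, M.δ i j ≫ app j = app i ≫ N.δ i j

instance : Category (TwistedComplex deg) where
  Hom := Hom
  id M := { app := fun _ => 𝟙 _, comm := by simp }
  comp f g :=
    { app := fun i => f.app i ≫ g.app i
      comm := fun i j => by rw [reassoc_of% f.comm i j, g.comm, Category.assoc] }
  id_comp f := Hom.ext (by ext; simp)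
  comp_id f := Hom.ext (by ext; simp)
  assoc f g h := Hom.ext (by ext; simp)

variable (M N P : TwistedComplex deg)

/-- The families of elements of all degrees of the complexes of a twisted complex. -/
abbrev Family : Type u := ∀ (i : J) (q : ℤ), (M.obj i).X q

/-- The sign `(-1)^(deg i)`. -/
def sgn (deg : J → ℤ) (i : J) : ℤ := ((deg i).negOnePow : ℤ)

/-- The total differential, without reference to degrees. -/
def D : M.Family →+ M.Family where
  toFun f i q := sgn deg i • (M.obj i).d (q - 1) q (f i (q - 1)) + ∑ j, (M.δ j i).f q (f j q)
  map_zero' := by ext; simp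
  map_add' f g := by
    ext i q
    simp only [Pi.add_apply, map_add, smul_add, Finset.sum_add_distrib]
    abel

lemma D_apply (f : M.Family) (i : J) (q : ℤ) :
    M.D f i q =
      sgn deg i • (M.obj i).d (q - 1) q (f i (q - 1)) + ∑ j, (M.δ j i).f q (f j q) := rfl

/-- The evaluation of morphisms of complexes at an element. -/
def evalAddHom (K L : CochainComplex AddCommGrpCat.{u} ℤ) (q : ℤ) (x : K.X q) :
    (K ⟶ L) →+ L.X q where
  toFun φ := φ.f q x
  map_zero' := rfl
  map_add' _ _ := rfl

lemma sum_δ_δ_apply (i k : J) (q : ℤ) (x : (M.obj i).X q) :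
    ∑ j, (M.δ j k).f q ((M.δ i j).f q x) = 0 := by
  have h := congr_arg (evalAddHom _ _ q x) (M.δ_comp_δ i k)
  rw [map_sum, map_zero] at h
  exact h

/-- A nonzero `δ i j` raises the degree by one, which flips the sign. This makes the signed internal
differential anticommute with `δ`, although each `δ i j` is a chain map. -/
lemma sgn_smul_δ_apply (i j : J) (q : ℤ) (x : (M.obj i).X q) :
    sgn deg j • (M.δ i j).f q x = - (sgn deg i • (M.δ i j).f q x) := by
  by_cases h : deg j = deg i + 1
  · simp [sgn, h, Int.negOnePow_succ]
  · simp [M.δ_eq_zero i j h]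

lemma δ_d_apply (i j : J) (p q : ℤ) (x : (M.obj i).X p) :
    (M.δ i j).f q ((M.obj i).d p q x) = (M.obj j).d p q ((M.δ i j).f p x) :=
  (ConcreteCategory.congr_hom ((M.δ i j).comm p q) x).symm

/-- The purely internal part vanishes by `d² = 0`, the pure twisting part by `δ² = 0`, and the mixed
terms cancel by `sgn_smul_δ_apply`. -/
lemma D_D (f : M.Family) : M.D (M.D f) = 0 := by
  ext k q
  have h₁ : (M.obj k).d (q - 1) q ((M.obj k).d (q - 1 - 1) (q - 1) (f k (q - 1 - 1))) = 0 :=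
    ConcreteCategory.congr_hom ((M.obj k).d_comp_d (q - 1 - 1) (q - 1) q) (f k (q - 1 - 1))
  have h₂ : ∑ j, (M.δ j k).f q (∑ i, (M.δ i j).f q (f i q)) = 0 := by
    simp only [map_sum]
    rw [Finset.sum_comm]
    exact Finset.sum_eq_zero fun i _ => M.sum_δ_δ_apply i k q _
  simp only [D_apply, map_add, map_zsmul, h₁, smul_zero, zero_add,
    Finset.sum_add_distrib, h₂, add_zero, Pi.zero_apply]
  rw [map_sum, Finset.smul_sum, ← Finset.sum_add_distrib]
  refine Finset.sum_eq_zero fun j _ => ?_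
  rw [δ_d_apply, ← map_zsmul ((M.obj k).d (q - 1) q).hom, sgn_smul_δ_apply, map_neg, map_zsmul,
    neg_add_cancel]

/-- The families which are homogeneous of degree `n`. -/
def homogeneous (n : ℤ) : AddSubgroup M.Family where
  carrier := {f | ∀ i q, deg i + q ≠ n → f i q = 0}
  zero_mem' := fun _ _ _ => rfl
  add_mem' := fun ha hb i q h => by simp [ha i q h, hb i q h]
  neg_mem' := fun ha i q h => by simp [ha i q h]

variable {M} in
lemma D_mem {n m : ℤ} (hnm : n + 1 = m) {f : M.Family} (hf : f ∈ M.homogeneous n) :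
    M.D f ∈ M.homogeneous m := by
  intro i q h
  rw [D_apply, hf i (q - 1) (by omega), map_zero, smul_zero, zero_add]
  refine Finset.sum_eq_zero fun j _ => ?_
  by_cases hj : deg i = deg j + 1
  · rw [hf j q (by omega), map_zero]
  · rw [M.δ_eq_zero j i hj]
    rfl

/-- The total complex of a twisted complex. -/
def total : CochainComplex AddCommGrpCat.{u} ℤ where
  X n := AddCommGrpCat.of (M.homogeneous n)
  d n m := if h : n + 1 = m then AddCommGrpCat.ofHom
    ((M.D.comp (M.homogeneous n).subtype).codRestrict (M.homogeneous m) fun f => D_mem h f.2) else 0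
  shape n m h := dif_neg h
  d_comp_d' n m k h h' := by
    obtain rfl : n + 1 = m := h
    obtain rfl : n + 1 + 1 = k := h'
    rw [dif_pos rfl, dif_pos rfl]
    refine AddCommGrpCat.hom_ext (AddMonoidHom.ext fun f => Subtype.ext ?_)
    exact M.D_D f.1

variable {M N P}

/-- The family of elements given by an element of the total complex. -/
def fam {n : ℤ} : M.total.X n →+ M.Family := (M.homogeneous n).subtype

/-- The element of the total complex given by a homogeneous family. -/
def ofFam {n : ℤ} (f : M.Family) (hf : ∀ i q, deg i + q ≠ n → f i q = 0) : M.total.X n := ⟨f, hf⟩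

lemma fam_eq_zero {n : ℤ} (f : M.total.X n) (i : J) (q : ℤ) (h : deg i + q ≠ n) :
    fam f i q = 0 := f.2 i q h

lemma fam_d {n m : ℤ} (h : n + 1 = m) (f : M.total.X n) :
    fam (M.total.d n m f) = M.D (fam f) := by
  simp only [total, dif_pos h]
  rfl

lemma fam_injective {n : ℤ} : Function.Injective (fam : M.total.X n → M.Family) :=
  Subtype.val_injective

lemma total_ext {n : ℤ} {f g : M.total.X n} (h : ∀ i q, deg i + q = n → fam f i q = fam g i q) :
    f = g :=
  fam_injective (funext fun i => funext fun q => by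
    by_cases hq : deg i + q = n
    · exact h i q hq
    · rw [fam_eq_zero f i q hq, fam_eq_zero g i q hq])

/-- The morphism on families induced by a morphism of twisted complexes. -/
def mapFamily (φ : M ⟶ N) : M.Family →+ N.Family where
  toFun f i q := (φ.app i).f q (f i q)
  map_zero' := by ext; simp
  map_add' f g := by ext; simp

lemma mapFamily_apply (φ : M ⟶ N) (f : M.Family) (i : J) (q : ℤ) :
    mapFamily φ f i q = (φ.app i).f q (f i q) := rfl

lemma D_mapFamily (φ : M ⟶ N) (f : M.Family) : N.D (mapFamily φ f) = mapFamily φ (M.D f) := by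
  ext i q
  simp only [D_apply, mapFamily_apply, map_add, map_zsmul, map_sum]
  congr 2
  · exact ConcreteCategory.congr_hom ((φ.app i).comm (q - 1) q) (f i (q - 1))
  · ext j
    exact (ConcreteCategory.congr_hom (HomologicalComplex.congr_hom (φ.comm j i) q) (f j q)).symm

/-- The morphism on total complexes induced by a morphism of twisted complexes. -/
def totalMap (φ : M ⟶ N) : M.total ⟶ N.total where
  f n := AddCommGrpCat.ofHom
    (((mapFamily φ).comp (M.homogeneous n).subtype).codRestrict (N.homogeneous n)
      fun f i q h => by
        change (φ.app i).f q (f.1 i q) = 0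
        rw [f.2 i q h, map_zero])
  comm' n m h := by
    refine AddCommGrpCat.hom_ext (AddMonoidHom.ext fun f => fam_injective ?_)
    refine (fam_d h _).trans ((D_mapFamily φ (fam f)).trans ?_)
    exact congr_arg (mapFamily φ) (fam_d h f).symm

@[simp]
lemma fam_totalMap (φ : M ⟶ N) {n : ℤ} (f : M.total.X n) (i : J) (q : ℤ) :
    fam ((totalMap φ).f n f) i q = (φ.app i).f q (fam f i q) := rfl

/-- The total complex functor. -/
def totalFunctor (deg : J → ℤ) : TwistedComplex deg ⥤ CochainComplex AddCommGrpCat.{u} ℤ where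
  obj M := M.total
  map φ := totalMap φ
  map_id M := by ext n f; exact fam_injective rfl
  map_comp f g := by ext n f; exact fam_injective rfl

open Classical in
/-- The family with a single nonzero element. -/
noncomputable def single (M : TwistedComplex deg) (i : J) (q : ℤ) : (M.obj i).X q →+ M.Family :=
  (AddMonoidHom.single (fun i => ∀ q, (M.obj i).X q) i).comp
    (AddMonoidHom.single (fun q => (M.obj i).X q) q)

lemma single_same (i : J) (q : ℤ) (x : (M.obj i).X q) : M.single i q x i q = x := by
  simp [single]

lemma single_of_ne {i j : J} (hij : j ≠ i) (q r : ℤ) (x : (M.obj i).X q) :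
    M.single i q x j r = 0 := by
  simp [single, hij]

lemma single_of_deg_ne (i j : J) {q r : ℤ} (hqr : r ≠ q) (x : (M.obj i).X q) :
    M.single i q x j r = 0 := by
  by_cases hij : j = i
  · subst hij
    simp [single, hqr]
  · exact single_of_ne hij q r x

lemma D_single (i : J) (q p : ℤ) (hp : q + 1 = p) (x : (M.obj i).X q) :
    M.D (M.single i q x) =
      sgn deg i • M.single i p ((M.obj i).d q p x) + ∑ j, M.single j q ((M.δ i j).f q x) := by
  subst hp
  ext k r
  rw [D_apply, Pi.add_apply, Pi.add_apply, Finset.sum_apply, Finset.sum_apply]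
  congr 1
  · simp only [Pi.smul_apply]
    by_cases hk : k = i
    · subst hk
      by_cases hr : r = q + 1
      · subst hr
        -- The index is generalized so that it can be replaced by `q` inside the dependent types.
        obtain ⟨q', hq'⟩ : ∃ q', q' = q + 1 - 1 := ⟨_, rfl⟩
        rw [single_same, ← hq']
        obtain rfl : q' = q := by omega
        rw [single_same]
      · rw [single_of_deg_ne k k (by omega : r - 1 ≠ q), single_of_deg_ne k k hr, map_zero]
    · rw [single_of_ne hk, single_of_ne hk, map_zero, smul_zero, smul_zero]
  · rw [Finset.sum_eq_single i, Finset.sum_eq_single k]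
    · by_cases hr : r = q
      · subst hr
        rw [single_same, single_same]
      · rw [single_of_deg_ne _ _ hr, single_of_deg_ne _ _ hr, map_zero]
    · intro j _ hj
      exact single_of_ne (Ne.symm hj) _ _ _
    · simp
    · intro j _ hj
      rw [single_of_ne hj, map_zero]
    · simp

lemma sum_single {n : ℤ} (f : M.total.X n) :
    ∑ i, M.single i (n - deg i) (fam f i (n - deg i)) = fam f := by
  ext j r
  rw [Finset.sum_apply, Finset.sum_apply, Finset.sum_eq_single j]
  · by_cases hr : r = n - deg j
    · subst hr
      rw [single_same]
    · rw [single_of_deg_ne _ _ hr, fam_eq_zero f j r (by omega)]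
  · intro i _ hij
    exact single_of_ne (Ne.symm hij) _ _ _
  · simp

/-- The inclusion of a column in the total complex. -/
noncomputable def ι (M : TwistedComplex deg) (i : J) {q n : ℤ} (h : deg i + q = n) :
    (M.obj i).X q →+ M.total.X n :=
  (M.single i q).codRestrict (M.homogeneous n) fun x j r hjr => by
    by_cases hr : r = q
    · refine single_of_ne ?_ _ _ _
      rintro rfl
      omega
    · exact single_of_deg_ne _ _ hr _

end TwistedComplex

end FiniteSpace

/-! ### Columnwise quasi-isomorphisms induce quasi-isomorphisms of total complexes. -/

namespace FiniteSpace

namespace TwistedComplex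

variable {J : Type u} [Fintype J] {deg : J → ℤ} {M N : TwistedComplex deg}

/-- The element of the total complex with given components. -/
noncomputable def ofColumns {n : ℤ} (x : ∀ i, (M.obj i).X (n - deg i)) : M.total.X n :=
  ∑ i, M.ι i (by omega) (x i)

lemma fam_ofColumns {n : ℤ} (x : ∀ i, (M.obj i).X (n - deg i)) (i : J) :
    fam (ofColumns x) i (n - deg i) = x i := by
  rw [ofColumns, map_sum, Finset.sum_apply, Finset.sum_apply, Finset.sum_eq_single i]
  · exact single_same i _ _
  · intro j _ hj
    exact single_of_ne (Ne.symm hj) _ _ _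
  · simp

lemma fam_ofColumns_eq_zero {n : ℤ} (x : ∀ i, (M.obj i).X (n - deg i)) (i : J) (hi : x i = 0)
    (q : ℤ) : fam (ofColumns x) i q = 0 := by
  by_cases hq : q = n - deg i
  · subst hq
    rw [fam_ofColumns, hi]
  · exact fam_eq_zero _ _ _ (by omega)

/-- The twisting part arriving in column `i` comes from columns of degree `deg i - 1 < e`, where `f`
vanishes. -/
lemma D_apply_of_vanish (f : M.Family) (e : ℤ) (hf : ∀ j, deg j < e → ∀ q, f j q = 0) (i : J)
    (hi : deg i ≤ e) (q p : ℤ) (hp : p + 1 = q) :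
    M.D f i q = sgn deg i • (M.obj i).d p q (f i p) := by
  obtain rfl : p = q - 1 := by omega
  rw [D_apply, add_eq_left]
  refine Finset.sum_eq_zero fun j _ => ?_
  by_cases h : deg i = deg j + 1
  · rw [hf j (by omega), map_zero]
  · rw [M.δ_eq_zero j i h]
    rfl

omit [Fintype J] in
lemma sgn_smul_sgn_smul {A : Type*} [AddCommGroup A] (i : J) (x : A) :
    sgn deg i • sgn deg i • x = x := by
  simp [sgn, smul_smul, ← Units.val_mul]

lemma totalMap_comm (φ : M ⟶ N) (n m : ℤ) (x : M.total.X n) :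
    (totalMap φ).f m (M.total.d n m x) = N.total.d n m ((totalMap φ).f n x) :=
  (ConcreteCategory.congr_hom ((totalMap φ).comm n m) x).symm

lemma total_d_d (n m k : ℤ) (x : M.total.X n) : M.total.d m k (M.total.d n m x) = 0 :=
  ConcreteCategory.congr_hom (M.total.d_comp_d n m k) x

/-- A cocycle of the cone of a morphism of total complexes can be made to vanish in one more
column if the morphism is a quasi-isomorphism on the columns. -/
lemma exists_vanish_succ (φ : M ⟶ N) (hφ : ∀ i, ConeAcyclic (φ.app i)) {a b c d : ℤ}
    (hab : a + 1 = b) (hbc : b + 1 = c) (hcd : c + 1 = d) (x : M.total.X c) (y : N.total.X b)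
    (hx : M.total.d c d x = 0) (hy : (totalMap φ).f c x = N.total.d b c y) (e : ℤ)
    (hxe : ∀ i, deg i < e → ∀ q, fam x i q = 0) (hye : ∀ i, deg i < e → ∀ q, fam y i q = 0) :
    ∃ (x' : M.total.X b) (y' : N.total.X a),
      (∀ i, deg i < e + 1 → ∀ q, fam (x - M.total.d b c x') i q = 0) ∧
      (∀ i, deg i < e + 1 → ∀ q,
        fam (y - ((totalMap φ).f b x' + N.total.d a b y')) i q = 0) := by
  -- In a column of degree `e`, the lowest one possibly nonzero, the total differential is internal
  -- up to sign, so the acyclicity of that column's cone applies. The other columns receive zero.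
  have key : ∀ i, ∃ (x' : (M.obj i).X (b - deg i)) (y' : (N.obj i).X (a - deg i)),
      deg i = e → (M.obj i).d (b - deg i) (c - deg i) x' = fam x i (c - deg i) ∧
        sgn deg i • fam y i (b - deg i) =
          (φ.app i).f _ x' + (N.obj i).d (a - deg i) (b - deg i) y' := by
    intro i
    by_cases hi : deg i = e
    · have hx' : (M.obj i).d (c - deg i) (d - deg i) (fam x i (c - deg i)) = 0 := by
        have := D_apply_of_vanish (fam x) e hxe i hi.le (d - deg i) (c - deg i) (by omega)
        rw [← fam_d hcd, hx, map_zero] at this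
        rw [← sgn_smul_sgn_smul i ((M.obj i).d (c - deg i) (d - deg i) (fam x i (c - deg i))),
          ← this]
        exact smul_zero _
      have hy' : (φ.app i).f _ (fam x i (c - deg i)) =
          (N.obj i).d (b - deg i) (c - deg i) (sgn deg i • fam y i (b - deg i)) := by
        rw [map_zsmul, ← D_apply_of_vanish (fam y) e hye i hi.le (c - deg i) (b - deg i) (by omega),
          ← fam_d hbc, ← hy, fam_totalMap]
      obtain ⟨x', y', h, h'⟩ := hφ i (a - deg i) (b - deg i) (c - deg i) (d - deg i)
        (by omega) (by omega) (by omega) _ _ hx' hy'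
      exact ⟨x', y', fun _ => ⟨h, h'⟩⟩
    · exact ⟨0, 0, fun h => (hi h).elim⟩
  choose x' y' h using key
  -- The sign on `x'` cancels the sign of the total differential. No sign is put on `y'`, because
  -- `key` was applied to the signed component of `y`.
  let X' : M.total.X b := ofColumns fun i => if deg i = e then sgn deg i • x' i else 0
  let Y' : N.total.X a := ofColumns fun i => if deg i = e then y' i else 0
  have hX : ∀ i, deg i < e → ∀ q, fam X' i q = 0 := fun i hi q =>
    fam_ofColumns_eq_zero _ _ (if_neg hi.ne) q
  have hY : ∀ i, deg i < e → ∀ q, fam Y' i q = 0 := fun i hi q =>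
    fam_ofColumns_eq_zero _ _ (if_neg hi.ne) q
  refine ⟨X', Y', fun i hi q => ?_, fun i hi q => ?_⟩
  · rw [map_sub, Pi.sub_apply, Pi.sub_apply, sub_eq_zero]
    by_cases hq : deg i + q = c
    · rw [fam_d hbc, D_apply_of_vanish (fam X') e hX i (by omega) q (b - deg i) (by omega)]
      by_cases hi' : deg i < e
      · rw [hX i hi', map_zero, smul_zero, hxe i hi']
      · have hi'' : deg i = e := by omega
        obtain rfl : q = c - deg i := by omega
        rw [← map_zsmul, fam_ofColumns, if_pos hi'', sgn_smul_sgn_smul, (h i hi'').1]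
    · rw [fam_eq_zero _ _ _ hq, fam_eq_zero _ _ _ hq]
  · rw [map_sub, Pi.sub_apply, Pi.sub_apply, sub_eq_zero, map_add, Pi.add_apply, Pi.add_apply,
      fam_totalMap]
    by_cases hq : deg i + q = b
    · rw [fam_d hab, D_apply_of_vanish (fam Y') e hY i (by omega) q (a - deg i) (by omega)]
      by_cases hi' : deg i < e
      · rw [hX i hi', hY i hi', map_zero, map_zero, smul_zero, hye i hi', add_zero]
      · have hi'' : deg i = e := by omega
        obtain rfl : q = b - deg i := by omega
        rw [fam_ofColumns, fam_ofColumns, if_pos hi'', if_pos hi'', map_zsmul, ← smul_add,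
          ← (h i hi'').2, sgn_smul_sgn_smul]
    · rw [fam_eq_zero _ _ _ hq, fam_eq_zero _ _ _ hq, fam_eq_zero _ _ _ hq, map_zero, add_zero]

/-- A morphism of twisted complexes which is a quasi-isomorphism on the columns induces a
quasi-isomorphism of total complexes. -/
lemma quasiIso_totalMap (φ : M ⟶ N) [∀ i, QuasiIso (φ.app i)] : QuasiIso (totalMap φ) := by
  have hφ : ∀ i, ConeAcyclic (φ.app i) := fun i => coneAcyclic_of_quasiIso _
  obtain ⟨B, hB⟩ : ∃ B, ∀ i, deg i < B := by
    obtain ⟨B, hB⟩ := (Set.finite_range deg).bddAbove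
    exact ⟨B + 1, fun i => Int.lt_add_one_of_le (hB ⟨i, rfl⟩)⟩
  obtain ⟨A, hA⟩ : ∃ A, ∀ i, A ≤ deg i := by
    obtain ⟨A, hA⟩ := (Set.finite_range deg).bddBelow
    exact ⟨A, fun i => hA ⟨i, rfl⟩⟩
  refine quasiIso_of_coneAcyclic _ fun a b c d hab hbc hcd => ?_
  -- All degrees lie in `[A, B)`. The induction is on the number `k` of degrees still to be cleared:
  -- for `k = B - A` the vanishing hypotheses are vacuous, and for `k = 0` both elements are zero.
  suffices ∀ (k : ℕ) (x : M.total.X c) (y : N.total.X b), M.total.d c d x = 0 →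
      (totalMap φ).f c x = N.total.d b c y → (∀ i, deg i < B - k → ∀ q, fam x i q = 0) →
      (∀ i, deg i < B - k → ∀ q, fam y i q = 0) →
      ∃ (x' : M.total.X b) (y' : N.total.X a),
        M.total.d b c x' = x ∧ y = (totalMap φ).f b x' + N.total.d a b y' by
    intro x y hx hy
    exact this (B - A).toNat x y hx hy (fun i hi => absurd (hA i) (by omega))
      (fun i hi => absurd (hA i) (by omega))
  intro k
  induction k with
  | zero =>
    intro x y _ _ hx hy
    have hx₀ : x = 0 := total_ext fun i q _ => by
      rw [hx i (by simpa using hB i), map_zero]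
      rfl
    have hy₀ : y = 0 := total_ext fun i q _ => by
      rw [hy i (by simpa using hB i), map_zero]
      rfl
    exact ⟨0, 0, by rw [hx₀, map_zero], by rw [hy₀, map_zero, map_zero, add_zero]⟩
  | succ k ih =>
    intro x y hx hy hxe hye
    obtain ⟨x', y', h, h'⟩ := exists_vanish_succ φ hφ hab hbc hcd x y hx hy _ hxe hye
    obtain ⟨x'', y'', e, e'⟩ := ih (x - M.total.d b c x')
      (y - ((totalMap φ).f b x' + N.total.d a b y'))
      (by rw [map_sub, hx, total_d_d, sub_zero])
      (by rw [map_sub, map_sub, map_add, hy, totalMap_comm, total_d_d, add_zero])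
      (fun i hi => h i (by push_cast; omega)) (fun i hi => h' i (by push_cast; omega))
    refine ⟨x' + x'', y' + y'', by rw [map_add, e, add_sub_cancel], ?_⟩
    rw [map_add, map_add, add_add_add_comm, ← e', add_sub_cancel]

end TwistedComplex

end FiniteSpace

namespace FiniteSpace

/-! ### Alternating sums over faces, and joins of chains. -/

section Combinatorics

open scoped Classical in
/-- The sign `(-1)^k` where `k` is the number of elements of `s` below `x`. -/
noncomputable def faceSign {P : Type u} [PartialOrder P] (s : Finset P) (x : P) : ℤ :=
  (-1) ^ (s.filter (· < x)).card

/-- Any two elements of `s` are comparable. -/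
def IsTotal {P : Type u} [PartialOrder P] (s : Finset P) : Prop :=
  ∀ x ∈ s, ∀ y ∈ s, x ≤ y ∨ y ≤ x

variable {P : Type u} [PartialOrder P] {A : Type*} [AddCommGroup A]

lemma IsTotal.mono {s t : Finset P} (h : IsTotal s) (hts : t ⊆ s) : IsTotal t :=
  fun x hx y hy => h x (hts hx) y (hts hy)

open scoped Classical in
/-- The alternating sum over the faces of `s`. -/
noncomputable def altSum (g : Finset P → A) (s : Finset P) : A :=
  ∑ x ∈ s, faceSign s x • g (s.erase x)

lemma altSum_empty (g : Finset P → A) : altSum g ∅ = 0 := rfl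

open scoped Classical in
lemma faceSign_erase_of_lt {s : Finset P} {x y : P} (hx : x ∈ s) (hxy : x < y) :
    faceSign (s.erase x) y = - faceSign s y := by
  have h : s.filter (· < y) = insert x ((s.erase x).filter (· < y)) := by
    ext z
    simp only [Finset.mem_filter, Finset.mem_insert, Finset.mem_erase]
    by_cases hz : z = x
    · subst hz; simp [hx, hxy]
    · simp [hz]
  rw [faceSign, faceSign, h, Finset.card_insert_of_notMem (by simp), pow_succ]
  ring

open scoped Classical in
lemma faceSign_erase_of_not_lt {s : Finset P} {x y : P} (hxy : ¬ x < y) :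
    faceSign (s.erase x) y = faceSign s y := by
  have h : s.filter (· < y) = (s.erase x).filter (· < y) := by
    ext z
    simp only [Finset.mem_filter, Finset.mem_erase]
    by_cases hz : z = x
    · subst hz; simp [hxy]
    · simp [hz]
  rw [faceSign, faceSign, h]

open scoped Classical in
-- Two distinct points can be removed in either order. Removing the smaller one first flips the sign
-- of the larger, while removing the larger first changes nothing, so the two contributions cancel.
lemma altSum_altSum (g : Finset P → A) {s : Finset P} (hs : IsTotal s) :
    altSum (altSum g) s = 0 := by
  have h : ∀ x ∈ s, faceSign s x • altSum g (s.erase x) =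
      ∑ y ∈ s, (if y < x then (faceSign s x * faceSign s y) • g ((s.erase x).erase y) else 0) +
      ∑ y ∈ s, (if x < y then -(faceSign s x * faceSign s y) • g ((s.erase x).erase y) else 0) := by
    intro x hx
    rw [altSum, Finset.smul_sum, ← Finset.sum_add_distrib, ← Finset.add_sum_erase s _ hx]
    simp only [lt_self_iff_false, if_false, add_zero, zero_add]
    refine Finset.sum_congr rfl fun y hy => ?_
    obtain ⟨hyx, hy⟩ := Finset.mem_erase.1 hy
    rw [smul_smul]
    rcases hs x hx y hy with h | h
    · have h' : x < y := lt_of_le_of_ne h (Ne.symm hyx)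
      rw [if_neg h'.not_gt, if_pos h', zero_add, faceSign_erase_of_lt hx h', mul_neg]
    · have h' : y < x := lt_of_le_of_ne h hyx
      rw [if_pos h', if_neg h'.not_gt, add_zero, faceSign_erase_of_not_lt h'.not_gt]
  rw [altSum, Finset.sum_congr rfl h, Finset.sum_add_distrib]
  rw [Finset.sum_comm, ← Finset.sum_add_distrib]
  refine Finset.sum_eq_zero fun x _ => ?_
  rw [← Finset.sum_add_distrib]
  refine Finset.sum_eq_zero fun y _ => ?_
  split_ifs
  · rw [Finset.erase_right_comm, mul_comm, neg_smul, add_neg_cancel]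
  · exact add_zero 0

/-- All the elements of `s` are smaller than the elements of `t`. -/
def Below (s t : Finset P) : Prop := ∀ x ∈ s, ∀ y ∈ t, x < y

open scoped Classical in
/-- The signed evaluation of `g` at the join of `s` and `t`. -/
noncomputable def joinEval (g : Finset P → A) (s t : Finset P) : A :=
  if Below s t then (-1 : ℤ) ^ s.card • g (s ∪ t) else 0

open scoped Classical in
-- Points of `s` keep their sign in `s ∪ t`, whereas each point of `t` gains the `s.card` points of
-- `s` below it.
lemma altSum_union (g : Finset P → A) {s t : Finset P} (h : Below s t) :
    altSum g (s ∪ t) = ∑ x ∈ s, faceSign s x • g (s.erase x ∪ t) +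
      (-1 : ℤ) ^ s.card • ∑ y ∈ t, faceSign t y • g (s ∪ t.erase y) := by
  have hst : Disjoint s t := Finset.disjoint_left.2 fun x hx hx' => lt_irrefl _ (h x hx x hx')
  rw [altSum, Finset.sum_union hst, Finset.smul_sum]
  congr 1
  · refine Finset.sum_congr rfl fun x hx => ?_
    have h₁ : faceSign (s ∪ t) x = faceSign s x := by
      rw [faceSign, faceSign, Finset.filter_union,
        Finset.filter_false_of_mem (s := t) fun y hy => (h x hx y hy).not_gt, Finset.union_empty]
    rw [h₁, Finset.erase_union_distrib,
      Finset.erase_eq_of_notMem (s := t) (Finset.disjoint_left.1 hst hx)]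
  · refine Finset.sum_congr rfl fun y hy => ?_
    have h₁ : faceSign (s ∪ t) y = (-1 : ℤ) ^ s.card * faceSign t y := by
      rw [faceSign, faceSign, Finset.filter_union,
        Finset.filter_true_of_mem (s := s) fun x hx => h x hx y hy,
        Finset.card_union_of_disjoint (hst.mono_right (Finset.filter_subset _ _)), pow_add]
    rw [h₁, Finset.erase_union_distrib,
      Finset.erase_eq_of_notMem (s := s) (Finset.disjoint_right.1 hst hy), mul_smul]

open scoped Classical in
-- If `s` lies strictly below `t`, this is the Leibniz rule of `altSum_union`. Otherwise `s` and `t`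
-- share the point `z = max s = min t`. Then only the two faces omitting `z` on one side contribute;
-- both are evaluations at `s ∪ t`, and they cancel.
lemma joinEval_altSum (g : Finset P → A) {s t : Finset P} (hst : ∀ x ∈ s, ∀ y ∈ t, x ≤ y) :
    altSum (fun s' => joinEval g s' t) s - (-1 : ℤ) ^ s.card • altSum (joinEval g s) t +
      joinEval (altSum g) s t = 0 := by
  by_cases h : Below s t
  · have h₁ : ∀ x ∈ s, joinEval g (s.erase x) t = - (-1 : ℤ) ^ s.card • g (s.erase x ∪ t) := by
      intro x hx
      have hx' : Below (s.erase x) t := fun z hz => h z (Finset.mem_of_mem_erase hz)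
      rw [joinEval, if_pos hx', ← Finset.card_erase_add_one hx, pow_succ]
      simp
    have h₂ : ∀ y ∈ t, joinEval g s (t.erase y) = (-1 : ℤ) ^ s.card • g (s ∪ t.erase y) := by
      intro y hy
      have hy' : Below s (t.erase y) := fun z hz w hw => h z hz w (Finset.mem_of_mem_erase hw)
      rw [joinEval, if_pos hy']
    rw [joinEval, if_pos h, altSum_union g h, altSum, altSum]
    rw [Finset.sum_congr rfl fun x hx => by rw [h₁ x hx],
      Finset.sum_congr (s₁ := t) rfl fun x hx => by rw [h₂ x hx]]
    simp only [smul_comm (faceSign _ _) ((-1 : ℤ) ^ s.card), neg_smul, smul_neg,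
      Finset.sum_neg_distrib, ← Finset.smul_sum, smul_add]
    abel
  · rw [joinEval, if_neg h, add_zero]
    -- Weak inequality without strict inequality forces a common point.
    obtain ⟨z, hzs, hzt⟩ : ∃ z, z ∈ s ∧ z ∈ t := by
      simp only [Below, not_forall] at h
      obtain ⟨x, hx, y, hy, hxy⟩ := h
      obtain rfl := (hst x hx y hy).eq_of_not_lt hxy
      exact ⟨x, hx, hy⟩
    have hs : faceSign s z = (-1 : ℤ) ^ (s.card - 1) := by
      rw [← Finset.card_erase_of_mem hzs, faceSign]
      congr 2
      ext x
      simp only [Finset.mem_filter, Finset.mem_erase]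
      exact ⟨fun hx => ⟨hx.2.ne, hx.1⟩, fun hx => ⟨hx.2, lt_of_le_of_ne (hst x hx.2 z hzt) hx.1⟩⟩
    have ht : faceSign t z = 1 := by
      rw [faceSign, Finset.filter_false_of_mem fun y hy => (hst z hzs y hy).not_gt]
      simp
    have e₁ : altSum (fun s' => joinEval g s' t) s = g (s ∪ t) := by
      rw [altSum, Finset.sum_eq_single z]
      · rw [joinEval, if_pos, hs, ← Finset.card_erase_of_mem hzs, smul_smul, ← mul_pow]
        · have : s.erase z ∪ t = s ∪ t := by
            ext x
            simp only [Finset.mem_union, Finset.mem_erase]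
            by_cases hx : x = z
            · subst hx; simp [hzt]
            · simp [hx]
          rw [this]
          simp
        · intro x hx y hy
          obtain ⟨hxz, hx⟩ := Finset.mem_erase.1 hx
          exact lt_of_lt_of_le (lt_of_le_of_ne (hst x hx z hzt) hxz) (hst z hzs y hy)
      · intro x _ hxz
        rw [joinEval, if_neg, smul_zero]
        exact fun H => lt_irrefl z (H z (Finset.mem_erase.2 ⟨Ne.symm hxz, hzs⟩) z hzt)
      · exact fun H => (H hzs).elim
    have e₂ : altSum (joinEval g s) t = (-1 : ℤ) ^ s.card • g (s ∪ t) := by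
      rw [altSum, Finset.sum_eq_single z]
      · rw [joinEval, if_pos, ht, one_smul]
        · have : s ∪ t.erase z = s ∪ t := by
            ext x
            simp only [Finset.mem_union, Finset.mem_erase]
            by_cases hx : x = z
            · subst hx; simp [hzs]
            · simp [hx]
          rw [this]
        · intro x hx y hy
          obtain ⟨hyz, hy⟩ := Finset.mem_erase.1 hy
          exact lt_of_le_of_lt (hst x hx z hzt) (lt_of_le_of_ne (hst z hzs y hy) (Ne.symm hyz))
      · intro y _ hyz
        rw [joinEval, if_neg, smul_zero]
        exact fun H => lt_irrefl z (H z hzs z (Finset.mem_erase.2 ⟨Ne.symm hyz, hzt⟩))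
      · exact fun H => (H hzt).elim
    rw [e₁, e₂, smul_smul, ← mul_pow]
    simp

end Combinatorics

/-! ### Chains as finite sets, and their incidence numbers. -/

/-- The nonempty finite chains in a partially ordered set. -/
structure FChain (P : Type u) [PartialOrder P] where
  /-- the elements of a chain -/
  support : Finset P
  nonempty : support.Nonempty
  isTotal : IsTotal support

namespace FChain

variable {P : Type u} [PartialOrder P]

@[ext]
lemma ext {c c' : FChain P} (h : c.support = c'.support) : c = c' := by
  cases c
  cases c'
  congr

instance [Finite P] : Finite (FChain P) :=
  Finite.of_injective support fun _ _ => FChain.ext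

noncomputable instance [Finite P] : Fintype (FChain P) := Fintype.ofFinite _

/-- The dimension of a chain. -/
def dim (c : FChain P) : ℤ := c.support.card - 1

lemma exists_last (c : FChain P) : ∃ x ∈ c.support, ∀ y ∈ c.support, y ≤ x := by
  obtain ⟨x, hx⟩ := c.support.exists_maximal c.nonempty
  exact ⟨x, hx.1, fun y hy => (c.isTotal y hy x hx.1).elim id fun h => hx.2 hy h⟩

lemma exists_first (c : FChain P) : ∃ x ∈ c.support, ∀ y ∈ c.support, x ≤ y := by
  obtain ⟨x, hx⟩ := c.support.exists_minimal c.nonempty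
  exact ⟨x, hx.1, fun y hy => (c.isTotal x hx.1 y hy).elim id fun h => hx.2 hy h⟩

/-- The greatest element of a chain. -/
noncomputable def last (c : FChain P) : P := c.exists_last.choose

/-- The least element of a chain. -/
noncomputable def first (c : FChain P) : P := c.exists_first.choose

lemma last_mem (c : FChain P) : c.last ∈ c.support := c.exists_last.choose_spec.1

lemma le_last (c : FChain P) {x : P} (hx : x ∈ c.support) : x ≤ c.last :=
  c.exists_last.choose_spec.2 x hx

lemma first_mem (c : FChain P) : c.first ∈ c.support := c.exists_first.choose_spec.1

lemma first_le (c : FChain P) {x : P} (hx : x ∈ c.support) : c.first ≤ x :=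
  c.exists_first.choose_spec.2 x hx

lemma last_mono {c c' : FChain P} (h : c.support ⊆ c'.support) : c.last ≤ c'.last :=
  c'.le_last (h c.last_mem)

lemma first_anti {c c' : FChain P} (h : c.support ⊆ c'.support) : c'.first ≤ c.first :=
  c'.first_le (h c.first_mem)

/-- The chain consisting of one point. -/
def point (x : P) : FChain P where
  support := {x}
  nonempty := Finset.singleton_nonempty x
  isTotal := by simp [IsTotal]

@[simp]
lemma point_dim (x : P) : (point x).dim = 0 := by simp [point, dim]

lemma dim_eq_zero_iff {c : FChain P} : c.dim = 0 ↔ ∃ x, c = point x := by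
  refine ⟨fun h => ?_, ?_⟩
  · have : c.support.card = 1 := by
      rw [dim] at h
      omega
    obtain ⟨x, hx⟩ := Finset.card_eq_one.1 this
    exact ⟨x, FChain.ext hx⟩
  · rintro ⟨x, rfl⟩
    simp

lemma dim_nonneg (c : FChain P) : 0 ≤ c.dim := by
  have := c.nonempty.card_pos
  rw [dim]
  omega

open scoped Classical in
/-- The incidence number of a face `t` of a chain `s`. -/
noncomputable def incidence (t s : FChain P) : ℤ :=
  altSum (fun r => if r = t.support then 1 else 0) s.support

lemma incidence_eq_zero {t s : FChain P} (h : ¬ (t.support ⊆ s.support ∧ s.dim = t.dim + 1)) :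
    incidence t s = 0 := by
  classical
  rw [incidence, altSum]
  refine Finset.sum_eq_zero fun x hx => ?_
  rw [if_neg, smul_zero]
  intro H
  refine h ⟨H ▸ Finset.erase_subset _ _, ?_⟩
  rw [dim, dim, ← H, ← Finset.card_erase_add_one hx]
  push_cast
  ring

/-- The empty set is the only face of a chain that is not itself a chain; the condition on `g ∅`
accounts for it. -/
lemma sum_incidence [Finite P] {A : Type*} [AddCommGroup A] (g : Finset P → A) (hg : g ∅ = 0)
    (s : FChain P) : ∑ t : FChain P, incidence t s • g t.support = altSum g s.support := by
  classical
  simp only [incidence, altSum, Finset.sum_smul]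
  rw [Finset.sum_comm]
  refine Finset.sum_congr rfl fun x hx => ?_
  by_cases h : (s.support.erase x).Nonempty
  · rw [Finset.sum_eq_single ⟨s.support.erase x, h, s.isTotal.mono (Finset.erase_subset _ _)⟩]
    · simp
    · intro t _ ht
      rw [if_neg, smul_zero, zero_smul]
      intro H
      exact ht (FChain.ext H.symm)
    · simp
  · rw [Finset.not_nonempty_iff_eq_empty] at h
    rw [h, hg, smul_zero]
    refine Finset.sum_eq_zero fun t _ => ?_
    rw [if_neg t.nonempty.ne_empty.symm, smul_zero, zero_smul]

/-- This is `altSum_altSum` for the indicator function of `r`, whose alternating sum at `t` is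
`incidence r t` by definition. -/
lemma sum_incidence_mul_incidence [Finite P] (r s : FChain P) :
    ∑ t : FChain P, incidence r t * incidence t s = 0 := by
  classical
  have := sum_incidence (altSum fun u => if u = r.support then (1 : ℤ) else 0) (altSum_empty _) s
  rw [altSum_altSum _ s.isTotal] at this
  rw [← this]
  exact Finset.sum_congr rfl fun t _ => mul_comm _ _

end FChain

end FiniteSpace

namespace FiniteSpace

/-! ### Complexes cut off by a proposition. -/

section Power

/-- The complex `K` if `Q` holds, and zero otherwise. -/
def cpow (Q : Prop) (K : CochainComplex AddCommGrpCat.{u} ℤ) :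
    CochainComplex AddCommGrpCat.{u} ℤ where
  X n := AddCommGrpCat.of (PLift Q → K.X n)
  d n m := AddCommGrpCat.ofHom ((K.d n m).hom.compLeft (PLift Q))
  shape n m h := by
    rw [K.shape n m h]
    rfl
  d_comp_d' n m k _ _ := by
    refine AddCommGrpCat.hom_ext (AddMonoidHom.ext fun f => funext fun q => ?_)
    exact ConcreteCategory.congr_hom (K.d_comp_d n m k) (f q)

/-- The functoriality of `cpow`. -/
def cpowMap {Q Q' : Prop} (h : Q' → Q) {K L : CochainComplex AddCommGrpCat.{u} ℤ} (φ : K ⟶ L) :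
    cpow Q K ⟶ cpow Q' L where
  f n := AddCommGrpCat.ofHom
    { toFun := fun f q => φ.f n (f ⟨h q.down⟩)
      map_zero' := funext fun _ => map_zero (φ.f n).hom
      map_add' := fun _ _ => funext fun _ => map_add (φ.f n).hom _ _ }
  comm' n m _ := by
    refine AddCommGrpCat.hom_ext (AddMonoidHom.ext fun f => funext fun q => ?_)
    exact ConcreteCategory.congr_hom (φ.comm n m) (f ⟨h q.down⟩)

/-- The evaluation of the elements of `cpow Q K`. -/
def cpowEval {Q : Prop} (q : Q) (K : CochainComplex AddCommGrpCat.{u} ℤ) (n : ℤ) :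
    (cpow Q K).X n →+ K.X n :=
  Pi.evalAddMonoidHom (fun _ : PLift Q => K.X n) ⟨q⟩

variable {Q Q' Q'' : Prop} {K L M : CochainComplex AddCommGrpCat.{u} ℤ}

lemma cpow_ext {n : ℤ} {x y : (cpow Q K).X n} (h : ∀ q : Q, cpowEval q K n x = cpowEval q K n y) :
    x = y := funext fun q => h q.down

/-- Elements of `cpow` are functions on proofs of the proposition, so functoriality is definitional
and needs no case distinction. -/
lemma cpowMap_comp (h : Q' → Q) (h' : Q'' → Q') (φ : K ⟶ L) (ψ : L ⟶ M) :
    cpowMap h φ ≫ cpowMap h' ψ = cpowMap (fun q => h (h' q)) (φ ≫ ψ) := rfl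

lemma quasiIso_cpowMap (h : Q → Q) (φ : K ⟶ L) [QuasiIso φ] : QuasiIso (cpowMap h φ) := by
  refine quasiIso_of_coneAcyclic _ fun a b c d hab hbc hcd x y hx hy => ?_
  by_cases hQ : Q
  · obtain ⟨x', y', e, e'⟩ := coneAcyclic_of_quasiIso φ a b c d hab hbc hcd
      (cpowEval hQ K c x) (cpowEval hQ L b y)
      (congr_arg (cpowEval hQ K d) hx) (congr_arg (cpowEval hQ L c) hy)
    exact ⟨fun _ => x', fun _ => y', cpow_ext fun _ => e, cpow_ext fun _ => e'⟩
  · exact ⟨0, 0, cpow_ext fun q => (hQ q).elim, cpow_ext fun q => (hQ q).elim⟩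

end Power

/-! ### Cochains with coefficients in a diagram of complexes. -/

section Cochains

variable {P : Type u} [PartialOrder P] [Finite P]
  (𝓕 𝓖 𝓗 : P ⥤ CochainComplex AddCommGrpCat.{u} ℤ) (p p' p'' : WithBot P)

open FChain TwistedComplex

/-- The morphism attached to a face of a chain. -/
noncomputable def faceMap {c c' : FChain P} (h : c.support ⊆ c'.support) :
    cpow (p ≤ (c.first : WithBot P)) (𝓕.obj c.last) ⟶
      cpow (p ≤ (c'.first : WithBot P)) (𝓕.obj c'.last) :=
  cpowMap (fun hp => hp.trans (WithBot.coe_le_coe.2 (first_anti h)))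
    (𝓕.map (homOfLE (last_mono h)))

omit [Finite P] in
lemma faceMap_comp {c c' c'' : FChain P} (h : c.support ⊆ c'.support)
    (h' : c'.support ⊆ c''.support) :
    faceMap 𝓕 p h ≫ faceMap 𝓕 p h' = faceMap 𝓕 p (h.trans h') := by
  rw [faceMap, faceMap, cpowMap_comp, ← 𝓕.map_comp]
  rfl

open scoped Classical in
/-- The twisted complex computing the cohomology of the open subset of the points above `p`,
with coefficients in `𝓕`. -/
noncomputable def cochainTwisted : TwistedComplex (FChain.dim : FChain P → ℤ) where
  obj c := cpow (p ≤ (c.first : WithBot P)) (𝓕.obj c.last)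
  δ c c' := incidence c c' • (if h : c.support ⊆ c'.support then faceMap 𝓕 p h else 0)
  δ_eq_zero c c' h := by
    rw [incidence_eq_zero (fun h' => h h'.2), zero_smul]
  δ_comp_δ c c'' := by
    by_cases hc : c.support ⊆ c''.support
    -- All routes from `c` to `c''` induce the same map, so only the sum of products of incidence
    -- numbers matters.
    · have : ∀ c', (incidence c c' • (if h : c.support ⊆ c'.support then faceMap 𝓕 p h else 0)) ≫
          (incidence c' c'' • (if h : c'.support ⊆ c''.support then faceMap 𝓕 p h else 0)) =
          (incidence c c' * incidence c' c'') • faceMap 𝓕 p hc := by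
        intro c'
        by_cases h : c.support ⊆ c'.support
        · by_cases h' : c'.support ⊆ c''.support
          · rw [dif_pos h, dif_pos h', Preadditive.zsmul_comp, Preadditive.comp_zsmul, smul_smul,
              faceMap_comp]
          · rw [incidence_eq_zero (t := c') (fun H => h' H.1), mul_zero, zero_smul, zero_smul,
              comp_zero]
        · rw [incidence_eq_zero (t := c) (fun H => h H.1), zero_mul, zero_smul, zero_smul,
              zero_comp]
      rw [Finset.sum_congr rfl fun c' _ => this c', ← Finset.sum_smul,
        sum_incidence_mul_incidence, zero_smul]
    · refine Finset.sum_eq_zero fun c' _ => ?_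
      by_cases h : c.support ⊆ c'.support
      · rw [dif_neg fun H => hc (h.trans H), smul_zero, comp_zero]
      · rw [dif_neg h, smul_zero, zero_comp]

variable {𝓕 𝓖 𝓗 p p' p''} in
/-- The functoriality of `cochainTwisted`. -/
noncomputable def cochainTwistedMap (τ : 𝓕 ⟶ 𝓖) (h : p ≤ p') :
    cochainTwisted 𝓕 p ⟶ cochainTwisted 𝓖 p' where
  app c := cpowMap h.trans (τ.app c.last)
  comm c c' := by
    dsimp only [cochainTwisted]
    rw [Preadditive.zsmul_comp, Preadditive.comp_zsmul]
    split_ifs with hc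
    · rw [faceMap, faceMap, cpowMap_comp, cpowMap_comp, τ.naturality]
    · rw [zero_comp, comp_zero]

/-- The cochain complex of the points above `p`. -/
noncomputable abbrev cochainComplex : CochainComplex AddCommGrpCat.{u} ℤ :=
  (cochainTwisted 𝓕 p).total

variable {𝓕 𝓖 𝓗 p p' p''} in
/-- The functoriality of the cochain complex. -/
noncomputable def cochainMap (τ : 𝓕 ⟶ 𝓖) (h : p ≤ p') :
    cochainComplex 𝓕 p ⟶ cochainComplex 𝓖 p' :=
  totalMap (cochainTwistedMap τ h)

variable {𝓕 𝓖 𝓗 p p' p''} in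
lemma cochainMap_comp (τ : 𝓕 ⟶ 𝓖) (τ' : 𝓖 ⟶ 𝓗) (h : p ≤ p') (h' : p' ≤ p'') :
    cochainMap τ h ≫ cochainMap τ' h' = cochainMap (τ ≫ τ') (h.trans h') :=
  ((totalFunctor (FChain.dim : FChain P → ℤ)).map_comp _ _).symm

lemma cochainMap_id : cochainMap (𝟙 𝓕) (le_refl p) = 𝟙 _ :=
  (totalFunctor (FChain.dim : FChain P → ℤ)).map_id _

/-- Families of elements indexed by chains. -/
abbrev Cochain : Type u :=
  ∀ (c : {c : FChain P // p ≤ (c.first : WithBot P)}) (q : ℤ), (𝓕.obj c.1.last).X q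

variable {𝓕 𝓖 𝓗 p p' p''}

/-- The value of an element of a column of `cochainTwisted 𝓕 p`. -/
noncomputable def colEval (c : {c : FChain P // p ≤ (c.first : WithBot P)}) (q : ℤ) :
    ((cochainTwisted 𝓕 p).obj c.1).X q →+ (𝓕.obj c.1.last).X q :=
  cpowEval c.2 (𝓕.obj c.1.last) q

/-- The cochain corresponding to a family of elements. -/
noncomputable def toCochain : (cochainTwisted 𝓕 p).Family →+ Cochain 𝓕 p where
  toFun f c q := colEval c q (f c.1 q)
  map_zero' := funext fun c => funext fun q => map_zero (colEval c q)
  map_add' _ _ := funext fun c => funext fun q => map_add (colEval c q) _ _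

lemma toCochain_apply (f : (cochainTwisted 𝓕 p).Family)
    (c : {c : FChain P // p ≤ (c.first : WithBot P)}) (q : ℤ) :
    toCochain f c q = colEval c q (f c.1 q) := rfl

namespace Cochain

/-- The value of a cochain at a finite subset, in the group attached to `y`. -/
noncomputable def evalAt (v : Cochain 𝓕 p) (q : ℤ) (y : P) (s : Finset P) : (𝓕.obj y).X q := by
  classical
  exact
    -- The default value at the empty set matters: with it, the alternating sum over the faces of a
    -- single point is zero, so the cochain complex is not augmented.
    if h : s.Nonempty ∧ IsTotal s ∧ (∀ x ∈ s, p ≤ (x : WithBot P)) ∧ ∀ x ∈ s, x ≤ y then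
      (𝓕.map (homOfLE (h.2.2.2 _ (FChain.last_mem ⟨s, h.1, h.2.1⟩)))).f q
        (v ⟨⟨s, h.1, h.2.1⟩, h.2.2.1 _ (FChain.first_mem ⟨s, h.1, h.2.1⟩)⟩ q)
    else 0

omit [Finite P] in
lemma evalAt_support (v : Cochain 𝓕 p) (q : ℤ) (y : P) (c : FChain P)
    (hp : p ≤ (c.first : WithBot P)) (hy : c.last ≤ y) :
    evalAt v q y c.support = (𝓕.map (homOfLE hy)).f q (v ⟨c, hp⟩ q) :=
  dif_pos ⟨c.nonempty, c.isTotal, fun _ hx => hp.trans (WithBot.coe_le_coe.2 (c.first_le hx)),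
    fun _ hx => (c.le_last hx).trans hy⟩

omit [Finite P] in
lemma evalAt_self (v : Cochain 𝓕 p) (q : ℤ) (c : FChain P) (hp : p ≤ (c.first : WithBot P)) :
    evalAt v q c.last c.support = v ⟨c, hp⟩ q := by
  rw [evalAt_support v q c.last c hp le_rfl, Subsingleton.elim (homOfLE _) (𝟙 _), 𝓕.map_id]
  rfl

omit [Finite P] in
lemma evalAt_empty (v : Cochain 𝓕 p) (q : ℤ) (y : P) : evalAt v q y ∅ = 0 :=
  dif_neg (by simp)

/-- The differential of cochains. -/
noncomputable def D (v : Cochain 𝓕 p) : Cochain 𝓕 p := fun c q =>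
  sgn FChain.dim c.1 • (𝓕.obj c.1.last).d (q - 1) q (v c (q - 1)) +
    altSum (evalAt v q c.1.last) c.1.support

end Cochain

open scoped Classical in
lemma colEval_δ (c : FChain P) (c' : {c : FChain P // p ≤ (c.first : WithBot P)}) (q : ℤ)
    (x : ((cochainTwisted 𝓕 p).obj c).X q) :
    colEval c' q (((cochainTwisted 𝓕 p).δ c c'.1).f q x) =
      incidence c c'.1 • (if h : c.support ⊆ c'.1.support then
        (𝓕.map (homOfLE (last_mono h))).f q
          (colEval ⟨c, c'.2.trans (WithBot.coe_le_coe.2 (first_anti h))⟩ q x) else 0) := by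
  dsimp only [cochainTwisted]
  split_ifs with h
  · rfl
  · rw [smul_zero, smul_zero]
    rfl

/-- The sum of incidence numbers over all chains collapses to the faces of `c`; the empty face is
harmless because `evalAt` vanishes there. -/
lemma toCochain_D (f : (cochainTwisted 𝓕 p).Family) :
    toCochain ((cochainTwisted 𝓕 p).D f) = Cochain.D (toCochain f) := by
  classical
  ext c q
  rw [toCochain_apply, TwistedComplex.D_apply, map_add, map_zsmul, Cochain.D, map_sum,
    ← sum_incidence _ (Cochain.evalAt_empty _ _ _)]
  congr 1
  refine Finset.sum_congr rfl fun c' _ => ?_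
  rw [colEval_δ]
  split_ifs with h
  · rw [Cochain.evalAt_support _ _ _ _ (c.2.trans (WithBot.coe_le_coe.2 (first_anti h)))
      (last_mono h)]
    rfl
  · rw [incidence_eq_zero (fun H => h H.1), zero_smul, zero_smul]

/-- The cochain corresponding to an element of the cochain complex. -/
noncomputable def coch {n : ℤ} : (cochainComplex 𝓕 p).X n →+ Cochain 𝓕 p := toCochain.comp fam

/-- The element of the cochain complex corresponding to a homogeneous cochain. -/
noncomputable def ofCoch {n : ℤ} (v : Cochain 𝓕 p) (hv : ∀ c q, c.1.dim + q ≠ n → v c q = 0) :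
    (cochainComplex 𝓕 p).X n :=
  ofFam (fun c q hc => v ⟨c, hc.down⟩ q) (fun _ q h => funext fun hc => hv ⟨_, hc.down⟩ q h)

lemma coch_eq_zero {n : ℤ} (x : (cochainComplex 𝓕 p).X n)
    (c : {c : FChain P // p ≤ (c.first : WithBot P)}) (q : ℤ) (h : c.1.dim + q ≠ n) :
    coch x c q = 0 :=
  congr_fun (fam_eq_zero x c.1 q h) ⟨c.2⟩

lemma coch_d {n m : ℤ} (h : n + 1 = m) (x : (cochainComplex 𝓕 p).X n) :
    coch ((cochainComplex 𝓕 p).d n m x) = Cochain.D (coch x) := by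
  refine (congr_arg toCochain (fam_d h x)).trans (toCochain_D _)

lemma coch_ext {n : ℤ} {x y : (cochainComplex 𝓕 p).X n}
    (h : ∀ c q, c.1.dim + q = n → coch x c q = coch y c q) : x = y :=
  total_ext fun c q hq => funext fun hc => h ⟨c, hc.down⟩ q hq

lemma coch_map (τ : 𝓕 ⟶ 𝓖) (h : p ≤ p') {n : ℤ} (x : (cochainComplex 𝓕 p).X n)
    (c : {c : FChain P // p' ≤ (c.first : WithBot P)}) (q : ℤ) :
    coch ((cochainMap τ h).f n x) c q =
      (τ.app c.1.last).f q (coch x ⟨c.1, h.trans c.2⟩ q) := rfl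

/-- A finite poset has finitely many chains, so the columnwise criterion applies with no boundedness
assumption on the diagrams. -/
lemma quasiIso_cochainMap (τ : 𝓕 ⟶ 𝓖) [∀ x, QuasiIso (τ.app x)] :
    QuasiIso (cochainMap τ (le_refl p)) := by
  have : ∀ c, QuasiIso ((cochainTwistedMap τ (le_refl p)).app c) := fun c =>
    quasiIso_cpowMap (le_refl p).trans (τ.app c.last)
  exact quasiIso_totalMap (cochainTwistedMap τ (le_refl p))

end Cochains

end FiniteSpace

namespace FiniteSpace

/-! ### Joins of cochains with a chain, and their differential. -/

section

variable {P : Type u} [PartialOrder P]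

lemma map_altSum {A B : Type*} [AddCommGroup A] [AddCommGroup B] (φ : A →+ B) (g : Finset P → A)
    (s : Finset P) : φ (altSum g s) = altSum (fun t => φ (g t)) s := by
  simp only [altSum, map_sum, map_zsmul]

lemma altSum_congr {A : Type*} [AddCommGroup A] {g g' : Finset P → A} {s : Finset P}
    (h : ∀ t, t ⊂ s → g t = g' t) : altSum g s = altSum g' s :=
  Finset.sum_congr rfl fun x hx => by
    classical
    exact congr_arg (faceSign s x • ·) (h _ (Finset.erase_ssubset hx))

lemma altSum_singleton {A : Type*} [AddCommGroup A] (g : Finset P → A) (x : P) :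
    altSum g {x} = g ∅ := by
  classical
  rw [altSum, Finset.sum_singleton, faceSign, Finset.filter_false_of_mem (by simp)]
  simp

open scoped Classical in
-- Only a two-element `s` has faces with one point, and its two faces carry opposite signs. In
-- effect, a constant 0-cochain is a cocycle.
lemma altSum_card_eq_one {A : Type*} [AddCommGroup A] (v : A) {s : Finset P} (hs : IsTotal s) :
    altSum (fun t => if t.card = 1 then v else 0) s = 0 := by
  by_cases h : s.card = 2
  · obtain ⟨a, b, hab, rfl⟩ := Finset.card_eq_two.1 h
    wlog hlt : a < b generalizing a b with H
    · have : b < a := lt_of_le_of_ne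
        ((hs a (by simp) b (by simp)).resolve_left fun h => hlt (lt_of_le_of_ne h hab)) hab.symm
      rw [Finset.pair_comm] at hs h ⊢
      exact H b a hab.symm hs h this
    have h₁ : faceSign {a, b} a = 1 := by
      rw [faceSign, Finset.filter_false_of_mem]
      · rfl
      · simp [hlt.not_gt]
    have h₂ : faceSign {a, b} b = -1 := by
      rw [faceSign, Finset.filter_insert, if_pos hlt, Finset.filter_singleton,
        if_neg (lt_irrefl b)]
      rfl
    rw [altSum, Finset.sum_pair hab, h₁, h₂]
    have e : ∀ x ∈ ({a, b} : Finset P), (({a, b} : Finset P).erase x).card = 1 := fun x hx => by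
      rw [Finset.card_erase_of_mem hx, h]
    rw [if_pos (e a (by simp)), if_pos (e b (by simp))]
    simp
  · refine Finset.sum_eq_zero fun x hx => ?_
    have : (s.erase x).card ≠ 1 := by
      rw [Finset.card_erase_of_mem hx]
      omega
    simp [this]

lemma sgn_dim (c : FChain P) : TwistedComplex.sgn FChain.dim c = -(-1) ^ c.support.card := by
  rw [TwistedComplex.sgn, FChain.dim, Int.negOnePow_sub, Int.negOnePow_one]
  simp [Int.negOnePow_def]

end

section Cochains

variable {P : Type u} [PartialOrder P]
  {𝓕 𝓖 𝓗 : P ⥤ CochainComplex AddCommGrpCat.{u} ℤ} {p p' p'' : WithBot P}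

open FChain TwistedComplex

namespace Cochain

lemma map_evalAt (v : Cochain 𝓕 p) (q : ℤ) {y y' : P} (h : y ≤ y') {s : Finset P}
    (hs : ∀ x ∈ s, x ≤ y) :
    (𝓕.map (homOfLE h)).f q (evalAt v q y s) = evalAt v q y' s := by
  rw [evalAt, evalAt]
  by_cases H : s.Nonempty ∧ IsTotal s ∧ (∀ x ∈ s, p ≤ (x : WithBot P))
  · rw [dif_pos ⟨H.1, H.2.1, H.2.2, hs⟩, dif_pos ⟨H.1, H.2.1, H.2.2, fun x hx => (hs x hx).trans h⟩,
      ← ConcreteCategory.comp_apply, ← HomologicalComplex.comp_f, ← 𝓕.map_comp]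
    rfl
  · rw [dif_neg fun H' => H ⟨H'.1, H'.2.1, H'.2.2.1⟩, dif_neg fun H' => H ⟨H'.1, H'.2.1, H'.2.2.1⟩,
      map_zero]

lemma evalAt_zero (q : ℤ) (y : P) (s : Finset P) : evalAt (0 : Cochain 𝓕 p) q y s = 0 := by
  rw [evalAt]
  split_ifs
  · exact map_zero _
  · rfl

lemma evalAt_add (v w : Cochain 𝓕 p) (q : ℤ) (y : P) (s : Finset P) :
    evalAt (v + w) q y s = evalAt v q y s + evalAt w q y s := by
  rw [evalAt, evalAt, evalAt]
  split_ifs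
  · exact map_add _ _ _
  · exact (add_zero 0).symm

lemma evalAt_D (v : Cochain 𝓕 p) (q : ℤ) (y : P) {s : Finset P} (hs : IsTotal s)
    (hp : ∀ x ∈ s, p ≤ (x : WithBot P)) (hy : ∀ x ∈ s, x ≤ y) :
    evalAt (D v) q y s = -(-1) ^ s.card • (𝓕.obj y).d (q - 1) q (evalAt v (q - 1) y s) +
      altSum (evalAt v q y) s := by
  rcases s.eq_empty_or_nonempty with rfl | h
  · rw [evalAt_empty, evalAt_empty, altSum_empty, map_zero, smul_zero, zero_add]
  · obtain ⟨c, rfl⟩ : ∃ c : FChain P, c.support = s := ⟨⟨s, h, hs⟩, rfl⟩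
    have hp' := hp _ c.first_mem
    have hy' := hy _ c.last_mem
    rw [evalAt_support _ _ _ _ hp' hy', evalAt_support _ _ _ _ hp' hy', D, map_add, map_zsmul,
      sgn_dim, map_altSum]
    congr 1
    · congr 1
      exact ConcreteCategory.congr_hom ((𝓕.map (homOfLE hy')).comm (q - 1) q).symm _
    · exact altSum_congr fun t ht => map_evalAt v q hy' fun x hx => c.le_last (ht.1 hx)

/-- The cochain obtained by evaluating on the join with `s`. -/
noncomputable def join (s : Finset P) (v : Cochain 𝓕 p) : Cochain 𝓕 p' := fun c q =>
  joinEval (evalAt v q c.1.last) s c.1.support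

lemma evalAt_join {s t : Finset P} (v : Cochain 𝓕 p) (q : ℤ) (y : P) (ht : IsTotal t)
    (htn : t.Nonempty) (hp : ∀ x ∈ t, p' ≤ (x : WithBot P)) (hy : ∀ x ∈ t, x ≤ y)
    (hst : ∀ x ∈ s, ∀ z ∈ t, x ≤ z) :
    evalAt (join s v : Cochain 𝓕 p') q y t = joinEval (evalAt v q y) s t := by
  classical
  obtain ⟨c, rfl⟩ : ∃ c : FChain P, c.support = t := ⟨⟨t, htn, ht⟩, rfl⟩
  have hy' := hy _ c.last_mem
  rw [evalAt_support _ _ _ _ (hp _ c.first_mem) hy', join, joinEval, joinEval]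
  split_ifs
  · rw [map_zsmul, map_evalAt v q hy']
    intro x hx
    rcases Finset.mem_union.1 hx with hx | hx
    · exact hst x hx _ c.last_mem
    · exact c.le_last hx
  · exact map_zero _

lemma joinEval_add {A : Type*} [AddCommGroup A] (g g' : Finset P → A) (s t : Finset P) :
    joinEval (fun r => g r + g' r) s t = joinEval g s t + joinEval g' s t := by
  simp only [joinEval]
  split_ifs
  · exact smul_add _ _ _
  · exact (add_zero 0).symm

/-- The failure of the join to commute with the differentials. -/
lemma D_join (s : Finset P) (v : Cochain 𝓕 p) (hs : IsTotal s)
    (hp : ∀ x ∈ s, p ≤ (x : WithBot P)) (hp' : ∀ x ∈ s, (x : WithBot P) ≤ p') (hpp' : p ≤ p')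
    (c : {c : FChain P // p' ≤ (c.first : WithBot P)}) (q : ℤ) :
    D (join s v : Cochain 𝓕 p') c q = (-1) ^ s.card •
      (altSum (fun t => (join t v : Cochain 𝓕 p') c q) s + (join s (D v) : Cochain 𝓕 p') c q -
        if c.1.dim = 0 then evalAt v q c.1.last s else 0) := by
  classical
  obtain ⟨c, hc⟩ := c
  have hst : ∀ x ∈ s, ∀ z ∈ c.support, x ≤ z := fun x hx z hz =>
    (WithBot.coe_le_coe.1 ((hp' x hx).trans hc)).trans (c.first_le hz)
  have htp : ∀ x ∈ c.support, p' ≤ (x : WithBot P) := fun x hx =>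
    hc.trans (WithBot.coe_le_coe.2 (c.first_le hx))
  -- Passing from `c` to `s ∪ c` multiplies the sign of the internal differential by `(-1) ^
  -- s.card`.
  have h₁ : (join s (D v) : Cochain 𝓕 p') ⟨c, hc⟩ q =
      (-1) ^ s.card • sgn FChain.dim c • (𝓕.obj c.last).d (q - 1) q
        ((join s v : Cochain 𝓕 p') ⟨c, hc⟩ (q - 1)) +
      joinEval (altSum (evalAt v q c.last)) s c.support := by
    simp only [join, joinEval]
    split_ifs with hB
    · have hst' : Disjoint s c.support :=
        Finset.disjoint_left.2 fun x hx hx' => lt_irrefl _ (hB x hx x hx')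
      rw [evalAt_D, Finset.card_union_of_disjoint hst', sgn_dim, smul_add, map_zsmul, pow_add]
      · congr 1
        simp only [smul_smul]
        congr 1
        ring
      · intro x hx y hy
        rcases Finset.mem_union.1 hx with hx | hx <;> rcases Finset.mem_union.1 hy with hy | hy
        · exact hs x hx y hy
        · exact Or.inl (hst x hx y hy)
        · exact Or.inr (hst y hy x hx)
        · exact c.isTotal x hx y hy
      · intro x hx
        rcases Finset.mem_union.1 hx with hx | hx
        · exact hp x hx
        · exact hpp'.trans (htp x hx)
      · intro x hx
        rcases Finset.mem_union.1 hx with hx | hx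
        · exact hst x hx _ c.last_mem
        · exact c.le_last hx
    · rw [map_zero, smul_zero, smul_zero, add_zero]
  -- The two sides differ only when `c` is a point: its empty face contributes nothing to the
  -- cochain `join s v`, but `joinEval` at the empty set is the value of `v` at `s`. This is the
  -- source of the correction term.
  have h₂ : altSum (evalAt (join s v : Cochain 𝓕 p') q c.last) c.support =
      altSum (joinEval (evalAt v q c.last) s) c.support -
        (-1) ^ s.card • (if c.dim = 0 then evalAt v q c.last s else 0) := by
    by_cases hd : c.dim = 0
    · rw [if_pos hd]
      obtain ⟨x, rfl⟩ := dim_eq_zero_iff.1 hd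
      have : (point x).support = {x} := rfl
      have hB : Below s ∅ := by simp [Below]
      rw [this, altSum_singleton, altSum_singleton, evalAt_empty, joinEval, if_pos hB, Finset.union_empty, sub_self]
    · rw [if_neg hd, smul_zero, sub_zero]
      refine Finset.sum_congr rfl fun x hx => ?_
      have hsub := Finset.erase_subset x c.support
      rw [evalAt_join v q _ (c.isTotal.mono hsub) _ (fun z hz => htp z (hsub hz))
        (fun z hz => c.le_last (hsub hz)) (fun z hz w hw => hst z hz w (hsub hw))]
      rw [← Finset.card_pos, Finset.card_erase_of_mem hx]
      rw [FChain.dim] at hd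
      have := c.nonempty.card_pos
      omega
  have h₃ := joinEval_altSum (evalAt v q c.last) hst
  have e : ((-1 : ℤ) ^ s.card) * (-1) ^ s.card = 1 := by rw [← mul_pow]; simp
  change sgn FChain.dim c • (𝓕.obj c.last).d (q - 1) q
    ((join s v : Cochain 𝓕 p') ⟨c, hc⟩ (q - 1)) +
    altSum (evalAt (join s v : Cochain 𝓕 p') q c.last) c.support = _
  have h₄ : altSum (joinEval (evalAt v q c.last) s) c.support = (-1 : ℤ) ^ s.card •
      (altSum (fun t => (join t v : Cochain 𝓕 p') ⟨c, hc⟩ q) s +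
        joinEval (altSum (evalAt v q c.last)) s c.support) := by
    have := congr_arg (fun z => (-1 : ℤ) ^ s.card • z) h₃
    simp only [smul_add, smul_sub, smul_smul, e, one_smul, smul_zero] at this
    rw [smul_add]
    rw [← sub_eq_zero, ← neg_eq_zero, ← this]
    simp only [join]
    abel
  rw [h₁, h₂, h₄]
  simp only [smul_add, smul_sub, smul_smul, ← mul_assoc, e, one_mul]
  abel

lemma join_empty (h : p ≤ p') (v : Cochain 𝓕 p)
    (c : {c : FChain P // p' ≤ (c.first : WithBot P)}) (q : ℤ) :
    (join ∅ v : Cochain 𝓕 p') c q = v ⟨c.1, h.trans c.2⟩ q := by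
  classical
  have hB : Below ∅ c.1.support := by simp [Below]
  rw [join, joinEval, if_pos hB, Finset.card_empty, pow_zero, one_smul,
    Finset.empty_union, evalAt_self]

end Cochain

end Cochains

end FiniteSpace

/-! ### Augmentation by cones, and contractibility above a point. -/

namespace FiniteSpace

/-- The family of elements of all degrees with a single nonzero component. -/
def homog (K : CochainComplex AddCommGrpCat.{u} ℤ) (n : ℤ) : K.X n →+ ∀ q, K.X q :=
  AddMonoidHom.single (fun q => K.X q) n

section Homog

variable {K L : CochainComplex AddCommGrpCat.{u} ℤ}

@[simp]
lemma homog_same (n : ℤ) (x : K.X n) : homog K n x n = x := by simp [homog]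

lemma homog_of_ne {n q : ℤ} (h : q ≠ n) (x : K.X n) : homog K n x q = 0 := by simp [homog, h]

lemma map_homog (φ : K ⟶ L) (n q : ℤ) (x : K.X n) :
    φ.f q (homog K n x q) = homog L n (φ.f n x) q := by
  by_cases h : q = n
  · subst h
    simp
  · rw [homog_of_ne h, homog_of_ne h, map_zero]

lemma d_homog {n m : ℤ} (hnm : n + 1 = m) (q : ℤ) (x : K.X n) :
    K.d (q - 1) q (homog K n x (q - 1)) = homog K m (K.d n m x) q := by
  by_cases h : q = m
  · subst h
    obtain rfl : n = q - 1 := by omega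
    simp
  · rw [homog_of_ne h, homog_of_ne (by omega), map_zero]

end Homog

section Augmentation

variable {P : Type u} [PartialOrder P] [Finite P]
  {𝓕 𝓖 𝓗 : P ⥤ CochainComplex AddCommGrpCat.{u} ℤ} {p p' p'' : WithBot P}

open FChain TwistedComplex

variable (𝓕 p) in
/-- The cones over the restriction of `𝓕` to the points above `p`. -/
@[ext]
structure ConeAbove (K : CochainComplex AddCommGrpCat.{u} ℤ) where
  /-- the projections of the cone -/
  π : ∀ y : P, p ≤ (y : WithBot P) → (K ⟶ 𝓕.obj y)
  w : ∀ (y y' : P) (h : y ≤ y') (hp : p ≤ (y : WithBot P)),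
    π y hp ≫ 𝓕.map (homOfLE h) = π y' (hp.trans (WithBot.coe_le_coe.2 h))

variable {K L : CochainComplex AddCommGrpCat.{u} ℤ}

open scoped Classical in
/-- The cochain attached to an element of the top of a cone. -/
noncomputable def augCochain (s : ConeAbove 𝓕 p K) (n : ℤ) : K.X n →+ Cochain 𝓕 p where
  toFun x c q := if c.1.dim = 0 then
    homog (𝓕.obj c.1.last) n ((s.π c.1.last
      (c.2.trans (WithBot.coe_le_coe.2 (c.1.first_le c.1.last_mem)))).f n x) q else 0
  map_zero' := by
    ext
    simp
  map_add' x y := by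
    ext c q
    simp only [map_add, Pi.add_apply]
    split_ifs
    · rfl
    · exact (add_zero 0).symm

omit [Finite P] in
lemma evalAt_augCochain (s : ConeAbove 𝓕 p K) (n : ℤ) (x : K.X n) (q : ℤ) (y : P)
    (hy : p ≤ (y : WithBot P)) {t : Finset P} (ht : IsTotal t)
    (hpt : ∀ z ∈ t, p ≤ (z : WithBot P)) (hyt : ∀ z ∈ t, z ≤ y) :
    Cochain.evalAt (augCochain s n x) q y t =
      if t.card = 1 then homog (𝓕.obj y) n ((s.π y hy).f n x) q else 0 := by
  classical
  rcases t.eq_empty_or_nonempty with rfl | h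
  · simp [Cochain.evalAt_empty]
  · obtain ⟨c, rfl⟩ : ∃ c : FChain P, c.support = t := ⟨⟨t, h, ht⟩, rfl⟩
    have hc : c.dim = 0 ↔ c.support.card = 1 := by
      rw [FChain.dim]
      omega
    rw [Cochain.evalAt_support _ _ _ _ (hpt _ c.first_mem) (hyt _ c.last_mem)]
    by_cases hd : c.dim = 0
    · rw [if_pos (hc.1 hd), ← s.w c.last y (hyt _ c.last_mem) (hpt _ c.last_mem),
        HomologicalComplex.comp_f, ConcreteCategory.comp_apply, ← map_homog]
      congr 1
      exact if_pos hd
    · rw [if_neg (fun H => hd (hc.2 H))]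
      have : augCochain s n x ⟨c, hpt _ c.first_mem⟩ q = 0 := if_neg hd
      rw [this, map_zero]

omit [Finite P] in
-- Compatibility of the cone makes the values on all points agree once pushed to the last point, so
-- the face sum vanishes by `altSum_card_eq_one`. In dimension zero the internal differential has
-- sign `1`.
lemma D_augCochain (s : ConeAbove 𝓕 p K) {n m : ℤ} (hnm : n + 1 = m) (x : K.X n) :
    Cochain.D (augCochain s n x) = augCochain s m (K.d n m x) := by
  classical
  ext ⟨c, hc⟩ q
  have h₀ : ∀ z ∈ c.support, p ≤ (z : WithBot P) := fun z hz =>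
    hc.trans (WithBot.coe_le_coe.2 (c.first_le hz))
  have h₁ : altSum (Cochain.evalAt (augCochain s n x) q c.last) c.support = 0 := by
    rw [← altSum_card_eq_one (homog (𝓕.obj c.last) n ((s.π c.last (h₀ _ c.last_mem)).f n x) q)
      c.isTotal]
    refine altSum_congr fun t ht => ?_
    exact evalAt_augCochain s n x q c.last _ (c.isTotal.mono ht.1) (fun z hz => h₀ z (ht.1 hz))
      (fun z hz => c.le_last (ht.1 hz))
  rw [Cochain.D, h₁, add_zero]
  by_cases hd : c.dim = 0
  · have e : ∀ (n q : ℤ) (x : K.X n), augCochain s n x ⟨c, hc⟩ q =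
        homog (𝓕.obj c.last) n ((s.π c.last (h₀ _ c.last_mem)).f n x) q := fun n q x => if_pos hd
    rw [e, e, d_homog hnm, TwistedComplex.sgn, hd, Int.negOnePow_zero, Units.val_one, one_smul]
    exact congr_arg (fun z => homog (𝓕.obj c.last) m z q)
      (ConcreteCategory.congr_hom ((s.π c.last (h₀ _ c.last_mem)).comm n m) x)
  · have e : ∀ (n q : ℤ) (x : K.X n), augCochain s n x ⟨c, hc⟩ q = 0 := fun n q x => if_neg hd
    rw [e, e, map_zero, smul_zero]

/-- The morphism to the cochain complex corresponding to a morphism to cochains. -/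
noncomputable def ofCochHom {A : Type*} [AddCommGroup A] {n : ℤ} (φ : A →+ Cochain 𝓕 p)
    (hφ : ∀ x c q, c.1.dim + q ≠ n → φ x c q = 0) : A →+ (cochainComplex 𝓕 p).X n where
  toFun x := ofCoch (φ x) (hφ x)
  map_zero' := coch_ext fun c q _ => congr_fun (congr_fun (map_zero φ) c) q
  map_add' x y := coch_ext fun c q _ => congr_fun (congr_fun (map_add φ x y) c) q

/-- The morphism to the cochain complex corresponding to a cone. -/
noncomputable def aug (s : ConeAbove 𝓕 p K) : K ⟶ cochainComplex 𝓕 p where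
  f n := AddCommGrpCat.ofHom (ofCochHom (augCochain s n) fun x c q h => by
    by_cases hd : c.1.dim = 0
    · exact (if_pos hd).trans (homog_of_ne (by omega) _)
    · exact if_neg hd)
  comm' n m h := by
    refine AddCommGrpCat.hom_ext (AddMonoidHom.ext fun x => coch_ext fun c q _ => ?_)
    refine congr_fun (congr_fun ((coch_d h _).trans ?_) c) q
    exact D_augCochain s h x

lemma coch_aug (s : ConeAbove 𝓕 p K) (n : ℤ) (x : K.X n) :
    coch ((aug s).f n x) = augCochain s n x := rfl

lemma coch_aug_of_dim_eq_zero (s : ConeAbove 𝓕 p K) (n : ℤ) (x : K.X n)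
    (c : {c : FChain P // p ≤ (c.first : WithBot P)}) (q : ℤ) (hc : c.1.dim = 0) :
    coch ((aug s).f n x) c q = homog (𝓕.obj c.1.last) n ((s.π c.1.last
      (c.2.trans (WithBot.coe_le_coe.2 (c.1.first_le c.1.last_mem)))).f n x) q := if_pos hc

lemma coch_aug_of_dim_ne_zero (s : ConeAbove 𝓕 p K) (n : ℤ) (x : K.X n)
    (c : {c : FChain P // p ≤ (c.first : WithBot P)}) (q : ℤ) (hc : c.1.dim ≠ 0) :
    coch ((aug s).f n x) c q = 0 := if_neg hc

/-- Precomposition of a cone with a morphism. -/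
def ConeAbove.precomp (s : ConeAbove 𝓕 p K) (φ : L ⟶ K) : ConeAbove 𝓕 p L where
  π y hy := φ ≫ s.π y hy
  w y y' h hp := by rw [Category.assoc, s.w]

/-- Postcomposition of a cone with a morphism. -/
def ConeAbove.postcomp (s : ConeAbove 𝓕 p K) (τ : 𝓕 ⟶ 𝓖) (h : p ≤ p') : ConeAbove 𝓖 p' K where
  π y hy := s.π y (h.trans hy) ≫ τ.app y
  w y y' h hp := by rw [Category.assoc, ← τ.naturality, ← s.w _ _ h, Category.assoc]

lemma aug_precomp (s : ConeAbove 𝓕 p K) (φ : L ⟶ K) : aug (s.precomp φ) = φ ≫ aug s := rfl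

/-- Together with `aug_precomp`, this reduces the commutation of squares of augmentations to
equalities of cones. -/
lemma aug_postcomp (s : ConeAbove 𝓕 p K) (τ : 𝓕 ⟶ 𝓖) (h : p ≤ p') :
    aug (s.postcomp τ h) = aug s ≫ cochainMap τ h := by
  ext n x
  refine coch_ext fun c q _ => ?_
  rw [HomologicalComplex.comp_f, ConcreteCategory.comp_apply, coch_map]
  by_cases hd : c.1.dim = 0
  · rw [coch_aug_of_dim_eq_zero _ _ _ _ _ hd, coch_aug_of_dim_eq_zero s n x ⟨c.1, _⟩ q hd, map_homog]
    rfl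
  · rw [coch_aug_of_dim_ne_zero _ _ _ _ _ hd, coch_aug_of_dim_ne_zero s n x ⟨c.1, _⟩ q hd, map_zero]

variable (𝓕) in
/-- The cone whose top is the value of `𝓕` at a point. -/
def pointCone (p : P) : ConeAbove 𝓕 p (𝓕.obj p) where
  π y hy := 𝓕.map (homOfLE (WithBot.coe_le_coe.1 hy))
  w y y' h hp := by
    rw [← 𝓕.map_comp]
    rfl

/-- A join of `p` with a nonempty chain strictly above it has at least two points, while an
augmentation is supported on single points. -/
lemma coch_aug_pointCone_join {p : P} (n : ℤ) (x : (𝓕.obj p).X n)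
    (c : {c : FChain P // (p : WithBot P) ≤ (c.first : WithBot P)}) (q : ℤ) :
    (Cochain.join {p} (coch ((aug (pointCone 𝓕 p)).f n x)) : Cochain 𝓕 (p : WithBot P)) c q = 0 := by
  classical
  rw [Cochain.join, joinEval]
  split_ifs with h
  · obtain ⟨c, hc⟩ := c
    have hpl : ∀ z ∈ c.support, p ≤ z := fun z hz =>
      (WithBot.coe_le_coe.1 hc).trans (c.first_le hz)
    have hcard : ({p} ∪ c.support : Finset P).card ≠ 1 := by
      have hd : Disjoint {p} c.support := Finset.disjoint_left.2 fun z hz hz' =>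
        lt_irrefl _ (h z hz z hz')
      rw [Finset.card_union_of_disjoint hd, Finset.card_singleton]
      have := c.nonempty.card_pos
      omega
    rw [coch_aug, evalAt_augCochain (pointCone 𝓕 p) n x q c.last
      (WithBot.coe_le_coe.2 (hpl _ c.last_mem)), if_neg hcard, smul_zero]
    · intro z hz z' hz'
      rcases Finset.mem_union.1 hz with hz | hz <;> rcases Finset.mem_union.1 hz' with hz' | hz'
      · rw [Finset.mem_singleton.1 hz, Finset.mem_singleton.1 hz']
        exact Or.inl le_rfl
      · rw [Finset.mem_singleton.1 hz]
        exact Or.inl (hpl _ hz')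
      · rw [Finset.mem_singleton.1 hz']
        exact Or.inr (hpl _ hz)
      · exact c.isTotal z hz z' hz'
    · intro z hz
      rcases Finset.mem_union.1 hz with hz | hz
      · rw [Finset.mem_singleton.1 hz]
      · exact WithBot.coe_le_coe.2 (hpl _ hz)
    · intro z hz
      rcases Finset.mem_union.1 hz with hz | hz
      · rw [Finset.mem_singleton.1 hz]
        exact hpl _ c.last_mem
      · exact c.le_last hz
  · rfl

/-- The value of `𝓕` at `p` is quasi-isomorphic to the cochain complex of the points above `p`. -/
lemma quasiIso_aug_pointCone (p : P) : QuasiIso (aug (pointCone 𝓕 p)) := by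
  classical
  refine quasiIso_of_coneAcyclic _ fun a b c d hab hbc hcd x y hx hy => ?_
  have hpt : IsTotal ({p} : Finset P) := (point p).isTotal
  have hpp : ∀ z ∈ ({p} : Finset P), (p : WithBot P) ≤ (z : WithBot P) := by simp
  have hpp' : ∀ z ∈ ({p} : Finset P), (z : WithBot P) ≤ (p : WithBot P) := by simp
  have hpp'' : ∀ z ∈ ({p} : Finset P), z ≤ p := by simp
  let v := coch y
  -- Cone contraction: `p` is the least point, so it can be added in front of any chain not
  -- containing it.
  let h : (cochainComplex 𝓕 (p : WithBot P)).X a := ofCoch (Cochain.join {p} v) fun e q he => by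
    rw [Cochain.join, joinEval]
    split_ifs with hB
    · rw [Cochain.evalAt]
      split_ifs with H
      · rw [show v _ q = 0 from coch_eq_zero _ _ _ ?_, map_zero, smul_zero]
        have hd : Disjoint {p} e.1.support := Finset.disjoint_left.2 fun z hz hz' =>
          lt_irrefl _ (hB z hz z hz')
        rw [FChain.dim] at he ⊢
        dsimp only
        rw [Finset.card_union_of_disjoint hd, Finset.card_singleton]
        push_cast
        omega
      · exact smul_zero _
    · rfl
  -- For `s = {p}`, `D_join` reads `D h = -(v - aug (v {p}))`, since the join of `{p}` with the
  -- differential of `v` vanishes. This dictates the value at `{p}` and the minus sign.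
  refine ⟨Cochain.evalAt v b p {p}, -h, ?_, ?_⟩
  · have h₁ := Cochain.evalAt_D v c p hpt hpp hpp''
    obtain rfl : b = c - 1 := by omega
    rw [altSum_singleton, Cochain.evalAt_empty, add_zero, Finset.card_singleton, pow_one,
      neg_neg, one_smul] at h₁
    rw [← h₁, ← coch_d hbc, ← hy, coch_aug, evalAt_augCochain (pointCone 𝓕 p) c x c p le_rfl hpt
      hpp hpp'', if_pos (Finset.card_singleton p), homog_same, pointCone]
    exact ConcreteCategory.congr_hom (HomologicalComplex.congr_hom (𝓕.map_id p) c) x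
  · refine coch_ext fun e q he => ?_
    have h₂ := Cochain.D_join (p' := (p : WithBot P)) {p} v hpt hpp hpp' le_rfl e q
    have h₃ : (Cochain.join {p} (Cochain.D v) : Cochain 𝓕 (p : WithBot P)) e q = 0 := by
      rw [← coch_d hbc, ← hy]
      exact coch_aug_pointCone_join c x e q
    rw [h₃, altSum_singleton, Cochain.join_empty le_rfl, Finset.card_singleton, pow_one, add_zero,
      neg_smul, one_smul] at h₂
    rw [map_neg, map_add, map_neg, coch_d hab]
    change v e q = coch _ e q + - Cochain.D (Cochain.join {p} v) e q
    rw [h₂, neg_neg]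
    by_cases hd : e.1.dim = 0
    · obtain rfl : q = b := by omega
      rw [if_pos hd, coch_aug_of_dim_eq_zero _ _ _ _ _ hd, homog_same, pointCone]
      dsimp only
      rw [Cochain.map_evalAt v q _ hpp'']
      abel
    · rw [if_neg hd, coch_aug_of_dim_ne_zero _ _ _ _ _ hd]
      abel

end Augmentation

end FiniteSpace

namespace FiniteSpace

/-! ### The cochain resolution and the join homotopy. -/

section Resolution

variable {P : Type u} [PartialOrder P] [Finite P]

open FChain TwistedComplex

/-- The functor sending `𝓕` to the complex of cochains on the points above `p`. -/
noncomputable def cochainFunctor (p : WithBot P) :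
    (P ⥤ CochainComplex AddCommGrpCat.{u} ℤ) ⥤ CochainComplex AddCommGrpCat.{u} ℤ where
  obj 𝓕 := cochainComplex 𝓕 p
  map τ := cochainMap τ le_rfl
  map_id 𝓕 := cochainMap_id 𝓕 p
  map_comp τ τ' := (cochainMap_comp τ τ' le_rfl le_rfl).symm

/-- The functor sending `𝓕` to the functor of cochains on the points above a variable point. -/
noncomputable def resolution :
    (P ⥤ CochainComplex AddCommGrpCat.{u} ℤ) ⥤ (P ⥤ CochainComplex AddCommGrpCat.{u} ℤ) where
  obj 𝓕 :=
    { obj := fun p => cochainComplex 𝓕 p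
      map := fun h => cochainMap (𝟙 𝓕) (WithBot.coe_le_coe.2 (leOfHom h))
      map_id := fun p => cochainMap_id 𝓕 p
      map_comp := fun f g => by rw [cochainMap_comp, Category.comp_id] }
  map τ :=
    { app := fun p => cochainMap τ le_rfl
      naturality := fun p q f => by
        simp only [cochainMap_comp, Category.comp_id, Category.id_comp] }
  map_id 𝓕 := by
    ext p : 2
    exact cochainMap_id 𝓕 p
  map_comp τ τ' := by
    ext p : 2
    exact (cochainMap_comp τ τ' le_rfl le_rfl).symm

variable (𝓕 𝓖 : P ⥤ CochainComplex AddCommGrpCat.{u} ℤ)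

/-- The augmentation of the resolution. -/
noncomputable def resolutionUnit :
    𝟭 (P ⥤ CochainComplex AddCommGrpCat.{u} ℤ) ⟶ resolution where
  app 𝓕 :=
    { app := fun p => aug (pointCone 𝓕 p)
      naturality := fun p q f => by
        have e : (pointCone 𝓕 q).precomp (𝓕.map f) =
            (pointCone 𝓕 p).postcomp (𝟙 𝓕) (WithBot.coe_le_coe.2 (leOfHom f)) := by
          ext y hy : 3
          dsimp [ConeAbove.precomp, ConeAbove.postcomp, pointCone]
          rw [Category.comp_id, ← 𝓕.map_comp]
          rfl
        exact (aug_precomp _ _).symm.trans ((congr_arg aug e).trans (aug_postcomp _ _ _)) }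
  naturality 𝓕 𝓖 τ := by
    ext p : 2
    have e : (pointCone 𝓖 p).precomp (τ.app p) = (pointCone 𝓕 p).postcomp τ le_rfl := by
      ext y hy : 3
      exact (τ.naturality _).symm
    exact (aug_precomp _ _).symm.trans ((congr_arg aug e).trans (aug_postcomp _ _ _))

instance (p : P) : QuasiIso ((resolutionUnit.app 𝓕).app p) := quasiIso_aug_pointCone p

/-- The cone over the resolution of `𝓕` whose top consists of all the cochains. -/
noncomputable def botCone : ConeAbove (resolution.obj 𝓕) ⊥ (cochainComplex 𝓕 ⊥) where
  π y _ := cochainMap (𝟙 𝓕) bot_le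
  w y y' h _ := by
    refine (cochainMap_comp _ _ _ _).trans ?_
    rw [Category.comp_id]

variable {𝓕}

/-- The value of a cochain at a chain. -/
noncomputable def cochEval {q : ℤ} {p : WithBot P} (d : {d : FChain P // p ≤ d.first}) (r : ℤ) :
    (cochainComplex 𝓕 p).X q →+ (𝓕.obj d.1.last).X r where
  toFun x := coch x d r
  map_zero' := by rw [map_zero]; rfl
  map_add' x x' := by rw [map_add]; rfl

/-- The value of a cochain of the resolution at a chain. -/
noncomputable def biEval {q : ℤ} {y : P} (d : {d : FChain P // (y : WithBot P) ≤ d.first}) (r : ℤ) :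
    ((resolution.obj 𝓕).obj y).X q →+ (𝓕.obj d.1.last).X r :=
  cochEval d r

lemma resolution_ext {q : ℤ} {y : P} {x x' : ((resolution.obj 𝓕).obj y).X q}
    (h : ∀ d r, d.1.dim + r = q → biEval d r x = biEval d r x') : x = x' :=
  coch_ext h

lemma biEval_map {q : ℤ} {y y' : P} (h : y ≤ y')
    (d : {d : FChain P // (y' : WithBot P) ≤ d.first}) (r : ℤ)
    (x : ((resolution.obj 𝓕).obj y).X q) :
    biEval d r (((resolution.obj 𝓕).map (homOfLE h)).f q x) =
      biEval (⟨d.1, (WithBot.coe_le_coe.2 h).trans d.2⟩ :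
        {d : FChain P // (y : WithBot P) ≤ d.first}) r x := rfl

omit [Finite P] in
lemma join_homogeneous {p p' : WithBot P} {n : ℤ} (v : Cochain 𝓕 p)
    (hv : ∀ c q, c.1.dim + q ≠ n → v c q = 0) (c : FChain P)
    (d : {d : FChain P // p' ≤ d.first}) (r : ℤ) (h : c.dim + d.1.dim + 1 + r ≠ n) :
    (Cochain.join c.support v : Cochain 𝓕 p') d r = 0 := by
  classical
  rw [Cochain.join, joinEval]
  split_ifs with hB
  · rw [Cochain.evalAt]
    split_ifs with H
    · rw [hv, map_zero, smul_zero]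
      have hd : Disjoint c.support d.1.support := Finset.disjoint_left.2 fun z hz hz' =>
        lt_irrefl _ (hB z hz z hz')
      rw [FChain.dim, FChain.dim] at h
      rw [FChain.dim, Finset.card_union_of_disjoint hd]
      push_cast
      omega
    · exact smul_zero _
  · rfl

omit [Finite P] in
lemma Cochain.join_zero {p p' : WithBot P} (s : Finset P) :
    (Cochain.join s (0 : Cochain 𝓕 p) : Cochain 𝓕 p') = 0 := by
  ext c q
  rw [Cochain.join, joinEval]
  split_ifs
  · rw [Cochain.evalAt_zero, smul_zero]
    rfl
  · rfl

omit [Finite P] in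
lemma Cochain.join_add {p p' : WithBot P} (s : Finset P) (v w : Cochain 𝓕 p) :
    (Cochain.join s (v + w) : Cochain 𝓕 p') = Cochain.join s v + Cochain.join s w := by
  ext c q
  rw [Pi.add_apply, Pi.add_apply, Cochain.join, Cochain.join, Cochain.join, ← Cochain.joinEval_add]
  congr 1
  ext t
  exact Cochain.evalAt_add v w q _ t

variable (𝓕)

/-- The morphism to the resolution corresponding to a morphism to cochains. -/
noncomputable def toResolution {A : Type*} [AddCommGroup A] {q : ℤ} {y : P}
    (φ : A →+ Cochain 𝓕 (y : WithBot P)) (hφ : ∀ x c r, c.1.dim + r ≠ q → φ x c r = 0) :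
    A →+ ((resolution.obj 𝓕).obj y).X q :=
  ofCochHom φ hφ

open Classical in
/-- The components of the homotopy between the two coaugmentations. -/
noncomputable def joinEntry (n m : ℤ) (h : m + 1 = n) (c : FChain P) (q : ℤ) :
    (cochainComplex 𝓕 ⊥).X n →+ ((resolution.obj 𝓕).obj c.last).X q :=
  if hq : c.dim + q = m then
    toResolution 𝓕
      { toFun := fun v => Cochain.join c.support (coch v)
        map_zero' := by rw [map_zero, Cochain.join_zero]
        map_add' := fun v w => by rw [map_add, Cochain.join_add] }
      fun v d r hd => join_homogeneous (coch v) (fun _ _ => coch_eq_zero v _ _) c d r (by omega)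
  else 0

variable {𝓕}

lemma biEval_joinEntry {n m : ℤ} (h : m + 1 = n) (c : FChain P) {q : ℤ} (hq : c.dim + q = m)
    (v : (cochainComplex 𝓕 ⊥).X n) (d : {d : FChain P // (c.last : WithBot P) ≤ d.first}) (r : ℤ) :
    biEval d r (joinEntry 𝓕 n m h c q v) =
      (Cochain.join c.support (coch v) : Cochain 𝓕 (c.last : WithBot P)) d r := by
  rw [joinEntry, dif_pos hq]
  rfl

lemma biEval_d_joinEntry {n m : ℤ} (h : m + 1 = n) (c : FChain P) {q q' : ℤ} (hq : c.dim + q = m)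
    (hq' : q + 1 = q')
    (v : (cochainComplex 𝓕 ⊥).X n) (d : {d : FChain P // (c.last : WithBot P) ≤ d.first}) (r : ℤ) :
    biEval d r (((resolution.obj 𝓕).obj c.last).d q q' (joinEntry 𝓕 n m h c q v)) =
      Cochain.D (Cochain.join c.support (coch v) : Cochain 𝓕 (c.last : WithBot P)) d r := by
  rw [joinEntry, dif_pos hq]
  exact congr_fun (congr_fun (coch_d hq' _) d) r

lemma joinEntry_eq_zero {n m : ℤ} (h : m + 1 = n) (c : FChain P) {q : ℤ} (hq : c.dim + q ≠ m)
    (v : (cochainComplex 𝓕 ⊥).X n) : joinEntry 𝓕 n m h c q v = 0 := by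
  rw [joinEntry, dif_neg hq]
  rfl

variable (𝓕) in
/-- The cochains of the homotopy between the two coaugmentations. -/
noncomputable def joinCochain (n m : ℤ) (h : m + 1 = n) :
    (cochainComplex 𝓕 ⊥).X n →+ Cochain (resolution.obj 𝓕) ⊥ where
  toFun v c q := joinEntry 𝓕 n m h c.1 q v
  map_zero' := funext fun c => funext fun q => map_zero (joinEntry 𝓕 n m h c.1 q)
  map_add' v w := funext fun c => funext fun q => map_add (joinEntry 𝓕 n m h c.1 q) v w

/-- If `c` is a point, its empty face is absent on the left, whereas joining with the empty set on
the right gives back `v`. The correction term compensates. -/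
lemma biEval_altSum_joinCochain {n m : ℤ} (h : m + 1 = n) (v : (cochainComplex 𝓕 ⊥).X n)
    (c : FChain P) {q : ℤ} (hq : c.dim + q = n)
    (d : {d : FChain P // (c.last : WithBot P) ≤ d.first}) (r : ℤ) :
    biEval d r (altSum (Cochain.evalAt (joinCochain 𝓕 n m h v) q c.last) c.support) =
      altSum (fun t => (Cochain.join t (coch v) : Cochain 𝓕 (c.last : WithBot P)) d r) c.support -
        if c.dim = 0 then coch v ⟨d.1, bot_le⟩ r else 0 := by
  classical
  rw [map_altSum]
  by_cases hc : c.dim = 0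
  · rw [if_pos hc]
    obtain ⟨x, rfl⟩ := dim_eq_zero_iff.1 hc
    have : (point x).support = {x} := rfl
    rw [this, altSum_singleton, altSum_singleton, Cochain.evalAt_empty, map_zero,
      Cochain.join_empty bot_le, sub_self]
  · rw [if_neg hc, sub_zero]
    refine Finset.sum_congr rfl fun x hx => ?_
    have hsub := Finset.erase_subset x c.support
    have hcard := Finset.card_erase_of_mem hx
    have hpos := c.nonempty.card_pos
    rw [FChain.dim] at hc hq
    have hne : (c.support.erase x).Nonempty := by
      rw [← Finset.card_pos, hcard]
      omega
    obtain ⟨e, he⟩ : ∃ e : FChain P, e.support = c.support.erase x :=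
      ⟨⟨_, hne, c.isTotal.mono hsub⟩, rfl⟩
    rw [← he] at hsub hcard ⊢
    congr 1
    dsimp only
    rw [Cochain.evalAt_support _ _ _ _ bot_le (last_mono hsub), biEval_map (last_mono hsub)]
    refine (biEval_joinEntry h e ?_ v _ r).trans rfl
    rw [FChain.dim, hcard]
    omega

variable (𝓕)

/-- The homotopy between the two coaugmentations of the complex of cochains with values in the
resolution. -/
noncomputable def joinMap (n m : ℤ) (h : m + 1 = n) :
    (cochainComplex 𝓕 ⊥).X n ⟶ (cochainComplex (resolution.obj 𝓕) ⊥).X m :=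
  AddCommGrpCat.ofHom (ofCochHom (joinCochain 𝓕 n m h) fun v c _ hc =>
    joinEntry_eq_zero h c.1 hc v)

lemma coch_joinMap (n m : ℤ) (h : m + 1 = n) (v : (cochainComplex 𝓕 ⊥).X n) :
    coch (joinMap 𝓕 n m h v) = joinCochain 𝓕 n m h v := rfl

/-- At a pair `(c, d)` with `c.last ≤ d.first` this is `Cochain.D_join` with `s = c.support`. The
two boundary cases survive: `d` a point gives the map induced by the resolution, and `c` a point
gives the augmentation of `botCone`. -/
lemma joinMap_comm (m n k : ℤ) (hm : m + 1 = n) (hk : n + 1 = k) (v : (cochainComplex 𝓕 ⊥).X n) :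
    (cochainMap (resolutionUnit.app 𝓕) le_rfl).f n v =
      joinMap 𝓕 k n hk ((cochainComplex 𝓕 ⊥).d n k v) +
        (cochainComplex (resolution.obj 𝓕) ⊥).d m n (joinMap 𝓕 n m hm v) +
        (aug (botCone 𝓕)).f n v := by
  classical
  refine coch_ext fun ⟨c, hc⟩ q hq => resolution_ext fun d r hdr => ?_
  rw [map_add, map_add, Pi.add_apply, Pi.add_apply, Pi.add_apply, Pi.add_apply, map_add, map_add,
    coch_d hm, coch_joinMap, coch_joinMap, Cochain.D, map_add, map_zsmul]
  have h₁ : biEval d r (joinCochain 𝓕 k n hk ((cochainComplex 𝓕 ⊥).d n k v) ⟨c, hc⟩ q) =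
      (Cochain.join c.support (Cochain.D (coch v)) : Cochain 𝓕 (c.last : WithBot P)) d r := by
    refine (biEval_joinEntry hk c hq _ d r).trans ?_
    rw [coch_d hk]
  have h₂ := biEval_d_joinEntry hm c (q := q - 1) (q' := q) (by dsimp only at hq; omega)
    (by omega) v d r
  have h₃ := biEval_altSum_joinCochain hm v c hq d r
  have h₄ := Cochain.D_join (p := ⊥) (p' := (c.last : WithBot P)) c.support (coch v) c.isTotal
    (fun _ _ => bot_le) (fun x hx => WithBot.coe_le_coe.2 (c.le_last hx)) bot_le d r
  have h₅ : biEval d r (coch ((aug (botCone 𝓕)).f n v) ⟨c, hc⟩ q) =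
      if c.dim = 0 then coch v ⟨d.1, bot_le⟩ r else 0 := by
    split_ifs with h0
    · rw [coch_aug_of_dim_eq_zero _ _ _ _ _ h0]
      obtain rfl : q = n := by dsimp only at hq; omega
      rw [homog_same]
      rfl
    · rw [coch_aug_of_dim_ne_zero _ _ _ _ _ h0, map_zero]
  have h₆ : biEval d r (coch ((cochainMap (resolutionUnit.app 𝓕) le_rfl).f n v) ⟨c, hc⟩ q) =
      if d.1.dim = 0 then Cochain.evalAt (coch v) r d.1.last c.support else 0 := by
    have hcd : c.last ≤ d.1.last :=
      (WithBot.coe_le_coe.1 d.2).trans (d.1.first_le d.1.last_mem)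
    rw [coch_map]
    split_ifs with h0
    · refine (coch_aug_of_dim_eq_zero (pointCone 𝓕 c.last) q _ d r h0).trans ?_
      obtain rfl : r = q := by omega
      rw [homog_same, Cochain.evalAt_support _ _ _ _ bot_le hcd]
      rfl
    · exact coch_aug_of_dim_ne_zero (pointCone 𝓕 c.last) q _ d r h0
  have e : ((-1 : ℤ) ^ c.support.card) * (-1) ^ c.support.card = 1 := by rw [← mul_pow]; simp
  rw [h₁, h₅, h₆]
  refine Eq.trans ?_ (congr_arg (fun z => _ + (sgn FChain.dim c • z + _) + _) h₂.symm)
  refine Eq.trans ?_ (congr_arg (fun z => _ + (_ + z) + _) h₃.symm)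
  -- The column sign of `c` times `(-1) ^ c.support.card` is `-1`, so the face sums from the two
  -- differentials cancel.
  rw [h₄, sgn_dim, smul_smul, neg_mul, e]
  abel

/-- The two coaugmentations of the complex of cochains with values in the resolution are
homotopic. -/
noncomputable def joinHomotopy :
    Homotopy (cochainMap (resolutionUnit.app 𝓕) (le_refl (⊥ : WithBot P))) (aug (botCone 𝓕)) where
  hom n m := if h : m + 1 = n then joinMap 𝓕 n m h else 0
  zero n m h := dif_neg h
  comm n := by
    rw [dNext_eq _ (show (ComplexShape.up ℤ).Rel n (n + 1) from rfl),
      prevD_eq _ (show (ComplexShape.up ℤ).Rel (n - 1) n from by simp), dif_pos rfl,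
      dif_pos (by omega)]
    ext v
    exact joinMap_comm 𝓕 (n - 1) n (n + 1) (by omega) rfl v

end Resolution

end FiniteSpace

namespace FiniteSpace

/-! ### A formal criterion for right derived functors. -/

section RightDerived

variable {C D H : Type*} [Category* C] [Category* D] [Category* H]

lemma isLeftKanExtension_of_existsUnique {L : C ⥤ D} {F : C ⥤ H} {RF : D ⥤ H} (α : F ⟶ L ⋙ RF)
    (h : ∀ (G : D ⥤ H) (β : F ⟶ L ⋙ G), ∃! γ : RF ⟶ G, α ≫ Functor.whiskerLeft L γ = β) :
    RF.IsLeftKanExtension α := by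
  choose γ hγ hγ' using h
  refine ⟨⟨IsInitial.ofUniqueHom
    (fun Y => StructuredArrow.homMk (γ Y.right Y.hom) (hγ Y.right Y.hom)) fun Y m => ?_⟩⟩
  ext1
  exact hγ' _ _ _ (StructuredArrow.w m)

/-- A criterion for a functor to be a right derived functor: `T` inverts the morphisms of `W` and
is, up to the resolution `R`, a retract of `F`. -/
lemma isRightDerivedFunctor_of_resolution {L : C ⥤ D} (W : MorphismProperty C)
    [L.IsLocalization W] {F T : C ⥤ H} (RF : D ⥤ H) (e : T ≅ L ⋙ RF) (a : F ⟶ T) {R : C ⥤ C}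
    (j : 𝟭 C ⟶ R) (hj : ∀ X, W (j.app X)) (r : T ⟶ R ⋙ F)
    (har : ∀ X, a.app X ≫ r.app X = F.map (j.app X))
    (hra : ∀ X, r.app X ≫ a.app (R.obj X) = T.map (j.app X)) :
    RF.IsRightDerivedFunctor (a ≫ e.hom) W := by
  have hL : ∀ X, IsIso (L.map (j.app X)) := fun X => Localization.inverts L W _ (hj X)
  rw [Functor.isRightDerivedFunctor_iff_isLeftKanExtension]
  refine isLeftKanExtension_of_existsUnique _ fun G β => ?_
  -- A transformation out of `F` is extended to `T` by passing to the resolution through `r`,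
  -- applying `β` there, and inverting the image of `j`.
  let γ' : L ⋙ RF ⟶ L ⋙ G :=
    { app := fun X => e.inv.app X ≫ r.app X ≫ β.app (R.obj X) ≫ inv (G.map (L.map (j.app X)))
      naturality := fun X Y f => by
        have h₁ := j.naturality f
        have h₂ := r.naturality f
        have h₃ := e.inv.naturality f
        have h₄ := β.naturality (R.map f)
        dsimp at h₁ h₂ h₃ h₄ ⊢
        rw [reassoc_of% h₃, reassoc_of% h₂, reassoc_of% h₄]
        simp only [Category.assoc]
        congr 3
        rw [IsIso.eq_inv_comp, ← Category.assoc, IsIso.comp_inv_eq, ← G.map_comp, ← G.map_comp,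
          ← L.map_comp, ← L.map_comp, h₁] }
  refine ⟨Localization.liftNatTrans L W (L ⋙ RF) (L ⋙ G) RF G γ', ?_, fun γ hγ => ?_⟩
  · ext X
    have h' := β.naturality (j.app X)
    have h := har X
    dsimp at h' h ⊢
    rw [Localization.liftNatTrans_app]
    dsimp [γ', Localization.Lifting.iso, Localization.Lifting.id]
    simp only [Category.assoc, Category.comp_id, Category.id_comp, Iso.hom_inv_id_app_assoc]
    rw [reassoc_of% h, reassoc_of% h', IsIso.hom_inv_id, Category.comp_id]
  -- Naturality along `j`, where `T.map j` factors as `r` followed by `a`, shows that `γ` is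
  -- determined by `β` on resolved objects.
  · refine Localization.natTrans_ext L W fun X => ?_
    have h₁ := NatTrans.congr_app hγ (R.obj X)
    have h₂ := γ.naturality (L.map (j.app X))
    have h₃ := e.hom.naturality (j.app X)
    have h₄ := hra X
    dsimp at h₁ h₂ h₃ h₄ ⊢
    rw [Localization.liftNatTrans_app]
    dsimp [γ', Localization.Lifting.iso, Localization.Lifting.id]
    simp only [Category.comp_id, Category.id_comp]
    rw [← Category.assoc, ← Category.assoc, IsIso.eq_comp_inv, ← h₂, ← cancel_epi (e.hom.app X),
      ← reassoc_of% h₃, ← h₄, Category.assoc, Category.assoc, Iso.hom_inv_id_app_assoc, ← h₁]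
    simp only [Category.assoc]

end RightDerived

/-! ### Complexes of functors versus functors to complexes. -/

section Flip

variable {T : Type*} [Category* T] {V : Type*} [Category* V] [HasZeroMorphisms V]
  {ι : Type*} {c : ComplexShape ι}

/-- A functor to complexes gives a complex of functors. -/
@[simps]
def asComplex (F : T ⥤ HomologicalComplex V c) : HomologicalComplex (T ⥤ V) c where
  X i := F ⋙ HomologicalComplex.eval V c i
  d i j :=
    { app := fun t => (F.obj t).d i j
      naturality := fun _ _ f => (F.map f).comm i j }
  shape i j h := by
    ext t
    exact (F.obj t).shape i j h
  d_comp_d' i j k _ _ := by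
    ext t
    exact (F.obj t).d_comp_d i j k

variable (T V c) in
/-- The functor sending a functor to complexes to a complex of functors. -/
@[simps]
def functorToComplexOfFunctors : (T ⥤ HomologicalComplex V c) ⥤ HomologicalComplex (T ⥤ V) c where
  obj := asComplex
  map τ :=
    { f := fun i => Functor.whiskerRight τ (HomologicalComplex.eval V c i)
      comm' := fun i j _ => by
        ext t
        exact (τ.app t).comm i j }

variable (T V c) in
/-- The equivalence between complexes of functors and functors to complexes. -/
def functorComplexEquivalence : HomologicalComplex (T ⥤ V) c ≌ (T ⥤ HomologicalComplex V c) where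
  functor := HomologicalComplex.complexOfFunctorsToFunctorToComplex
  inverse := functorToComplexOfFunctors T V c
  unitIso := Iso.refl _
  counitIso := Iso.refl _
  functor_unitIso_comp _ := Category.comp_id _

end Flip

section QuasiIso

variable {T : Type*} [Category* T] {V : Type*} [Category* V] [Abelian V] {ι : Type*}
  {c : ComplexShape ι}

lemma quasiIso_iff_app {K L : HomologicalComplex (T ⥤ V) c} (f : K ⟶ L) :
    QuasiIso f ↔ ∀ t, QuasiIso
      ((HomologicalComplex.complexOfFunctorsToFunctorToComplex.map f).app t) :=
  HomologicalComplex.quasiIso_iff_evaluation f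

end QuasiIso

end FiniteSpace

namespace FiniteSpace

/-! ### Cochains compute derived global sections. -/

section DerivedSections

variable (X : Type u) [TopologicalSpace X] [Finite X] [T0Space X]

/-- Complexes of abelian data on a `T₀` space, as functors to complexes. -/
noncomputable abbrev toDiagram :
    CochainComplex (AbData X) ℤ ⥤ (Specialization X ⥤ CochainComplex AddCommGrpCat.{u} ℤ) :=
  HomologicalComplex.complexOfFunctorsToFunctorToComplex

/-- Functors to complexes, as complexes of abelian data on a `T₀` space. -/
noncomputable abbrev ofDiagram :
    (Specialization X ⥤ CochainComplex AddCommGrpCat.{u} ℤ) ⥤ CochainComplex (AbData X) ℤ :=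
  functorToComplexOfFunctors _ _ _

/-- The complexes of global sections. -/
noncomputable abbrev sectionsComplex :
    CochainComplex (AbData X) ℤ ⥤ CochainComplex AddCommGrpCat.{u} ℤ :=
  (sections X).mapHomologicalComplex (ComplexShape.up ℤ)

/-- The resolution of a complex of abelian data. -/
noncomputable def resolutionComplex : CochainComplex (AbData X) ℤ ⥤ CochainComplex (AbData X) ℤ :=
  toDiagram X ⋙ resolution ⋙ ofDiagram X

/-- The augmentation of the resolution of a complex of abelian data. -/
noncomputable def resolutionComplexUnit : 𝟭 _ ⟶ resolutionComplex X :=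
  Functor.whiskerLeft (toDiagram X) (Functor.whiskerRight resolutionUnit (ofDiagram X))

lemma quasiIso_resolutionComplexUnit (K : CochainComplex (AbData X) ℤ) :
    QuasiIso ((resolutionComplexUnit X).app K) := by
  rw [quasiIso_iff_app]
  intro t
  exact inferInstanceAs (QuasiIso ((resolutionUnit.app ((toDiagram X).obj K)).app t))

/-- The complex of all cochains. -/
noncomputable def sectionsCochain :
    CochainComplex (AbData X) ℤ ⥤ CochainComplex AddCommGrpCat.{u} ℤ :=
  toDiagram X ⋙ cochainFunctor ⊥

variable {X} in
/-- The cone consisting of the global sections. -/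
noncomputable def sectionsCone (K : CochainComplex (AbData X) ℤ) :
    ConeAbove ((toDiagram X).obj K) ⊥ ((sectionsComplex X).obj K) where
  π y _ :=
    { f := fun n => limit.π (K.X n) y
      comm' := fun i j _ => (limMap_π (K.d i j) y).symm }
  w y y' h _ := by
    ext n : 1
    exact limit.w (K.X n) (homOfLE h)

/-- The coaugmentation of the complex of cochains by the global sections. -/
noncomputable def sectionsAug : sectionsComplex X ⟶ sectionsCochain X where
  app K := aug (sectionsCone K)
  naturality K L φ := by
    have e : (sectionsCone L).precomp ((sectionsComplex X).map φ) =
        (sectionsCone K).postcomp ((toDiagram X).map φ) le_rfl := by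
      ext y hy n : 4
      exact limMap_π (φ.f n) y
    exact (aug_precomp _ _).symm.trans ((congr_arg aug e).trans (aug_postcomp _ _ _))

variable {X} in
/-- The morphism from the cochains to the global sections of the resolution, in each degree. -/
noncomputable def cochainLift (K : CochainComplex (AbData X) ℤ) (n : ℤ) :
    ((sectionsCochain X).obj K).X n ⟶ ((sectionsComplex X).obj ((resolutionComplex X).obj K)).X n :=
  limit.lift (((resolutionComplex X).obj K).X n)
    { pt := ((sectionsCochain X).obj K).X n
      π :=
        { app := fun _ => (cochainMap (𝟙 ((toDiagram X).obj K)) bot_le).f n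
          naturality := fun y y' f => (Category.id_comp _).trans
            (HomologicalComplex.congr_hom
              ((botCone ((toDiagram X).obj K)).w y y' (leOfHom f) bot_le) n).symm } }

variable {X} in
lemma cochainLift_π (K : CochainComplex (AbData X) ℤ) (n : ℤ) (y : Specialization X) :
    cochainLift K n ≫ limit.π (((resolutionComplex X).obj K).X n) y =
      (cochainMap (𝟙 ((toDiagram X).obj K)) bot_le).f n := limit.lift_π _ _

/-- The morphism from the cochains to the global sections of the resolution. -/
noncomputable def cochainToSections :
    sectionsCochain X ⟶ resolutionComplex X ⋙ sectionsComplex X where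
  app K :=
    { f := cochainLift K
      comm' := fun i j _ => by
        refine limit.hom_ext fun y => ?_
        refine (Category.assoc _ _ _).trans ((congr_arg _ (limMap_π _ y)).trans ?_)
        refine (Category.assoc _ _ _).symm.trans
          ((congr_arg (fun z => z ≫ _) (cochainLift_π K i y)).trans ?_)
        refine Eq.trans ?_ (Category.assoc _ _ _).symm
        refine Eq.trans ?_ (congr_arg _ (cochainLift_π K j y)).symm
        exact (cochainMap (𝟙 ((toDiagram X).obj K)) bot_le).comm i j }
  naturality K L φ := by
    ext n : 1
    refine limit.hom_ext fun y => ?_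
    refine (Category.assoc _ _ _).trans ((congr_arg _ (cochainLift_π L n y)).trans ?_)
    refine Eq.trans ?_ (Category.assoc _ _ _).symm
    refine Eq.trans ?_ (congr_arg _ (limMap_π _ y)).symm
    refine Eq.trans ?_ (Category.assoc _ _ _)
    refine Eq.trans ?_ (congr_arg (fun z => z ≫ _) (cochainLift_π K n y)).symm
    refine (HomologicalComplex.congr_hom (cochainMap_comp _ _ _ _) n).trans ?_
    refine Eq.trans ?_ (HomologicalComplex.congr_hom (cochainMap_comp _ _ _ _) n).symm
    rw [Category.comp_id, Category.id_comp]

/-- After projection to a point `y`, both sides are augmentations of the same cone: restricting a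
section to the points above `y` factors through its value at `y`. -/
lemma sectionsAug_cochainToSections (K : CochainComplex (AbData X) ℤ) :
    (sectionsAug X).app K ≫ (cochainToSections X).app K =
      (sectionsComplex X).map ((resolutionComplexUnit X).app K) := by
  ext n : 1
  refine limit.hom_ext fun y => ?_
  refine (Category.assoc _ _ _).trans ((congr_arg _ (cochainLift_π K n y)).trans ?_)
  refine Eq.trans ?_ (limMap_π _ y).symm
  have e : (sectionsCone K).postcomp (𝟙 _) bot_le =
      (pointCone ((toDiagram X).obj K) y).precomp ((sectionsCone K).π y bot_le) := by
    ext z hz m : 4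
    refine (Category.comp_id _).trans ?_
    exact (limit.w (K.X m) (homOfLE (WithBot.coe_le_coe.1 hz))).symm
  refine (HomologicalComplex.congr_hom
    (aug_postcomp (sectionsCone K) (𝟙 _) bot_le) n).symm.trans ?_
  rw [e]
  exact HomologicalComplex.congr_hom (aug_precomp _ _) n

/-- The projections of the map into the limit are the restrictions of cochains, which form
`botCone`. -/
lemma cochainToSections_sectionsAug (K : CochainComplex (AbData X) ℤ) :
    (cochainToSections X).app K ≫ (sectionsAug X).app ((resolutionComplex X).obj K) =
      aug (botCone ((toDiagram X).obj K)) := by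
  have e : (sectionsCone ((resolutionComplex X).obj K)).precomp ((cochainToSections X).app K) =
      botCone ((toDiagram X).obj K) := by
    ext y hy n : 4
    exact cochainLift_π K n y
  exact (aug_precomp _ _).symm.trans (congr_arg aug e)

lemma quasiIso_sectionsCochain_map {K L : CochainComplex (AbData X) ℤ} (f : K ⟶ L) [QuasiIso f] :
    QuasiIso ((sectionsCochain X).map f) := by
  have := (quasiIso_iff_app f).1 inferInstance
  exact quasiIso_cochainMap ((toDiagram X).map f)

variable [HasDerivedCategory.{w₂} AddCommGrpCat.{u}]

lemma isInvertedBy_sectionsCochain :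
    (HomologicalComplex.quasiIso (AbData X) (ComplexShape.up ℤ)).IsInvertedBy
      (sectionsCochain X ⋙ DerivedCategory.Q) := by
  intro K L f hf
  have : QuasiIso f := hf
  have := quasiIso_sectionsCochain_map X f
  exact inferInstanceAs (IsIso (DerivedCategory.Q.map ((sectionsCochain X).map f)))

variable [HasDerivedCategory.{w₁} (AbData X)]

/-- The derived functor of the functor of global sections, computed by cochains. -/
noncomputable def derivedSections :
    DerivedCategory (AbData X) ⥤ DerivedCategory AddCommGrpCat.{u} :=
  Localization.lift (sectionsCochain X ⋙ DerivedCategory.Q) (isInvertedBy_sectionsCochain X)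
    DerivedCategory.Q

noncomputable instance :
    CatCommSq (sectionsCochain X) DerivedCategory.Q DerivedCategory.Q (derivedSections X) where
  iso := (Localization.fac _ (isInvertedBy_sectionsCochain X) DerivedCategory.Q).symm

/-- The natural transformation exhibiting `derivedSections` as a derived functor. -/
noncomputable def derivedSectionsUnit : sectionsQ X ⟶ DerivedCategory.Q ⋙ derivedSections X :=
  Functor.whiskerRight (sectionsAug X) DerivedCategory.Q ≫
    (CatCommSq.iso (sectionsCochain X) DerivedCategory.Q DerivedCategory.Q
      (derivedSections X)).hom

/-- The first identity of the criterion holds for complexes; the second holds up to `joinHomotopy`,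
which suffices since the functors compared take values in the derived category. -/
lemma isRightDerivedFunctor_derivedSections :
    (derivedSections X).IsRightDerivedFunctor (derivedSectionsUnit X)
      (HomologicalComplex.quasiIso (AbData X) (ComplexShape.up ℤ)) := by
  refine isRightDerivedFunctor_of_resolution _ _ _ _ (resolutionComplexUnit X)
    (quasiIso_resolutionComplexUnit X)
    (Functor.whiskerRight (cochainToSections X) DerivedCategory.Q) (fun K => ?_) (fun K => ?_)
  · exact (DerivedCategory.Q.map_comp _ _).symm.trans
      (congr_arg _ (sectionsAug_cochainToSections X K))
  · refine (DerivedCategory.Q.map_comp _ _).symm.trans ?_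
    refine (congr_arg _ (cochainToSections_sectionsAug X K)).trans ?_
    exact (DerivedCategory.Q_map_eq_of_homotopy _ (joinHomotopy ((toDiagram X).obj K))).symm

end DerivedSections

end FiniteSpace

namespace FiniteSpace

/-! ### The explicit right adjoint of the cochain functor. -/

section Dual

variable {P : Type u} [PartialOrder P] [Finite P]
  (G G' : CochainComplex AddCommGrpCat.{u} ℤ) (p p' : P)

open FChain TwistedComplex

/-- The opposite of the dimension of a chain. -/
def FChain.codim (c : FChain P) : ℤ := -c.dim

omit [Finite P] in
lemma sgn_codim (c : FChain P) :
    TwistedComplex.sgn FChain.codim c = TwistedComplex.sgn FChain.dim c := by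
  rw [TwistedComplex.sgn, TwistedComplex.sgn, FChain.codim, Int.negOnePow_neg]

omit [Finite P] in
lemma sgn_mul_sgn (c : FChain P) :
    TwistedComplex.sgn FChain.dim c * TwistedComplex.sgn FChain.dim c = 1 := by
  rw [sgn_dim, neg_mul_neg, ← mul_pow]
  simp

/-- The signed incidence number for the dual differential. -/
noncomputable def dualIncidence (c c' : FChain P) : ℤ :=
  -(TwistedComplex.sgn FChain.dim c * incidence c c')

omit [Finite P] in
lemma dualIncidence_eq_zero {c c' : FChain P}
    (h : ¬ (c.support ⊆ c'.support ∧ c'.dim = c.dim + 1)) : dualIncidence c c' = 0 := by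
  rw [dualIncidence, incidence_eq_zero h, mul_zero, neg_zero]

/-- In a nonzero product the dimensions of `r` and `t` are consecutive, so the two signs multiply to
`-1` and the claim reduces to `sum_incidence_mul_incidence`. -/
lemma sum_dualIncidence_mul (r s : FChain P) :
    ∑ t : FChain P, dualIncidence t s * dualIncidence r t = 0 := by
  have : ∀ t : FChain P, dualIncidence t s * dualIncidence r t =
      -(incidence r t * incidence t s) := by
    intro t
    by_cases h : t.dim = r.dim + 1
    · have e : TwistedComplex.sgn FChain.dim t * TwistedComplex.sgn FChain.dim r = -1 := by
        have : TwistedComplex.sgn FChain.dim t = -TwistedComplex.sgn FChain.dim r := by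
          simp [TwistedComplex.sgn, h, Int.negOnePow_succ]
        rw [this, neg_mul, sgn_mul_sgn]
      rw [dualIncidence, dualIncidence]
      linear_combination incidence r t * incidence t s * e
    · rw [dualIncidence_eq_zero fun H => h H.2, incidence_eq_zero fun H => h H.2]
      simp
  rw [Finset.sum_congr rfl fun t _ => this t, Finset.sum_neg_distrib,
    sum_incidence_mul_incidence, neg_zero]

/-- The morphism from a chain to a face. -/
noncomputable def cofaceMap {c c' : FChain P} (h : c.support ⊆ c'.support) :
    cpow (p ≤ c'.last) G ⟶ cpow (p ≤ c.last) G :=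
  cpowMap (fun hp => hp.trans (last_mono h)) (𝟙 G)

open scoped Classical in
/-- The twisted complex whose total complex is the value at `p` of the right adjoint of the
functor of cochains. -/
noncomputable def dualTwisted : TwistedComplex (FChain.codim : FChain P → ℤ) where
  obj c := cpow (p ≤ c.last) G
  δ c' c := dualIncidence c c' • (if h : c.support ⊆ c'.support then cofaceMap G p h else 0)
  δ_eq_zero c' c h := by
    rw [dualIncidence_eq_zero, zero_smul]
    rintro ⟨_, h'⟩
    rw [FChain.codim, FChain.codim] at h
    omega
  δ_comp_δ c'' c := by
    by_cases hc : c.support ⊆ c''.support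
    · have : ∀ c',
          (dualIncidence c' c'' • (if h : c'.support ⊆ c''.support then cofaceMap G p h else 0)) ≫
          (dualIncidence c c' • (if h : c.support ⊆ c'.support then cofaceMap G p h else 0)) =
          (dualIncidence c' c'' * dualIncidence c c') • cofaceMap G p hc := by
        intro c'
        by_cases h : c.support ⊆ c'.support
        · by_cases h' : c'.support ⊆ c''.support
          · rw [dif_pos h, dif_pos h', Preadditive.zsmul_comp, Preadditive.comp_zsmul, smul_smul]
            rfl
          · rw [dualIncidence_eq_zero (c := c') (fun H => h' H.1), zero_mul, zero_smul, zero_smul,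
              zero_comp]
        · rw [dualIncidence_eq_zero (c := c) (fun H => h H.1), mul_zero, zero_smul, zero_smul,
              comp_zero]
      rw [Finset.sum_congr rfl fun c' _ => this c', ← Finset.sum_smul,
        sum_dualIncidence_mul, zero_smul]
    · refine Finset.sum_eq_zero fun c' _ => ?_
      by_cases h : c.support ⊆ c'.support
      · rw [dif_neg fun H => hc (h.trans H), smul_zero, zero_comp]
      · rw [dif_neg h, smul_zero, comp_zero]

variable {G G' p p'} in
/-- The functoriality of `dualTwisted`. -/
noncomputable def dualTwistedMap (φ : G ⟶ G') (h : p ≤ p') :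
    dualTwisted G p ⟶ dualTwisted G' p' where
  app c := cpowMap h.trans φ
  comm c c' := by
    dsimp only [dualTwisted]
    rw [Preadditive.zsmul_comp, Preadditive.comp_zsmul]
    split_ifs with hc
    · rw [cofaceMap, cofaceMap, cpowMap_comp, cpowMap_comp, Category.id_comp, Category.comp_id]
    · rw [zero_comp, comp_zero]

/-- The right adjoint of the functor of cochains. -/
noncomputable def dualFunctor :
    CochainComplex AddCommGrpCat.{u} ℤ ⥤ (P ⥤ CochainComplex AddCommGrpCat.{u} ℤ) where
  obj G :=
    { obj := fun p => (dualTwisted G p).total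
      map := fun f => totalMap (dualTwistedMap (𝟙 G) (leOfHom f))
      map_id := fun p => (totalFunctor _).map_id (dualTwisted G p)
      map_comp := fun f g => (totalFunctor _).map_comp (dualTwistedMap (𝟙 G) (leOfHom f))
        (dualTwistedMap (𝟙 G) (leOfHom g)) }
  map φ :=
    { app := fun p => totalMap (dualTwistedMap φ le_rfl)
      naturality := fun p q f => by
        refine ((totalFunctor _).map_comp (dualTwistedMap (𝟙 _) (leOfHom f))
          (dualTwistedMap φ le_rfl)).symm.trans ?_
        exact (totalFunctor _).map_comp (dualTwistedMap φ le_rfl)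
          (dualTwistedMap (𝟙 _) (leOfHom f)) }
  map_id G := by
    ext p : 2
    exact (totalFunctor _).map_id (dualTwisted G p)
  map_comp φ ψ := by
    ext p : 2
    exact (totalFunctor _).map_comp (dualTwistedMap φ (le_refl p)) (dualTwistedMap ψ le_rfl)

variable {G G' p p'}

/-- At `p` every column is `φ` or zero, and there are finitely many columns. -/
lemma quasiIso_dualFunctor_map (φ : G ⟶ G') [QuasiIso φ] (p : P) :
    QuasiIso ((dualFunctor.map φ).app p) := by
  have : ∀ c, QuasiIso ((dualTwistedMap φ (le_refl p)).app c) := fun c =>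
    quasiIso_cpowMap (le_refl p).trans φ
  exact quasiIso_totalMap (dualTwistedMap φ (le_refl p))

open scoped Classical in
/-- The evaluation of the elements of `cpow Q K`, extended by zero. -/
noncomputable def cpowEvalZero (Q : Prop) (K : CochainComplex AddCommGrpCat.{u} ℤ) (n : ℤ) :
    (cpow Q K).X n →+ K.X n :=
  if h : Q then cpowEval h K n else 0

omit [Finite P] in
lemma cpowEvalZero_of_pos {Q : Prop} (h : Q) {n : ℤ} (x : (cpow Q G).X n) :
    cpowEvalZero Q G n x = cpowEval h G n x := by
  rw [cpowEvalZero, dif_pos h]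

omit [Finite P] in
lemma cpowEvalZero_of_neg {Q : Prop} (h : ¬ Q) {n : ℤ} (x : (cpow Q G).X n) :
    cpowEvalZero Q G n x = 0 := by
  rw [cpowEvalZero, dif_neg h, AddMonoidHom.zero_apply]

omit [Finite P] in
lemma cpowEvalZero_cofaceMap {c c' : FChain P} (h : c.support ⊆ c'.support) (hc : p ≤ c.last)
    (q : ℤ) (x : (cpow (p ≤ c'.last) G).X q) :
    cpowEvalZero (p ≤ c.last) G q ((cofaceMap G p h).f q x) =
      cpowEvalZero (p ≤ c'.last) G q x := by
  rw [cpowEvalZero_of_pos hc, cpowEvalZero_of_pos (hc.trans (last_mono h)), cofaceMap]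
  rfl

/-- The value of an element of a column of `dualTwisted G p`. -/
noncomputable def dualColEval (c : FChain P) (q : ℤ) : ((dualTwisted G p).obj c).X q →+ G.X q :=
  cpowEvalZero (p ≤ c.last) G q

lemma dualColEval_of_le {c : FChain P} (h : p ≤ c.last) (q : ℤ)
    (x : ((dualTwisted G p).obj c).X q) : dualColEval c q x = cpowEval h G q x :=
  cpowEvalZero_of_pos h x

lemma dualColEval_of_not_le {c : FChain P} (h : ¬ p ≤ c.last) (q : ℤ)
    (x : ((dualTwisted G p).obj c).X q) : dualColEval c q x = 0 :=
  cpowEvalZero_of_neg h x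

lemma dualColEval_d (c : FChain P) (q q' : ℤ) (x : ((dualTwisted G p).obj c).X q) :
    dualColEval c q' (((dualTwisted G p).obj c).d q q' x) = G.d q q' (dualColEval c q x) := by
  by_cases h : p ≤ c.last
  · rw [dualColEval_of_le h, dualColEval_of_le h]
    rfl
  · rw [dualColEval_of_not_le h, dualColEval_of_not_le h, map_zero]

/-- The condition on `c` is essential: if `c` does not end above `p`, the left side is zero, while a
larger chain `c'` may still end above `p`. -/
lemma dualColEval_δ {c : FChain P} (hc : p ≤ c.last) (c' : FChain P) (q : ℤ)
    (x : ((dualTwisted G p).obj c').X q) :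
    dualColEval c q (((dualTwisted G p).δ c' c).f q x) =
      dualIncidence c c' • dualColEval c' q x := by
  dsimp only [dualTwisted]
  by_cases h : c.support ⊆ c'.support
  · rw [dif_pos h]
    refine (map_zsmul (dualColEval c q)
      (dualIncidence c c') ((cofaceMap G p h).f q x : ((dualTwisted G p).obj c).X q)).trans
      (congr_arg _ ?_)
    exact cpowEvalZero_cofaceMap h hc q x
  · rw [dif_neg h, dualIncidence_eq_zero fun H => h H.1, zero_smul, zero_smul]
    exact map_zero (dualColEval c q)

variable (G) in
/-- Families of elements indexed by chains. -/
abbrev DualFamily (P : Type u) [PartialOrder P] : Type u := FChain P → ∀ q, G.X q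

/-- The values of an element of the value at `p` of the right adjoint. -/
noncomputable def dcoch {n : ℤ} : ((dualFunctor.obj G).obj p).X n →+ DualFamily G P where
  toFun v c q := dualColEval c q (fam (M := dualTwisted G p) v c q)
  map_zero' := funext fun c => funext fun q => map_zero (dualColEval (p := p) c q)
  map_add' _ _ := funext fun c => funext fun q => map_add (dualColEval (p := p) c q) _ _

lemma dcoch_ext {n : ℤ} {v w : ((dualFunctor.obj G).obj p).X n}
    (h : ∀ c q, p ≤ c.last → c.codim + q = n → dcoch v c q = dcoch w c q) : v = w :=
  total_ext (M := dualTwisted G p) fun c q hq => cpow_ext fun hc => by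
    have := h c q hc hq
    exact (dualColEval_of_le hc q _).symm.trans (this.trans (dualColEval_of_le hc q _))

lemma dcoch_d {n m : ℤ} (hnm : n + 1 = m) (v : ((dualFunctor.obj G).obj p).X n) {c : FChain P}
    (hc : p ≤ c.last) {q q' : ℤ} (hq : q + 1 = q') :
    dcoch (((dualFunctor.obj G).obj p).d n m v) c q' =
      TwistedComplex.sgn FChain.dim c • G.d q q' (dcoch v c q) +
        ∑ c', dualIncidence c c' • dcoch v c' q' := by
  obtain rfl : q = q' - 1 := by omega
  refine (congr_arg (fun w => dualColEval c q' (w c q'))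
    (fam_d (M := dualTwisted G p) hnm v)).trans ?_
  dsimp only
  rw [D_apply, map_add, map_zsmul, map_sum, sgn_codim]
  congr 1
  · exact congr_arg _ (dualColEval_d c _ _ _)
  · exact Finset.sum_congr rfl fun c' _ => dualColEval_δ hc c' q' _

lemma dcoch_map {n : ℤ} (f : p ⟶ p') (v : ((dualFunctor.obj G).obj p).X n) {c : FChain P}
    (hc : p' ≤ c.last) (q : ℤ) :
    dcoch (((dualFunctor.obj G).map f).f n v) c q = dcoch v c q :=
  (dualColEval_of_le hc q _).trans (dualColEval_of_le ((leOfHom f).trans hc) q _).symm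

lemma dcoch_functor_map {n : ℤ} (φ : G ⟶ G') (v : ((dualFunctor.obj G).obj p).X n) {c : FChain P}
    (hc : p ≤ c.last) (q : ℤ) :
    dcoch (((dualFunctor.map φ).app p).f n v) c q = φ.f q (dcoch v c q) :=
  (dualColEval_of_le hc q _).trans (congr_arg (φ.f q) (dualColEval_of_le hc q _).symm)

variable (p) in
/-- The morphism to the value at `p` of the right adjoint given by a morphism to families. -/
noncomputable def ofDcochHom {A : Type*} [AddCommGroup A] {n : ℤ} (φ : A →+ DualFamily G P)
    (hφ : ∀ x c q, c.codim + q ≠ n → φ x c q = 0) : A →+ ((dualFunctor.obj G).obj p).X n where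
  toFun x := ofFam (M := dualTwisted G p) (fun c q _ => φ x c q)
    fun c q h => funext fun _ => hφ x c q h
  map_zero' := total_ext (M := dualTwisted G p) fun c q _ => funext fun _ =>
    congr_fun (congr_fun (map_zero φ) c) q
  map_add' x y := total_ext (M := dualTwisted G p) fun c q _ => funext fun _ =>
    congr_fun (congr_fun (map_add φ x y) c) q

lemma dcoch_ofDcochHom {A : Type*} [AddCommGroup A] {n : ℤ} (φ : A →+ DualFamily G P)
    (hφ : ∀ x c q, c.codim + q ≠ n → φ x c q = 0) (x : A) {c : FChain P} (hc : p ≤ c.last)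
    (q : ℤ) : dcoch (ofDcochHom p φ hφ x) c q = φ x c q :=
  dualColEval_of_le hc q (fam (M := dualTwisted G p) (ofDcochHom p φ hφ x) c q)

end Dual

end FiniteSpace

namespace FiniteSpace

/-! ### Unit, counit and triangle identities. -/

section Adjunction

variable {P : Type u} [PartialOrder P] [Finite P] {G G' : CochainComplex AddCommGrpCat.{u} ℤ}
  {𝓕 𝓖 : P ⥤ CochainComplex AddCommGrpCat.{u} ℤ} {p p' : P}

open FChain TwistedComplex

/-- The evaluation of cochains with values in the dual of `G`. -/
noncomputable def contract (n : ℤ) : Cochain (dualFunctor.obj G) (⊥ : WithBot P) →+ G.X n where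
  toFun v := ∑ c : FChain P, dcoch (v ⟨c, bot_le⟩ (n - c.dim)) c n
  map_zero' := Finset.sum_eq_zero fun c _ => by
    rw [Pi.zero_apply, Pi.zero_apply, map_zero]
    rfl
  map_add' v w := by
    rw [← Finset.sum_add_distrib]
    refine Finset.sum_congr rfl fun c _ => ?_
    rw [Pi.add_apply, Pi.add_apply, map_add]
    rfl

lemma contract_apply (n : ℤ) (v : Cochain (dualFunctor.obj G) (⊥ : WithBot P)) :
    contract n v = ∑ c : FChain P, dcoch (v ⟨c, bot_le⟩ (n - c.dim)) c n := rfl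

/-- The value of an element of the dual at a chain. -/
noncomputable def dcochEval {n : ℤ} (c : FChain P) (q : ℤ) :
    ((dualFunctor.obj G).obj p).X n →+ G.X q where
  toFun v := dcoch v c q
  map_zero' := by rw [map_zero]; rfl
  map_add' v w := by rw [map_add]; rfl

/-- Faces enter twice: through the cochain differential and through the twisting of the dual. The
sign in `dualIncidence` is chosen so that the two double sums are exchanged by swapping indices and
cancel. -/
lemma contract_D {n m : ℤ} (h : n + 1 = m) (v : Cochain (dualFunctor.obj G) (⊥ : WithBot P)) :
    contract m (Cochain.D v) = G.d n m (contract n v) := by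
  have key : ∀ c : FChain P, dcoch (Cochain.D v ⟨c, bot_le⟩ (m - c.dim)) c m =
      G.d n m (dcoch (v ⟨c, bot_le⟩ (n - c.dim)) c n) +
        (∑ c', incidence c' c • dcoch (v ⟨c', bot_le⟩ (n - c'.dim)) c m -
          ∑ c', incidence c c' • dcoch (v ⟨c, bot_le⟩ (n - c.dim)) c' m) := by
    intro c
    have e : m - c.dim - 1 = n - c.dim := by omega
    have h₁ : dcochEval c m (Cochain.D v ⟨c, bot_le⟩ (m - c.dim)) =
        TwistedComplex.sgn FChain.dim c • dcochEval c m
          (((dualFunctor.obj G).obj c.last).d (m - c.dim - 1) (m - c.dim)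
            (v ⟨c, bot_le⟩ (m - c.dim - 1))) +
        dcochEval c m (altSum (Cochain.evalAt v (m - c.dim) c.last) c.support) := by
      rw [Cochain.D, map_add, map_zsmul]
    have h₂ : dcochEval c m (altSum (Cochain.evalAt v (m - c.dim) c.last) c.support) =
        ∑ c', incidence c' c • dcoch (v ⟨c', bot_le⟩ (n - c'.dim)) c m := by
      rw [← sum_incidence _ (Cochain.evalAt_empty _ _ _), map_sum]
      refine Finset.sum_congr rfl fun c' _ => ?_
      rw [map_zsmul]
      by_cases hc : c'.support ⊆ c.support ∧ c.dim = c'.dim + 1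
      · obtain ⟨hc, hd⟩ := hc
        have : m - c.dim = n - c'.dim := by omega
        rw [Cochain.evalAt_support _ _ _ _ bot_le (last_mono hc), this]
        exact congr_arg _ (dcoch_map _ _ le_rfl _)
      · rw [incidence_eq_zero hc, zero_smul, zero_smul]
    refine h₁.trans ?_
    rw [h₂, e]
    have h₃ := dcoch_d (show n - c.dim + 1 = m - c.dim by omega) (v ⟨c, bot_le⟩ (n - c.dim))
      (le_refl c.last) h
    refine (congr_arg (fun z => _ • z + _) h₃).trans ?_
    rw [smul_add, smul_smul, sgn_mul_sgn, one_smul, add_assoc, Finset.smul_sum]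
    congr 1
    refine (add_comm _ _).trans ((congr_arg (_ + ·) ?_).trans (sub_eq_add_neg _ _).symm)
    rw [← Finset.sum_neg_distrib]
    refine Finset.sum_congr rfl fun c' _ => ?_
    rw [smul_smul, dualIncidence, mul_neg, ← mul_assoc, sgn_mul_sgn, one_mul, neg_smul]
  rw [contract_apply, Finset.sum_congr rfl fun c _ => key c, Finset.sum_add_distrib,
    Finset.sum_sub_distrib, contract_apply, map_sum, Finset.sum_comm, sub_self, add_zero]

variable (G) in
/-- The counit of the adjunction. -/
noncomputable def contractMap : cochainComplex (dualFunctor.obj G) (⊥ : WithBot P) ⟶ G where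
  f n := AddCommGrpCat.ofHom ((contract n).comp coch)
  comm' n m h := by
    refine AddCommGrpCat.hom_ext (AddMonoidHom.ext fun x => ?_)
    exact (contract_D h (coch x)).symm.trans (congr_arg (contract m) (coch_d h x).symm)

/-- The constant function, as an element of a column. -/
noncomputable def colConst (c : FChain P) (n : ℤ) :
    (𝓕.obj c.last).X n →+ ((cochainTwisted 𝓕 ⊥).obj c).X n :=
  Pi.constAddMonoidHom (PLift ((⊥ : WithBot P) ≤ c.first)) ((𝓕.obj c.last).X n)

open scoped Classical in
lemma δ_colConst (c c' : FChain P) (n : ℤ) (x : (𝓕.obj c.last).X n) :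
    ((cochainTwisted 𝓕 ⊥).δ c c').f n (colConst c n x) = incidence c c' • colConst c' n
      (if hc : c.support ⊆ c'.support then (𝓕.map (homOfLE (last_mono hc))).f n x else 0) := by
  dsimp only [cochainTwisted]
  split_ifs with hc
  · rfl
  · rw [incidence_eq_zero (fun H => hc H.1), zero_smul]
    exact (zero_smul ℤ (colConst c' n 0)).symm

/-- The column of the complex of cochains attached to a chain. -/
noncomputable def colHom (c : FChain P) (n q : ℤ) :
    (𝓕.obj c.last).X n →+ (cochainComplex 𝓕 ⊥).X q :=
  if h : c.dim + n = q then (TwistedComplex.ι (cochainTwisted 𝓕 ⊥) c h).comp (colConst c n) else 0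

lemma fam_colHom {c : FChain P} {n q : ℤ} (h : c.dim + n = q) (x : (𝓕.obj c.last).X n) :
    fam (colHom c n q x) = (cochainTwisted 𝓕 ⊥).single c n (colConst c n x) := by
  rw [colHom, dif_pos h]
  rfl

lemma colHom_of_ne {c : FChain P} {n q : ℤ} (h : c.dim + n ≠ q) (x : (𝓕.obj c.last).X n) :
    colHom c n q x = 0 := by
  rw [colHom, dif_neg h, AddMonoidHom.zero_apply]

open scoped Classical in
lemma d_colHom {c : FChain P} {n q q' : ℤ} (hq : q + 1 = q') (h : c.dim + n = q)
    (x : (𝓕.obj c.last).X n) :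
    (cochainComplex 𝓕 ⊥).d q q' (colHom c n q x) =
      TwistedComplex.sgn FChain.dim c • colHom c (n + 1) q' ((𝓕.obj c.last).d n (n + 1) x) +
        ∑ c', incidence c c' • colHom c' n q'
          (if hc : c.support ⊆ c'.support then (𝓕.map (homOfLE (last_mono hc))).f n x else 0) := by
  apply fam_injective
  rw [fam_d hq, fam_colHom h, D_single _ _ _ rfl, map_add, map_zsmul, map_sum,
    fam_colHom (by omega)]
  congr 1
  refine Finset.sum_congr rfl fun c' _ => ?_
  rw [map_zsmul]
  by_cases hc : c'.dim = c.dim + 1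
  · rw [fam_colHom (by omega), ← map_zsmul, δ_colConst]
  · rw [δ_colConst, incidence_eq_zero (fun H => hc H.2), zero_smul, zero_smul, map_zero]

lemma contract_colHom (c : FChain P) {n q : ℤ} (h : c.dim + n = q)
    (x : ((dualFunctor.obj G).obj c.last).X n) :
    contract q (coch (colHom c n q x)) = dcoch x c q := by
  classical
  obtain rfl : n = q - c.dim := by omega
  rw [contract_apply, Finset.sum_eq_single c]
  · refine congr_arg (dcochEval c q) ?_
    refine (congr_arg (fun f => colEval ⟨c, bot_le⟩ (q - c.dim) (f c (q - c.dim)))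
      (fam_colHom h x)).trans ?_
    refine (congr_arg (colEval ⟨c, bot_le⟩ (q - c.dim)) (single_same _ _ _)).trans ?_
    rfl
  · intro c' _ hc
    refine (congr_arg (dcochEval c' q) ?_).trans (map_zero (dcochEval c' q))
    refine (congr_arg (fun f => colEval ⟨c', bot_le⟩ (q - c'.dim) (f c' (q - c'.dim)))
      (fam_colHom h x)).trans ?_
    refine (congr_arg (colEval ⟨c', bot_le⟩ (q - c'.dim)) (single_of_ne hc _ _ _)).trans ?_
    exact map_zero _
  · simp

lemma sum_colHom {n : ℤ} (x : (cochainComplex 𝓕 ⊥).X n) :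
    ∑ c : FChain P, colHom c (n - c.dim) n (coch x ⟨c, bot_le⟩ (n - c.dim)) = x := by
  apply fam_injective
  rw [map_sum, ← sum_single x]
  refine Finset.sum_congr rfl fun c _ => ?_
  rw [fam_colHom (by omega)]
  rfl

lemma colHom_map (τ : 𝓕 ⟶ 𝓖) (c : FChain P) (n q : ℤ) (x : (𝓕.obj c.last).X n) :
    (cochainMap τ le_rfl).f q (colHom c n q x) = colHom c n q ((τ.app c.last).f n x) := by
  by_cases h : c.dim + n = q
  · refine total_ext fun i r hr => ?_
    refine (congr_arg (fun f => ((cochainTwistedMap τ (le_refl ⊥)).app i).f r (f i r))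
      (fam_colHom h x)).trans (Eq.trans ?_ (congr_arg (fun f => f i r) (fam_colHom h _)).symm)
    by_cases hi : i = c
    · subst hi
      obtain rfl : r = n := by omega
      rw [single_same, single_same]
      rfl
    · rw [single_of_ne hi, single_of_ne hi, map_zero]
  · rw [colHom_of_ne h, colHom_of_ne h, map_zero]

open scoped Classical in
/-- The components of the unit of the adjunction. -/
noncomputable def unitFamily (𝓕 : P ⥤ CochainComplex AddCommGrpCat.{u} ℤ) (p : P) (n : ℤ) :
    (𝓕.obj p).X n →+ DualFamily (cochainComplex 𝓕 ⊥) P where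
  toFun x c q := if h : p ≤ c.last then colHom c n q ((𝓕.map (homOfLE h)).f n x) else 0
  map_zero' := by
    ext c q
    simp only [map_zero, dite_eq_ite, ite_self, Pi.zero_apply]
  map_add' x y := by
    ext c q
    by_cases h : p ≤ c.last
    · simp only [dif_pos h, map_add, Pi.add_apply]
    · simp only [dif_neg h, add_zero, Pi.add_apply]

lemma unitFamily_of_le {n : ℤ} (x : (𝓕.obj p).X n) {c : FChain P} (h : p ≤ c.last) (q : ℤ) :
    unitFamily 𝓕 p n x c q = colHom c n q ((𝓕.map (homOfLE h)).f n x) := dif_pos h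

lemma unitFamily_eq_zero {n : ℤ} (x : (𝓕.obj p).X n) (c : FChain P) (q : ℤ)
    (h : c.codim + q ≠ n) : unitFamily 𝓕 p n x c q = 0 := by
  by_cases hc : p ≤ c.last
  · rw [unitFamily_of_le x hc, colHom_of_ne]
    rw [FChain.codim] at h
    omega
  · exact dif_neg hc

lemma dcoch_unitFamily {n : ℤ} (x : (𝓕.obj p).X n) {c : FChain P} (h : p ≤ c.last) (q : ℤ) :
    dcoch (ofDcochHom p (unitFamily 𝓕 p n) unitFamily_eq_zero x) c q =
      colHom c n q ((𝓕.map (homOfLE h)).f n x) :=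
  (dcoch_ofDcochHom _ unitFamily_eq_zero _ h _).trans (unitFamily_of_le x h q)

/-- The twisting of the dual cancels the part of the cochain differential that enlarges chains, by
the sign in `dualIncidence`. Only the internal differential of `𝓕` remains. -/
lemma dcoch_d_unitFamily {n m : ℤ} (hnm : n + 1 = m) (x : (𝓕.obj p).X n) {c : FChain P}
    (hc : p ≤ c.last) {q : ℤ} (hq : c.codim + q = m) :
    dcoch (((dualFunctor.obj (cochainComplex 𝓕 ⊥)).obj p).d n m
        (ofDcochHom p (unitFamily 𝓕 p n) unitFamily_eq_zero x)) c q =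
      colHom c m q ((𝓕.map (homOfLE hc)).f m ((𝓕.obj p).d n m x)) := by
  classical
  subst hnm
  rw [FChain.codim] at hq
  rw [dcoch_d rfl _ hc (sub_add_cancel q 1), dcoch_unitFamily x hc,
    d_colHom (sub_add_cancel q 1) (by omega), smul_add, smul_smul, sgn_mul_sgn, one_smul, add_assoc,
    Finset.smul_sum, ← Finset.sum_add_distrib, Finset.sum_eq_zero, add_zero]
  · congr 1
    exact ConcreteCategory.congr_hom ((𝓕.map (homOfLE hc)).comm n (n + 1)) x
  · intro c' _
    by_cases h : c.support ⊆ c'.support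
    · rw [dif_pos h, dcoch_unitFamily x (hc.trans (last_mono h)), dualIncidence, neg_smul, mul_smul]
      have : (𝓕.map (homOfLE (hc.trans (last_mono h)))).f n x =
          (𝓕.map (homOfLE (last_mono h))).f n ((𝓕.map (homOfLE hc)).f n x) := by
        rw [← homOfLE_comp hc (last_mono h), 𝓕.map_comp]
        rfl
      rw [this, add_neg_cancel]
    · rw [incidence_eq_zero fun H => h H.1, dualIncidence_eq_zero fun H => h H.1, zero_smul,
        zero_smul, smul_zero, add_zero]

/-- The unit of the adjunction, at a point. -/
noncomputable def unitMap (𝓕 : P ⥤ CochainComplex AddCommGrpCat.{u} ℤ) (p : P) :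
    𝓕.obj p ⟶ (dualFunctor.obj (cochainComplex 𝓕 ⊥)).obj p where
  f n := AddCommGrpCat.ofHom (ofDcochHom p (unitFamily 𝓕 p n) unitFamily_eq_zero)
  comm' n m h := by
    refine AddCommGrpCat.hom_ext (AddMonoidHom.ext fun x => dcoch_ext fun c q hc hq => ?_)
    exact (dcoch_d_unitFamily h x hc hq).trans (dcoch_unitFamily _ hc q).symm

lemma dcoch_unitMap {n : ℤ} (x : (𝓕.obj p).X n) {c : FChain P} (h : p ≤ c.last) (q : ℤ) :
    dcoch ((unitMap 𝓕 p).f n x) c q = colHom c n q ((𝓕.map (homOfLE h)).f n x) :=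
  dcoch_unitFamily x h q

lemma unitMap_naturality (f : p ⟶ p') :
    𝓕.map f ≫ unitMap 𝓕 p' = unitMap 𝓕 p ≫ (dualFunctor.obj (cochainComplex 𝓕 ⊥)).map f := by
  ext n x
  refine dcoch_ext fun c q hc hq => ?_
  refine (dcoch_unitMap _ hc q).trans (Eq.trans ?_ (dcoch_map f _ hc q).symm)
  refine Eq.trans ?_ (dcoch_unitMap x ((leOfHom f).trans hc) q).symm
  congr 1
  exact ConcreteCategory.congr_hom (HomologicalComplex.congr_hom
    (𝓕.map_comp f (homOfLE hc)) n).symm x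

lemma unitMap_map (τ : 𝓕 ⟶ 𝓖) (p : P) :
    τ.app p ≫ unitMap 𝓖 p = unitMap 𝓕 p ≫ (dualFunctor.map (cochainMap τ le_rfl)).app p := by
  ext n x
  refine dcoch_ext fun c q hc hq => ?_
  refine (dcoch_unitMap _ hc q).trans (Eq.trans ?_ (dcoch_functor_map _ _ hc q).symm)
  refine Eq.trans ?_ (congr_arg _ (dcoch_unitMap x hc q)).symm
  rw [colHom_map]
  congr 1
  exact ConcreteCategory.congr_hom (HomologicalComplex.congr_hom
    (τ.naturality (homOfLE hc)) n).symm x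

lemma contractMap_naturality (φ : G ⟶ G') :
    cochainMap (dualFunctor.map φ) (le_refl (⊥ : WithBot P)) ≫ contractMap G' =
      contractMap G ≫ φ := by
  ext n x
  refine Eq.trans ?_ (map_sum (φ.f n).hom _ _).symm
  exact Finset.sum_congr rfl fun c _ => dcoch_functor_map φ _ le_rfl n

/-- The unit of the adjunction. -/
noncomputable def unitNat (𝓕 : P ⥤ CochainComplex AddCommGrpCat.{u} ℤ) :
    𝓕 ⟶ dualFunctor.obj (cochainComplex 𝓕 ⊥) where
  app := unitMap 𝓕
  naturality _ _ f := unitMap_naturality f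

/-- The composite replaces a cochain by the sum of its columns. -/
lemma cochainMap_unitNat_contractMap (𝓕 : P ⥤ CochainComplex AddCommGrpCat.{u} ℤ) :
    cochainMap (unitNat 𝓕) (le_refl (⊥ : WithBot P)) ≫ contractMap (cochainComplex 𝓕 ⊥) = 𝟙 _ := by
  ext n x
  refine Eq.trans (Finset.sum_congr rfl fun c _ => ?_) (sum_colHom x)
  refine (dcoch_unitMap _ le_rfl n).trans ?_
  congr 1
  exact ConcreteCategory.congr_hom (HomologicalComplex.congr_hom
    (𝓕.map_id c.last) (n - c.dim)) _

/-- At a chain `c`, the composite inserts an element in column `c` and contracts it again, which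
reads off its coordinate at `c`. -/
lemma unitMap_dualFunctor_map (p : P) :
    unitMap (dualFunctor.obj G) p ≫ (dualFunctor.map (contractMap G)).app p = 𝟙 _ := by
  ext n x
  refine dcoch_ext fun c q hc hq => ?_
  refine (dcoch_functor_map _ _ hc q).trans ?_
  refine (congr_arg _ (dcoch_unitMap x hc q)).trans ?_
  refine (contract_colHom c (by rw [FChain.codim] at hq; omega) _).trans ?_
  exact dcoch_map _ _ le_rfl q

/-- The functor of cochains is left adjoint to `dualFunctor`. -/
noncomputable def dualAdjunction : cochainFunctor (P := P) ⊥ ⊣ dualFunctor :=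
  Adjunction.mkOfUnitCounit
    { unit :=
        { app := unitNat
          naturality := fun 𝓕 𝓖 τ => by
            ext p : 2
            exact unitMap_map τ p }
      counit :=
        { app := contractMap
          naturality := fun G G' φ => contractMap_naturality φ }
      left_triangle := by
        ext 𝓕 : 2
        refine Eq.trans ?_ (cochainMap_unitNat_contractMap 𝓕)
        exact congr_arg (_ ≫ ·) (Category.id_comp _)
      right_triangle := by
        ext G p : 4
        refine Eq.trans ?_ (unitMap_dualFunctor_map p)
        exact congr_arg (_ ≫ ·) (Category.id_comp _) }

end Adjunction

end FiniteSpace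

namespace FiniteSpace

/-! ### Passage to derived categories and uniqueness of the dualizing complex. -/

section DerivedDual

variable (X : Type u) [TopologicalSpace X] [Finite X] [T0Space X]

/-- The right adjoint of the functor of cochains, with values in complexes of abelian data. -/
noncomputable def dualComplexFunctor :
    CochainComplex AddCommGrpCat.{u} ℤ ⥤ CochainComplex (AbData X) ℤ :=
  dualFunctor ⋙ ofDiagram X

/-- The functor of cochains on complexes of abelian data has a right adjoint. -/
noncomputable def dualComplexAdjunction : sectionsCochain X ⊣ dualComplexFunctor X :=
  (functorComplexEquivalence (Specialization X) AddCommGrpCat.{u}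
    (ComplexShape.up ℤ)).toAdjunction.comp dualAdjunction

lemma quasiIso_dualComplexFunctor_map {G G' : CochainComplex AddCommGrpCat.{u} ℤ} (φ : G ⟶ G')
    [QuasiIso φ] : QuasiIso ((dualComplexFunctor X).map φ) := by
  rw [quasiIso_iff_app]
  exact fun p => quasiIso_dualFunctor_map φ p

variable [HasDerivedCategory.{w₁} (AbData X)]

lemma isInvertedBy_dualComplexFunctor :
    (HomologicalComplex.quasiIso AddCommGrpCat.{u} (ComplexShape.up ℤ)).IsInvertedBy
      (dualComplexFunctor X ⋙ DerivedCategory.Q) := by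
  intro K L f hf
  have : QuasiIso f := hf
  have := quasiIso_dualComplexFunctor_map X f
  exact inferInstanceAs (IsIso (DerivedCategory.Q.map ((dualComplexFunctor X).map f)))

variable [HasDerivedCategory.{w₂} AddCommGrpCat.{u}]

/-- The right adjoint of the derived functor of the functor of global sections. -/
noncomputable def derivedDual :
    DerivedCategory AddCommGrpCat.{u} ⥤ DerivedCategory (AbData X) :=
  Localization.lift (dualComplexFunctor X ⋙ DerivedCategory.Q) (isInvertedBy_dualComplexFunctor X)
    DerivedCategory.Q

noncomputable instance :
    CatCommSq (dualComplexFunctor X) DerivedCategory.Q DerivedCategory.Q (derivedDual X) where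
  iso := (Localization.fac _ (isInvertedBy_dualComplexFunctor X) DerivedCategory.Q).symm

/-- The derived functor of the functor of global sections has a right adjoint. -/
noncomputable def derivedDualAdjunction : derivedSections X ⊣ derivedDual X :=
  (dualComplexAdjunction X).localization DerivedCategory.Q
    (HomologicalComplex.quasiIso _ _) DerivedCategory.Q (HomologicalComplex.quasiIso _ _) _ _

/-- An explicit complex which is a dualizing complex. -/
noncomputable def dualizingComplex : CochainComplex (AbData X) ℤ :=
  (dualComplexFunctor X).obj ((CochainComplex.singleFunctor AddCommGrpCat.{u} 0).obj zGroup)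

/-- The dualizing complex is the value at `ℤ` of the right adjoint. -/
noncomputable def derivedDualObjIso :
    (derivedDual X).obj ((DerivedCategory.singleFunctor AddCommGrpCat.{u} 0).obj zGroup) ≅
      DerivedCategory.Q.obj (dualizingComplex X) :=
  (derivedDual X).mapIso ((DerivedCategory.singleFunctorIsoCompQ _ 0).app zGroup) ≪≫
    ((CatCommSq.iso (dualComplexFunctor X) DerivedCategory.Q DerivedCategory.Q
      (derivedDual X)).app _).symm

/-- The right adjoint represents the dual of the derived functor. -/
noncomputable def derivedDualRepresentableBy :
    ((derivedSections X).op ⋙ yoneda.obj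
      ((DerivedCategory.singleFunctor AddCommGrpCat.{u} 0).obj zGroup)).RepresentableBy
        (DerivedCategory.Q.obj (dualizingComplex X)) :=
  ((derivedDualAdjunction X).representableBy _).ofIsoObj (derivedDualObjIso X).symm

variable {X}

lemma isDualizingComplex_dualizingComplex :
    IsDualizingComplex (DerivedCategory.Q.obj (dualizingComplex X)) :=
  ⟨derivedSections X, derivedSectionsUnit X, isRightDerivedFunctor_derivedSections X,
    ⟨derivedDualRepresentableBy X⟩⟩

/-- Any two right derived functors are isomorphic, hence so are the functors they define by duality,
and a representing object is unique. -/
lemma IsDualizingComplex.nonempty_iso {D : DerivedCategory (AbData X)}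
    (hD : IsDualizingComplex D) :
    Nonempty (D ≅ DerivedCategory.Q.obj (dualizingComplex X)) := by
  obtain ⟨RΓ, α, hα, ⟨h⟩⟩ := hD
  have := isRightDerivedFunctor_derivedSections X
  let e := Functor.rightDerivedUnique RΓ (derivedSections X) α (derivedSectionsUnit X)
    (HomologicalComplex.quasiIso (AbData X) (ComplexShape.up ℤ))
  exact ⟨h.uniqueUpToIso ((derivedDualRepresentableBy X).ofIso
    (Functor.isoWhiskerRight (NatIso.op e) _))⟩

end DerivedDual

end FiniteSpace

namespace FiniteSpace

/-! ### Increasing sequences versus chains as finite sets. -/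

section Chains

variable {X : Type u} [TopologicalSpace X]

lemma mem_closure_singleton_iff (x : X) (y : Specialization X) :
    Specialization.ofEquiv y ∈ closure {x} ↔ y ≤ Specialization.toEquiv x :=
  specializes_iff_mem_closure.symm.trans Specialization.ofEquiv_specializes_ofEquiv

lemma Chain.length_le_card [Finite X] {p : ℕ} (c : Chain X p) : p + 1 ≤ Nat.card X := by
  have := Nat.card_le_card_of_injective c.1 c.2.injective
  rwa [Nat.card_fin] at this

/-- The supremum defining `dim` is meaningful because the cardinality of `X` bounds the length of
chains. -/
lemma Chain.length_le_dim [Finite X] {p : ℕ} (c : Chain X p) : p ≤ dim X :=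
  le_csSup ⟨Nat.card X, fun _ ⟨c⟩ => (Nat.le_succ _).trans c.length_le_card⟩ ⟨c⟩

variable [T0Space X]

/-- The chain of points underlying an increasing sequence. -/
def Chain.toFChain {p : ℕ} (c : Chain X p) : FChain (Specialization X) where
  support := Finset.univ.map ⟨c.1, c.2.injective⟩
  nonempty := Finset.univ_nonempty.map
  isTotal x hx y hy := by
    obtain ⟨i, _, rfl⟩ := Finset.mem_map.1 hx
    obtain ⟨j, _, rfl⟩ := Finset.mem_map.1 hy
    exact (le_total i j).imp (fun h => c.2.monotone h) fun h => c.2.monotone h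

lemma Chain.dim_toFChain {p : ℕ} (c : Chain X p) : c.toFChain.dim = p := by
  simp [FChain.dim, Chain.toFChain]

lemma Chain.neg_dim_toFChain {p : ℕ} (c : Chain X p) : -c.toFChain.dim = -(p : ℤ) := by
  rw [c.dim_toFChain]

lemma Chain.last_toFChain {p : ℕ} (c : Chain X p) :
    c.toFChain.last = Specialization.toEquiv c.last := by
  refine le_antisymm ?_ (c.toFChain.le_last (Finset.mem_map_of_mem _ (Finset.mem_univ _)))
  obtain ⟨i, _, hi⟩ := Finset.mem_map.1 c.toFChain.last_mem
  rw [← hi]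
  exact c.2.monotone (Fin.le_last i)

lemma Chain.toFChain_injective (p : ℕ) :
    Function.Injective (Chain.toFChain : Chain X p → FChain (Specialization X)) := by
  intro c c' h
  refine Subtype.ext ((StrictMono.range_inj c.2 c'.2).1 ?_)
  have := congr_arg (fun d => (d.support : Set (Specialization X))) h
  simpa [Chain.toFChain] using this

/-- The support of a chain is linearly ordered with `p + 1` elements, so it has an increasing
enumeration by `Fin (p + 1)`. -/
lemma Chain.exists_toFChain_eq {p : ℕ} (d : FChain (Specialization X)) (hd : d.dim = p) :
    ∃ c : Chain X p, c.toFChain = d := by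
  classical
  let : LinearOrder d.support :=
    { (inferInstance : PartialOrder d.support) with
      le_total := fun x y => d.isTotal x x.2 y y.2
      toDecidableLE := Classical.decRel _ }
  have hcard : Fintype.card d.support = p + 1 := by
    rw [FChain.dim] at hd
    rw [Fintype.card_coe]
    omega
  let e := Fintype.orderIsoFinOfCardEq d.support hcard
  refine ⟨⟨fun i => e i, fun i j hij => e.strictMono hij⟩, FChain.ext ?_⟩
  ext x
  simp only [Chain.toFChain, Finset.mem_map, Finset.mem_univ, true_and,
    Function.Embedding.coeFn_mk]
  exact ⟨fun ⟨i, hi⟩ => hi ▸ (e i).2, fun hx => ⟨e.symm ⟨x, hx⟩, by simp⟩⟩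

lemma FChain.dim_le_dim [Finite X] (d : FChain (Specialization X)) :
    d.dim ≤ FiniteSpace.dim X := by
  obtain ⟨p, hp⟩ := Int.eq_ofNat_of_zero_le d.dim_nonneg
  obtain ⟨c, -⟩ := Chain.exists_toFChain_eq d hp
  have := c.length_le_dim
  omega

end Chains

/-! ### The terms of the dualizing complex. -/

section Terms

variable {X : Type u} [TopologicalSpace X] [Finite X] [T0Space X]

open FChain

/-- The group of integers, as a complex concentrated in degree zero. -/
noncomputable abbrev zComplex : CochainComplex AddCommGrpCat.{u} ℤ :=
  (HomologicalComplex.single AddCommGrpCat.{u} (ComplexShape.up ℤ) 0).obj zGroup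

/-- The degree zero term of `zComplex`. -/
noncomputable def zComplexEquiv : zComplex.{u}.X 0 ≃+ ULift.{u} ℤ :=
  (HomologicalComplex.singleObjXSelf (ComplexShape.up ℤ) 0 zGroup).addCommGroupIsoToAddEquiv

lemma zComplex_eq_zero {q : ℤ} (hq : q ≠ 0) (x : zComplex.{u}.X q) : x = 0 := by
  have := AddCommGrpCat.subsingleton_of_isZero
    (HomologicalComplex.isZero_single_obj_X (ComplexShape.up ℤ) 0 zGroup.{u} q hq)
  exact Subsingleton.elim _ _

/-- The coordinates of an element of a stalk of the dualizing complex. -/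
noncomputable def coord {y : Specialization X} {n : ℤ} (c : FChain (Specialization X)) :
    ((dualizingComplex X).X n).obj y →+ ULift.{u} ℤ :=
  zComplexEquiv.toAddMonoidHom.comp (dcochEval (G := zComplex) c 0)

/-- The coefficient complex `ℤ` lives in degree zero, so in total degree `n` only columns with
`-c.dim = n` contribute. -/
lemma coord_ext {y : Specialization X} {n : ℤ} {v w : ((dualizingComplex X).X n).obj y}
    (h : ∀ c : FChain (Specialization X), y ≤ c.last → -c.dim = n → coord c v = coord c w) :
    v = w := by
  refine dcoch_ext (G := zComplex) fun c q hc hq => ?_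
  by_cases h0 : q = 0
  · subst h0
    rw [add_zero, FChain.codim] at hq
    exact zComplexEquiv.injective (h c hc hq)
  · exact (zComplex_eq_zero h0 _).trans (zComplex_eq_zero h0 _).symm

lemma coord_of_not_le {y : Specialization X} {n : ℤ} {c : FChain (Specialization X)}
    (h : ¬ y ≤ c.last) (v : ((dualizingComplex X).X n).obj y) : coord c v = 0 :=
  (congr_arg zComplexEquiv (dualColEval_of_not_le h 0 _)).trans (map_zero zComplexEquiv)

lemma coord_map {y y' : Specialization X} {n : ℤ} (f : y ⟶ y') {c : FChain (Specialization X)}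
    (h : y' ≤ c.last) (v : ((dualizingComplex X).X n).obj y) :
    coord c (((dualizingComplex X).X n).map f v) = coord c v :=
  congr_arg zComplexEquiv (dcoch_map (G := zComplex) f v h 0)

open scoped Classical in
/-- The family with a single nonzero element. -/
noncomputable def singleDual (c : FChain (Specialization X)) :
    ULift.{u} ℤ →+ DualFamily zComplex.{u} (Specialization X) where
  toFun g c' q := if c' = c then homog zComplex 0 (zComplexEquiv.symm g) q else 0
  map_zero' := by
    ext c' q
    simp only [map_zero, Pi.zero_apply, ite_self]
  map_add' g g' := by
    ext c' q
    by_cases h : c' = c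
    · simp only [if_pos h, map_add, Pi.add_apply]
    · simp only [if_neg h, add_zero, Pi.add_apply]

omit [Finite X] in
lemma singleDual_same (c : FChain (Specialization X)) (g : ULift.{u} ℤ) (q : ℤ) :
    singleDual c g c q = homog zComplex 0 (zComplexEquiv.symm g) q := if_pos rfl

omit [Finite X] in
lemma singleDual_of_ne {c c' : FChain (Specialization X)} (h : c' ≠ c) (g : ULift.{u} ℤ) (q : ℤ) :
    singleDual c g c' q = 0 := if_neg h

/-- The element of a stalk of the dualizing complex with a single nonzero coordinate. -/
noncomputable def ofCoord (y : Specialization X) {n : ℤ} (c : FChain (Specialization X))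
    (h : -c.dim = n) : ULift.{u} ℤ →+ ((dualizingComplex X).X n).obj y :=
  ofDcochHom (G := zComplex) y (singleDual c) fun g c' q h' => by
    by_cases hc : c' = c
    · subst hc
      refine (singleDual_same _ _ _).trans (homog_of_ne ?_ _)
      rw [FChain.codim] at h'
      omega
    · exact singleDual_of_ne hc _ _

lemma coord_ofCoord_self {y : Specialization X} {n : ℤ} {c : FChain (Specialization X)}
    (h : -c.dim = n) (hc : y ≤ c.last) (g : ULift.{u} ℤ) : coord c (ofCoord y c h g) = g := by
  refine (congr_arg zComplexEquiv (dcoch_ofDcochHom (G := zComplex) _ _ _ hc 0)).trans ?_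
  refine (congr_arg zComplexEquiv (singleDual_same c g 0)).trans ?_
  refine (congr_arg zComplexEquiv (homog_same 0 _)).trans ?_
  exact zComplexEquiv.apply_symm_apply g

lemma coord_ofCoord_of_ne {y : Specialization X} {n : ℤ} {c c' : FChain (Specialization X)}
    (h : -c.dim = n) (hc : c' ≠ c) (g : ULift.{u} ℤ) : coord c' (ofCoord y c h g) = 0 := by
  by_cases hy : y ≤ c'.last
  · refine (congr_arg zComplexEquiv (dcoch_ofDcochHom (G := zComplex) _ _ _ hy 0)).trans ?_
    refine (congr_arg zComplexEquiv (singleDual_of_ne hc g 0)).trans ?_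
    exact map_zero zComplexEquiv
  · exact coord_of_not_le hy _

/-- The projection of the dualizing complex corresponding to a chain. -/
noncomputable def termπ {p : ℕ} (c : Chain X p) :
    (dualizingComplex X).X (-(p : ℤ)) ⟶ zClosure c.last where
  app y := AddCommGrpCat.ofHom ((coord c.toFChain).codRestrict
    (supportSubgroup (constData X zGroup.{u}) (closure {c.last}) y) fun v hy =>
      coord_of_not_le (fun h => hy ((mem_closure_singleton_iff _ _).2
        (h.trans_eq c.last_toFChain))) v)
  naturality y y' f := by
    ext v
    refine Subtype.ext ?_
    by_cases h : y' ≤ Specialization.toEquiv c.last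
    · refine (coord_map f (h.trans_eq c.last_toFChain.symm) v).trans ?_
      exact (if_pos ((mem_closure_singleton_iff _ _).2 h)).symm
    · refine (coord_of_not_le (fun h' => h (h'.trans_eq c.last_toFChain)) _).trans ?_
      exact (if_neg fun h' => h ((mem_closure_singleton_iff _ _).1 h')).symm

/-- The inclusion in the dualizing complex corresponding to a chain. -/
noncomputable def termι {p : ℕ} (c : Chain X p) :
    zClosure c.last ⟶ (dualizingComplex X).X (-(p : ℤ)) where
  app y := AddCommGrpCat.ofHom ((ofCoord y c.toFChain c.neg_dim_toFChain).comp
    (supportSubgroup (constData X zGroup.{u}) (closure {c.last}) y).subtype)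
  naturality y y' f := by
    ext v
    refine coord_ext fun d hd _ => ?_
    refine Eq.trans ?_ (coord_map f hd _).symm
    by_cases h : d = c.toFChain
    · subst h
      refine (coord_ofCoord_self c.neg_dim_toFChain hd _).trans (Eq.trans ?_ (coord_ofCoord_self c.neg_dim_toFChain
        ((leOfHom f).trans hd) _).symm)
      exact if_pos ((mem_closure_singleton_iff _ _).2 (hd.trans_eq c.last_toFChain))
    · exact (coord_ofCoord_of_ne c.neg_dim_toFChain h _).trans (coord_ofCoord_of_ne c.neg_dim_toFChain h _).symm

variable (X) in
/-- The terms of the dualizing complex, as biproducts. -/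
noncomputable def termBicone (p : ℕ) : Bicone fun c : Chain X p => zClosure c.last where
  pt := (dualizingComplex X).X (-(p : ℤ))
  π := termπ
  ι := termι
  ι_π c c' := by
    by_cases h : c = c'
    · subst h
      rw [dif_pos rfl]
      ext y v
      refine Subtype.ext ?_
      by_cases hy : y ≤ Specialization.toEquiv c.last
      · exact coord_ofCoord_self c.neg_dim_toFChain (hy.trans_eq c.last_toFChain.symm) _
      · refine (coord_of_not_le (fun h' => hy (h'.trans_eq c.last_toFChain)) _).trans ?_
        exact (v.2 fun h' => hy ((mem_closure_singleton_iff _ _).1 h')).symm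
    · rw [dif_neg h]
      ext y v
      exact Subtype.ext (coord_ofCoord_of_ne c.neg_dim_toFChain (fun h' => h (Chain.toFChain_injective p h').symm) _)

/-- The coordinates of the values of an endomorphism of a term of the dualizing complex. -/
noncomputable def endCoord {n : ℤ} {y : Specialization X} (d : FChain (Specialization X))
    (v : ((dualizingComplex X).X n).obj y) :
    ((dualizingComplex X).X n ⟶ (dualizingComplex X).X n) →+ ULift.{u} ℤ where
  toFun φ := coord d (φ.app y v)
  map_zero' := map_zero (coord d)
  map_add' φ ψ := map_add (coord d) (φ.app y v) (ψ.app y v)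

lemma termBicone_total (p : ℕ) [Fintype (Chain X p)] :
    ∑ c, (termBicone X p).π c ≫ (termBicone X p).ι c = 𝟙 (termBicone X p).pt := by
  ext y v
  refine coord_ext fun d hd hdim => ?_
  obtain ⟨c, rfl⟩ := Chain.exists_toFChain_eq d (p := p) (by omega)
  refine (map_sum (endCoord c.toFChain v) _ _).trans ?_
  rw [Finset.sum_eq_single c]
  · exact coord_ofCoord_self c.neg_dim_toFChain hd _
  · intro c' _ hc
    exact coord_ofCoord_of_ne c'.neg_dim_toFChain
      (fun h => hc (Chain.toFChain_injective p h).symm) _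
  · simp

variable (X) in
/-- The terms of the dualizing complex are sums of abelian data supported on closures of points. -/
lemma nonempty_term_iso (p : ℕ) :
    Nonempty ((dualizingComplex X).X (-(p : ℤ)) ≅ ⨁ fun c : Chain X p => zClosure c.last) := by
  have := Fintype.ofFinite (Chain X p)
  exact ⟨biproduct.uniqueUpToIso _ (isBilimitOfTotal (termBicone X p) (termBicone_total p))⟩

variable (X) in
-- The coordinates in degree `i` are indexed by chains of dimension `-i`, and none exist outside the
-- interval.
lemma isZero_dualizingComplex_X (i : ℤ) (hi : i ∉ Set.Icc (-(FiniteSpace.dim X : ℤ)) 0) :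
    IsZero ((dualizingComplex X).X i) := by
  refine Functor.isZero _ fun y => ?_
  have : Subsingleton (((dualizingComplex X).X i).obj y) := by
    refine ⟨fun v w => coord_ext fun d _ hd => (hi ?_).elim⟩
    have := d.dim_nonneg
    have := d.dim_le_dim
    constructor <;> omega
  exact AddCommGrpCat.isZero_of_subsingleton _

/-- The vector of the coordinates of an element of a stalk of the dualizing complex. -/
noncomputable def coords (n : ℤ) (y : Specialization X) :
    ((dualizingComplex X).X n).obj y →+ (FChain (Specialization X) → ULift.{u} ℤ) :=
  AddMonoidHom.mk' (fun v c => coord c v) fun v w => funext fun c => map_add (coord c) v w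

lemma coords_injective (n : ℤ) (y : Specialization X) : Function.Injective (coords n y) :=
  fun _ _ h => coord_ext fun c _ _ => congr_fun h c

/-- The coordinates embed the stalk in a finite power of `ℤ`. -/
lemma isNoetherian_dualizingComplex (n : ℤ) (y : Specialization X) :
    IsNoetherian ℤ (((dualizingComplex X).X n).obj y) := by
  have : IsNoetherian ℤ (ULift.{u} ℤ) := isNoetherian_of_linearEquiv ULift.moduleEquiv.symm
  exact isNoetherian_of_injective (coords n y).toIntLinearMap (coords_injective n y)

end Terms

end FiniteSpace

/-! ### Finite type, amplitude and conclusion. -/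

namespace FiniteSpace

lemma fg_homology (L : CochainComplex AddCommGrpCat.{u} ℤ) (i : ℤ) [IsNoetherian ℤ (L.X i)] :
    AddGroup.FG (L.homology i) := by
  have h₁ : Function.Injective (L.iCycles i) :=
    (AddCommGrpCat.mono_iff_injective _).1 inferInstance
  have h₂ : Function.Surjective (L.homologyπ i) :=
    (AddCommGrpCat.epi_iff_surjective _).1 inferInstance
  have : IsNoetherian ℤ (L.cycles i) :=
    isNoetherian_of_injective (L.iCycles i).hom.toIntLinearMap h₁
  have : Module.Finite ℤ (L.homology i) :=
    Module.Finite.of_surjective (L.homologyπ i).hom.toIntLinearMap h₂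
  exact Module.Finite.iff_addGroup_fg.1 this

lemma fg_of_iso {A B : AddCommGrpCat.{u}} (e : A ≅ B) (h : AddGroup.FG A) : AddGroup.FG B :=
  AddGroup.fg_of_surjective (f := e.addCommGroupIsoToAddEquiv.toAddMonoidHom)
    e.addCommGroupIsoToAddEquiv.surjective

section Conclusion

variable {X : Type u} [TopologicalSpace X]
  [HasDerivedCategory.{w₁} (AbData X)] [HasDerivedCategory.{w₂} AddCommGrpCat.{u}]

/-- Evaluation at a point is exact, so the stalk is represented by the complex of termwise stalks;
its cohomology consists of subquotients of noetherian groups. -/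
lemma isOfFiniteType_Q_obj (K : CochainComplex (AbData X) ℤ)
    (h : ∀ (i : ℤ) (y : Specialization X), IsNoetherian ℤ ((K.X i).obj y)) :
    IsOfFiniteType (DerivedCategory.Q.obj K) := by
  intro i x
  let ev := (evaluation (Specialization X) AddCommGrpCat.{u}).obj (Specialization.toEquiv x)
  have : IsNoetherian ℤ (((ev.mapHomologicalComplex (ComplexShape.up ℤ)).obj K).X i) := h i _
  let e : stalk x (DerivedCategory.Q.obj K) ≅
      DerivedCategory.Q.obj ((ev.mapHomologicalComplex (ComplexShape.up ℤ)).obj K) :=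
    ev.mapDerivedCategoryFactors.app K
  exact fg_of_iso ((DerivedCategory.homologyFunctor AddCommGrpCat.{u} i).mapIso e ≪≫
    (DerivedCategory.homologyFunctorFactors AddCommGrpCat.{u} i).app _).symm (fg_homology _ i)

lemma IsOfFiniteType.of_iso {D D' : DerivedCategory (AbData X)} (e : D ≅ D')
    (h : IsOfFiniteType D) : IsOfFiniteType D' := fun i x =>
  fg_of_iso ((((evaluation (Specialization X) AddCommGrpCat.{u}).obj
    (Specialization.toEquiv x)).mapDerivedCategory ⋙
      DerivedCategory.homologyFunctor AddCommGrpCat.{u} i).mapIso e) (h i x)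

omit [HasDerivedCategory.{w₂} AddCommGrpCat.{u}] in
lemma hasAmplitude_Q_obj (K : CochainComplex (AbData X) ℤ) (a b : ℤ)
    (h : ∀ i : ℤ, i ∉ Set.Icc a b → IsZero (K.X i)) :
    HasAmplitude (DerivedCategory.Q.obj K) a b := fun i hi => by
  refine IsZero.of_iso ?_ ((DerivedCategory.homologyFunctorFactors (AbData X) i).app K)
  exact (ShortComplex.exact_iff_isZero_homology _).1
    (ShortComplex.exact_of_isZero_X₂ (K.sc i) (h i hi))

omit [HasDerivedCategory.{w₂} AddCommGrpCat.{u}] in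
lemma HasAmplitude.of_iso {D D' : DerivedCategory (AbData X)} (e : D ≅ D') {a b : ℤ}
    (h : HasAmplitude D a b) : HasAmplitude D' a b := fun i hi =>
  (h i hi).of_iso ((DerivedCategory.homologyFunctor (AbData X) i).mapIso e.symm)

end Conclusion

end FiniteSpace

theorem mainTheorem7 (X : Type u) [TopologicalSpace X] [Finite X] [T0Space X]
    [HasDerivedCategory.{w₁} (FiniteSpace.AbData X)]
    [HasDerivedCategory.{w₂} AddCommGrpCat.{u}] :
    (∃ D : DerivedCategory (FiniteSpace.AbData X), FiniteSpace.IsDualizingComplex D) ∧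
      ∀ D : DerivedCategory (FiniteSpace.AbData X), FiniteSpace.IsDualizingComplex D →
        (∃ K : CochainComplex (FiniteSpace.AbData X) ℤ,
          (∀ p : ℕ, Nonempty (K.X (-(p : ℤ)) ≅
            ⨁ fun c : FiniteSpace.Chain X p => FiniteSpace.zClosure c.last)) ∧
          (∀ i : ℤ, i ∉ Set.Icc (-(FiniteSpace.dim X : ℤ)) 0 → IsZero (K.X i)) ∧
          Nonempty (D ≅ DerivedCategory.Q.obj K)) ∧
        FiniteSpace.IsOfFiniteType D ∧
        FiniteSpace.HasAmplitude D (-(FiniteSpace.dim X : ℤ)) 0 := by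
  refine ⟨⟨_, FiniteSpace.isDualizingComplex_dualizingComplex⟩, fun D hD => ?_⟩
  -- Every property is checked on the explicit complex and carried along this isomorphism.
  obtain ⟨e⟩ := hD.nonempty_iso
  have hK := FiniteSpace.isZero_dualizingComplex_X X
  exact ⟨⟨FiniteSpace.dualizingComplex X, FiniteSpace.nonempty_term_iso X, hK, ⟨e⟩⟩,
    (FiniteSpace.isOfFiniteType_Q_obj _ FiniteSpace.isNoetherian_dualizingComplex).of_iso e.symm,
    (FiniteSpace.hasAmplitude_Q_obj _ _ _ hK).of_iso e.symm⟩
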